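/- **Setting.** For each $m\in\mathbb N$ let $G_{1}^{(m)},G_{2}^{(m)}$ be arbitrary (deterministic) connected graphs with $n_1=n_1(m)$ and $n_2=n_2(m)$ nodes, where $n_1,n_2\to\infty$ and distinct $m$ give distinct pairs $(n_1,n_2)$; put $n=n_1+n_2$, $n_{\min}=\min(n_1,n_2)$, $n_{\max}=\max(n_1,n_2)$. For $p\in[0,1]$ join node $u$ of $G_1^{(m)}$ and node $v$ of $G_2^{(m)}$ by an edge exactly when $[\mathbf C^{(m)}]_{uv}=1$, where for each $m$ the entries of the $n_1\times n_2$ matrix $\mathbf C^{(m)}$ are i.i.d. Bernoulli($p$) (the joint law of the matrices for different $m$ is arbitrary). Let $\mathbf L$ be the graph Laplacian (degree matrix minus adjacency matrix) of the resulting graph on $n$ nodes, $\mathbf L_k$ that of $G_k^{(m)}$, and $\lambda_2(\cdot)$ the second smallest eigenvalue, with multiplicity. Let $\mathbf y=[\mathbf y_1^T\ \mathbf y_2^T]^T$ (with $\mathbf y_k\in\mathbb R^{n_k}$) be any minimizer of $\mathbf x^T\mathbf L\mathbf x$ subject to $\mathbf x^T\mathbf x=1$, $\mathbf x^T\mathbf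 1_n=0$. Suppose that the limits $n_{\min}/n_{\max}\to c>0$, $n_k/n\to\rho_k$ and $\lambda_2(\mathbf L_k)/n\to\ell_k$ ($k=1,2$) exist, and let $$c^*=\lim\frac{\lambda_2(\mathbf L_1)+\lambda_2(\mathbf L_2)-|\lambda_2(\mathbf L_1)-\lambda_2(\mathbf L_2)|}{2n}.$$ **Statement.** There is a critical value $p^*\in\mathbb R$, depending only on the sequence of cluster pairs, such that for every $p\in[0,1]$ the following holds almost surely as $m\to\infty$. (a) If $p\le p^*$, then $\lambda_2(\mathbf L)/n\to p$. If $p>p^*$, then asymptotically $$c^*+\frac{c}{1+c}\,p\ \le\ \frac{\lambda_2(\mathbf L)}{n}\ \le\ c^*+\frac{1}{1+c}\,p,$$ that is, for every $\varepsilon>0$ both inequalities hold up to an error $\varepsilon$ for all large $m$. (b) If $p<p^*$, then for every choice of the minimizers there are signs $\sigma=\sigma(m)\in\{1,-1\}$ with $$\sqrt{\tfrac{n n_1}{n_2}}\;\mathbf y_1-\sigma\mathbf 1_{n_1}\to 0\quad\text{and}\quad \sqrt{\tfrac{n n_2}{n_1}}\;\mathbf y_2+\sigma\mathbf 1_{n_2}\to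 0$$ uniformly over the entries (in the maximum norm), and moreover $\big\|\mathbf y_1-\sigma\sqrt{\tfrac{n_2}{n n_1}}\,\mathbf 1_{n_1}\big\|_2\to0$ and $\big\|\mathbf y_2+\sigma\sqrt{\tfrac{n_1}{n n_2}}\,\mathbf 1_{n_2}\big\|_2\to0$. If $p>p^*$, then $\mathbf y_1^T\mathbf 1_{n_1}\to0$ and $\mathbf y_2^T\mathbf 1_{n_2}\to0$ for every choice of the minimizers. (c) $\displaystyle \frac{2c^*}{1+|\rho_1-\rho_2|}\le p^*\le\frac{2c^*}{1-|\rho_1-\rho_2|}.$ -/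

import Mathlib

open MeasureTheory ProbabilityTheory Filter Topology

noncomputable section

/-- The graph Laplacian `D - A` of a finite simple graph, as a real matrix. -/
def graphLaplacian {V : Type*} [Fintype V] (G : SimpleGraph V) : Matrix V V ℝ := by
  classical exact G.lapMatrix ℝ

theorem graphLaplacian_isHermitian {V : Type*} [Fintype V] (G : SimpleGraph V) :
    (graphLaplacian G).IsHermitian := by
  classical exact G.isHermitian_lapMatrix (R := ℝ)

open Classical in
/-- `lambda2 G` is the second smallest eigenvalue, counted with multiplicity, of the graph
Laplacian of `G` (with the value `0` for graphs with fewer than two nodes). Mathlib lists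
eigenvalues in decreasing order, so this is the entry of index `card V - 2`. -/
def lambda2 {V : Type*} [Fintype V] (G : SimpleGraph V) : ℝ :=
  if h : 2 ≤ Fintype.card V then
    (graphLaplacian_isHermitian G).eigenvalues₀ ⟨Fintype.card V - 2, by omega⟩
  else 0

/-- The graph made of two clusters: internal edges `G` on `V`, internal edges `H` on `W`, and
between `u : V` and `v : W` an edge exactly when the entry `C u v` of the interconnection matrix
is `1` (`true`). -/
def twoClusterGraph {V W : Type*} (G : SimpleGraph V) (H : SimpleGraph W) (C : V → W → Bool) :
    SimpleGraph (V ⊕ W) where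
  Adj x y :=
    match x, y with
    | Sum.inl u, Sum.inl u' => G.Adj u u'
    | Sum.inl u, Sum.inr v => C u v = true
    | Sum.inr v, Sum.inl u => C u v = true
    | Sum.inr v, Sum.inr v' => H.Adj v v'
  symm := by
    constructor
    rintro (u | v) (u' | v') h
    · exact SimpleGraph.Adj.symm h
    · exact h
    · exact h
    · exact SimpleGraph.Adj.symm h
  loopless := by
    constructor
    rintro (u | v) h
    · exact G.irrefl h
    · exact H.irrefl h

/-- The entries of the random matrix `C` are i.i.d. Bernoulli with parameter `p`. -/
structure IsIIDBernoulli {Ω : Type*} [MeasurableSpace Ω] (P : Measure Ω) {V W : Type*}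
    (C : Ω → V → W → Bool) (p : ℝ) : Prop where
  measurable : ∀ u v, Measurable fun ω => C ω u v
  prob : ∀ u v, P {ω | C ω u v = true} = ENNReal.ofReal p
  indep : iIndepFun (fun (e : V × W) (ω : Ω) => C ω e.1 e.2) P

/-- `y` is feasible for the two-cluster spectral clustering problem: unit length and centred. -/
def IsFeasible {V : Type*} [Fintype V] (y : V → ℝ) : Prop :=
  ∑ i, y i ^ 2 = 1 ∧ ∑ i, y i = 0

/-- `y` solves the two-cluster spectral clustering problem for the graph `G`:
it minimizes `xᵀ L x` over all centred unit vectors `x`, where `L` is the graph Laplacian. -/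
def IsSpectralSolution {V : Type*} [Fintype V] (G : SimpleGraph V) (y : V → ℝ) : Prop :=
  IsFeasible y ∧ ∀ x : V → ℝ, IsFeasible x →
    y ⬝ᵥ (graphLaplacian G).mulVec y ≤ x ⬝ᵥ (graphLaplacian G).mulVec x

/-- The Euclidean norm of a vector indexed by a finite type. -/
def l2norm {ι : Type*} [Fintype ι] (x : ι → ℝ) : ℝ := Real.sqrt (∑ i, x i ^ 2)

end

/-! Put `N = n₁ + n₂` and let `e`, `e'` be the vectors of row and column sums of `C - p`. Replacing
`C` by its mean changes the quadratic form of the Laplacian by `o(N)`, because `C - p` has operator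
norm `O(√N)` and its row and column sums are `O(N^(3/4))`. For the averaged form, a centred unit
vector splits into a multiple of the two-cluster indicator and two parts centred within the
clusters. These contribute at least `p N`, `λ₂(L₁) + p n₂` and `λ₂(L₂) + p n₁` times their squared
lengths, and each value is attained by a trial vector. Hence `λ₂(L)/N` tends to `min p (min (l₁ + p
ρ₂) (l₂ + p ρ₁))` (`tendsto_lambda2_div`). As `ρ₁ + ρ₂ = 1`, this equals `p` exactly when `p ≤ min
(l₁ / ρ₁) (l₂ / ρ₂)`, which is the threshold.

Strictly below the threshold there is a gap of order `N` above the indicator direction, so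
minimizers converge in Euclidean norm (`exists_sign_tendsto_l2norm`). Uniform convergence of the
entries comes from the eigenvector equation: the degrees are at least about `λ₂(L₁)`, so the
diagonal coefficient exceeds the eigenvalue by order `N`, and Cauchy–Schwarz bounds the other terms
by the Euclidean error (`abs_entry_mul_le`, `tendsto_norm_block`).

Above the threshold, summing the eigenvector equation over the first cluster gives `(μ - p N) ∑ y₁ =
e ⬝ y₁ - e' ⬝ y₂` with `μ = λ₂(L)`, and `μ - p N` is of order `-N`. It remains to show that both
correlations are `o(N)`. This is the hard point: `e` itself has length of order `N`, and `y₁`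
depends on it. Let `M` be the deterministic mean matrix of the cluster, so that `M y₁ = μ y₁ - e y₁
+ (C - p) y₂`, where `e y₁` is the entrywise product. For a level `l` within `√N` of `μ` and a large
`T`, write `e = π e + (M - l) f` with `π` the spectral projection to eigenvalues up to `l + T √N`.
By symmetry of `M` the second summand contributes `O(N / T)`. If `π` has small relative rank,
concentration makes `π e` short. Otherwise some column of `π` is a vector on which the diagonal form
`e` is below `-(T + 1) √N`, and this trial vector would push `λ₂(L)` below itself
(`measureReal_no_trial_le`, `IsSpectrallyRegular.abs_dotProduct_rowDeviation_le`).

Since `μ` is random, `l` runs over the `N + 1` deterministic levels `j √N`, and a union bound covers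
them all. The failure probabilities are summable over distinct pairs of sizes
(`ae_eventually_forall_notMem`). -/

noncomputable section

open Matrix

/-! ### Real symmetric matrices in coordinates -/

/-- An orthonormal eigenbasis of a real symmetric matrix, in coordinates. -/
theorem Matrix.IsHermitian.exists_eigenbasis {V : Type*} [Fintype V] [DecidableEq V]
    {A : Matrix V V ℝ} (hA : A.IsHermitian) :
    ∃ φ : Fin (Fintype.card V) → V → ℝ,
      (∀ i, A.mulVec (φ i) = hA.eigenvalues₀ i • φ i) ∧
      (∀ i j, φ i ⬝ᵥ φ j = if i = j then 1 else 0) ∧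
      (∀ x : V → ℝ, ∑ i, (φ i ⬝ᵥ x) • φ i = x) := by
  let b := (isSymmetric_toEuclideanLin_iff.mpr hA).eigenvectorBasis finrank_euclideanSpace
  have hin : ∀ x y : EuclideanSpace ℝ V, inner ℝ x y = x.ofLp ⬝ᵥ y.ofLp := by
    intro x y
    simp [PiLp.inner_apply, dotProduct, mul_comm]
  refine ⟨fun i => (b i).ofLp, fun i => ?_, fun i j => ?_, fun x => ?_⟩
  · have h := (isSymmetric_toEuclideanLin_iff.mpr hA).apply_eigenvectorBasis
      finrank_euclideanSpace i
    exact congrArg WithLp.ofLp h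
  · have h := orthonormal_iff_ite.mp b.orthonormal i j
    rwa [hin] at h
  · have h := b.sum_repr' (WithLp.toLp 2 x)
    have h2 := congrArg WithLp.ofLp h
    simp only [hin, WithLp.ofLp_sum, WithLp.ofLp_smul] at h2
    exact h2

/-- Parseval's identity, in coordinates. -/
theorem dotProduct_eq_sum_of_expansion {ι V : Type*} [Fintype ι] [Fintype V]
    {φ : ι → V → ℝ} (hφ : ∀ x : V → ℝ, ∑ i, (φ i ⬝ᵥ x) • φ i = x) (x y : V → ℝ) :
    x ⬝ᵥ y = ∑ i, (φ i ⬝ᵥ x) * (φ i ⬝ᵥ y) := by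
  conv_lhs => rw [← hφ x]
  rw [sum_dotProduct]
  simp [smul_dotProduct]

theorem dotProduct_mulVec_comm {V : Type*} [Fintype V] {A : Matrix V V ℝ} (hA : A.IsHermitian)
    (x y : V → ℝ) : x ⬝ᵥ A.mulVec y = y ⬝ᵥ A.mulVec x := by
  have h : Aᵀ = A := by simpa [Matrix.IsHermitian, conjTranspose_eq_transpose_of_trivial] using hA
  rw [dotProduct_mulVec, ← mulVec_transpose, h, dotProduct_comm]

theorem dotProduct_self_eq_sum_sq {V : Type*} [Fintype V] (x : V → ℝ) :
    x ⬝ᵥ x = ∑ i, x i ^ 2 := by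
  simp [dotProduct, sq]

/-! ### The graph Laplacian -/

section Laplacian

variable {V : Type*} [Fintype V] (G : SimpleGraph V)

open Classical in
theorem graphLaplacian_mulVec_apply (x : V → ℝ) (u : V) :
    (graphLaplacian G).mulVec x u = ∑ w, if G.Adj u w then x u - x w else 0 := by
  rw [graphLaplacian, SimpleGraph.lapMatrix_mulVec_apply, ← SimpleGraph.card_neighborFinset_eq_degree,
    ← nsmul_eq_mul, ← Finset.sum_const, ← Finset.sum_sub_distrib, ← Finset.sum_filter]
  refine Finset.sum_congr ?_ fun _ _ => rfl
  ext w
  simp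

theorem graphLaplacian_dotProduct_comm (x y : V → ℝ) :
    x ⬝ᵥ (graphLaplacian G).mulVec y = y ⬝ᵥ (graphLaplacian G).mulVec x :=
  dotProduct_mulVec_comm (graphLaplacian_isHermitian G) x y

theorem graphLaplacian_mulVec_const (a : ℝ) : (graphLaplacian G).mulVec (fun _ => a) = 0 := by
  ext u
  simp [graphLaplacian_mulVec_apply]

theorem graphLaplacian_nonneg (x : V → ℝ) : 0 ≤ x ⬝ᵥ (graphLaplacian G).mulVec x := by
  classical
  have h := (G.posSemidef_lapMatrix ℝ).dotProduct_mulVec_nonneg x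
  simpa [graphLaplacian] using! h

theorem sum_graphLaplacian_mulVec (x : V → ℝ) : ∑ u, (graphLaplacian G).mulVec x u = 0 := by
  have h := graphLaplacian_dotProduct_comm G (fun _ => 1) x
  rw [graphLaplacian_mulVec_const] at h
  simpa [dotProduct] using h

/-- The Courant–Fischer characterization relative to the constants, which lie in the kernel.
Everything later uses `lambda2` only through these two halves and its nonnegativity. -/
theorem lambda2_spec (h : 2 ≤ Fintype.card V) :
    (∀ y : V → ℝ, ∑ i, y i = 0 →
      lambda2 G * ∑ i, y i ^ 2 ≤ y ⬝ᵥ (graphLaplacian G).mulVec y) ∧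
    ∃ y : V → ℝ, IsFeasible y ∧ y ⬝ᵥ (graphLaplacian G).mulVec y ≤ lambda2 G := by
  classical
  have hL := graphLaplacian_isHermitian G
  obtain ⟨φ, h1, h2, h3⟩ := hL.exists_eigenbasis
  set μ := hL.eigenvalues₀ with hμ
  set a : Fin (Fintype.card V) := ⟨Fintype.card V - 2, by omega⟩ with ha
  set b : Fin (Fintype.card V) := ⟨Fintype.card V - 1, by omega⟩ with hb
  have hab : a ≠ b := by simp [ha, hb, Fin.ext_iff]; omega
  have hl : lambda2 G = μ a := by
    rw [lambda2, dif_pos h]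
  have hanti : Antitone μ := hL.eigenvalues₀_antitone
  have hen : ∀ y : V → ℝ, y ⬝ᵥ (graphLaplacian G).mulVec y = ∑ i, μ i * (φ i ⬝ᵥ y) ^ 2 := by
    intro y
    rw [dotProduct_eq_sum_of_expansion h3]
    refine Finset.sum_congr rfl fun i _ => ?_
    rw [dotProduct_mulVec_comm hL, h1, dotProduct_smul, dotProduct_comm y]
    simp only [smul_eq_mul]; ring
  have hnn : ∀ i, 0 ≤ μ i := by
    intro i
    have := graphLaplacian_nonneg G (φ i)
    rw [h1, dotProduct_smul, h2] at this
    simpa using this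
  have hpars : ∀ y : V → ℝ, ∑ i, y i ^ 2 = ∑ i, (φ i ⬝ᵥ y) ^ 2 := by
    intro y
    rw [← dotProduct_self_eq_sum_sq, dotProduct_eq_sum_of_expansion h3]
    simp [sq]
  have hle : ∀ i, i ≠ b → μ a ≤ μ i := by
    intro i hi
    apply hanti
    rw [Fin.le_def]
    have : (i : ℕ) ≠ Fintype.card V - 1 := fun h => hi (Fin.ext h)
    have := i.2
    simp only [ha]; omega
  constructor
  · intro y hy
    rw [hl, hen, hpars, Finset.mul_sum]
    -- If the second smallest eigenvalue vanishes, the bound is nonnegativity of the energy.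
    -- Otherwise the kernel is one-dimensional, so `φ b` spans the constants and a centred vector
    -- has no component along it.
    rcases (hnn a).eq_or_lt with h0 | h0
    · refine Finset.sum_le_sum fun i _ => ?_
      rw [← h0, zero_mul]
      exact mul_nonneg (hnn i) (sq_nonneg _)
    · have horth : ∀ i, i ≠ b → φ i ⬝ᵥ (fun _ => (1 : ℝ)) = 0 := by
        intro i hi
        have h4 := graphLaplacian_dotProduct_comm G (φ i) (fun _ => 1)
        rw [graphLaplacian_mulVec_const, h1, dotProduct_smul, dotProduct_zero,
          dotProduct_comm] at h4
        have : μ i ≠ 0 := (h0.trans_le (hle i hi)).ne'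
        simpa [this] using h4.symm
      have hone : (φ b ⬝ᵥ fun _ => (1 : ℝ)) • φ b = fun _ => 1 := by
        refine Eq.trans ?_ (h3 fun _ => (1 : ℝ))
        rw [Finset.sum_eq_single b]
        · intro i _ hi
          rw [horth i hi, zero_smul]
        · simp
      have hby : φ b ⬝ᵥ y = 0 := by
        have h5 : (fun _ => (1 : ℝ)) ⬝ᵥ y = 0 := by simpa [dotProduct] using hy
        rw [← hone, smul_dotProduct, smul_eq_mul] at h5
        rcases mul_eq_zero.mp h5 with h6 | h6
        · exfalso
          rw [h6, zero_smul] at hone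
          have hne : Nonempty V := Fintype.card_pos_iff.mp (by omega)
          have := congrFun hone hne.some
          simp at this
        · exact h6
      refine Finset.sum_le_sum fun i _ => ?_
      by_cases hi : i = b
      · rw [hi, hby]; simp
      · exact mul_le_mul_of_nonneg_right (hle i hi) (sq_nonneg _)
  -- The plane spanned by the two lowest eigenvectors contains a centred unit vector, whichever of
  -- them is parallel to the constants.
  · obtain ⟨α, β, hαβ, hlin⟩ : ∃ α β : ℝ, α ^ 2 + β ^ 2 = 1 ∧
        α * (∑ u, φ a u) + β * ∑ u, φ b u = 0 := by
      by_cases hz : (∑ u, φ a u) = 0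
      · exact ⟨1, 0, by norm_num, by simp [hz]⟩
      · set A := ∑ u, φ a u
        set B := ∑ u, φ b u
        have hpos : 0 < A ^ 2 + B ^ 2 := by positivity
        refine ⟨B / √(A ^ 2 + B ^ 2), -A / √(A ^ 2 + B ^ 2), ?_, by ring⟩
        rw [div_pow, div_pow, Real.sq_sqrt hpos.le]
        field_simp
        ring
    have hca : φ a ⬝ᵥ (α • φ a + β • φ b) = α := by
      simp [h2, hab]
    have hcb : φ b ⬝ᵥ (α • φ a + β • φ b) = β := by
      simp [h2, hab.symm]
    have hci : ∀ i, i ≠ a → i ≠ b → φ i ⬝ᵥ (α • φ a + β • φ b) = 0 := by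
      intro i hia hib
      simp [h2, hia, hib]
    have hsum : ∀ f : Fin (Fintype.card V) → ℝ, (∀ i, i ≠ a → i ≠ b → f i = 0) →
        ∑ i, f i = f a + f b := by
      intro f hf
      rw [← Finset.sum_pair hab]
      symm
      apply Finset.sum_subset (Finset.subset_univ _)
      intro i _ hi
      simp only [Finset.mem_insert, Finset.mem_singleton, not_or] at hi
      exact hf i hi.1 hi.2
    refine ⟨α • φ a + β • φ b, ⟨?_, ?_⟩, ?_⟩
    · rw [hpars, hsum _ (fun i hia hib => by rw [hci i hia hib]; simp), hca, hcb, hαβ]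
    · simp only [Pi.add_apply, Pi.smul_apply, smul_eq_mul, Finset.sum_add_distrib,
        ← Finset.mul_sum, hlin]
    · rw [hen, hsum _ (fun i hia hib => by rw [hci i hia hib]; simp), hca, hcb, hl]
      have : μ b ≤ μ a := hanti (by rw [Fin.le_def]; simp only [ha, hb]; omega)
      have h4 := mul_le_mul_of_nonneg_right this (sq_nonneg β)
      have h5 : μ a * α ^ 2 + μ a * β ^ 2 = μ a := by rw [← mul_add, hαβ, mul_one]
      linarith

theorem lambda2_mul_le (h : 2 ≤ Fintype.card V) {y : V → ℝ} (hy : ∑ i, y i = 0) :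
    lambda2 G * ∑ i, y i ^ 2 ≤ y ⬝ᵥ (graphLaplacian G).mulVec y :=
  (lambda2_spec G h).1 y hy

theorem lambda2_nonneg : 0 ≤ lambda2 G := by
  by_cases h : 2 ≤ Fintype.card V
  · obtain ⟨y, -, hy⟩ := (lambda2_spec G h).2
    exact (graphLaplacian_nonneg G y).trans hy
  · rw [lambda2, dif_neg h]

variable {G} in
theorem IsSpectralSolution.energy_eq (h : 2 ≤ Fintype.card V) {y : V → ℝ}
    (hy : IsSpectralSolution G y) : y ⬝ᵥ (graphLaplacian G).mulVec y = lambda2 G := by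
  obtain ⟨z, hz, hz'⟩ := (lambda2_spec G h).2
  refine le_antisymm ((hy.2 z hz).trans hz') ?_
  have := lambda2_mul_le G h hy.1.2
  rwa [hy.1.1, mul_one] at this

variable {G} in
/-- A minimizer of the Rayleigh quotient is an eigenvector. -/
theorem IsSpectralSolution.mulVec_eq (h : 2 ≤ Fintype.card V) {y : V → ℝ}
    (hy : IsSpectralSolution G y) : (graphLaplacian G).mulVec y = lambda2 G • y := by
  set r : V → ℝ := (graphLaplacian G).mulVec y - lambda2 G • y with hr
  have hrs : ∑ i, r i = 0 := by
    simp [hr, Finset.sum_sub_distrib, sum_graphLaplacian_mulVec, ← Finset.mul_sum, hy.1.2]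
  have hE := hy.energy_eq h
  -- Variation of `y` along its own residual `r`, which is centred and hence admissible.
  have hquad : ∀ t : ℝ, 0 ≤ 2 * t * (∑ i, r i ^ 2) +
      t ^ 2 * (r ⬝ᵥ (graphLaplacian G).mulVec r - lambda2 G * ∑ i, r i ^ 2) := by
    intro t
    have h1 := lambda2_mul_le G h (y := y + t • r) (by
      simp [Finset.sum_add_distrib, hy.1.2, ← Finset.mul_sum, hrs])
    rw [← dotProduct_self_eq_sum_sq] at h1
    simp only [mulVec_add, mulVec_smul, add_dotProduct, dotProduct_add, smul_dotProduct,
      dotProduct_smul, hE, graphLaplacian_dotProduct_comm G y r, dotProduct_comm y r,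
      dotProduct_self_eq_sum_sq y, hy.1.1] at h1
    have h2 : r ⬝ᵥ (graphLaplacian G).mulVec y = ∑ i, r i ^ 2 + lambda2 G * (r ⬝ᵥ y) := by
      have : (graphLaplacian G).mulVec y = r + lambda2 G • y := by simp [hr]
      rw [this, dotProduct_add, dotProduct_smul, dotProduct_self_eq_sum_sq, smul_eq_mul]
    rw [h2] at h1
    rw [← dotProduct_self_eq_sum_sq r] at h1 ⊢
    simp only [smul_eq_mul] at h1
    nlinarith
  have hz : ∑ i, r i ^ 2 = 0 := by
    by_contra hne
    have hpos : 0 < ∑ i, r i ^ 2 :=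
      lt_of_le_of_ne (Finset.sum_nonneg fun i _ => sq_nonneg _) (Ne.symm hne)
    set S := ∑ i, r i ^ 2
    set B := r ⬝ᵥ (graphLaplacian G).mulVec r - lambda2 G * S
    -- A small negative `t`, for which the linear term beats the quadratic one.
    have h3 := hquad (-S / (|B| + 1))
    have hB : 0 < |B| + 1 := by positivity
    have h4 : 2 * (-S / (|B| + 1)) * S + (-S / (|B| + 1)) ^ 2 * B =
        S ^ 2 / (|B| + 1) ^ 2 * (B - 2 * (|B| + 1)) := by
      field_simp
      ring
    rw [h4] at h3
    have h5 : B - 2 * (|B| + 1) < 0 := by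
      have := le_abs_self B
      have := abs_nonneg B
      linarith
    have h6 : 0 < S ^ 2 / (|B| + 1) ^ 2 := by positivity
    nlinarith [mul_neg_of_pos_of_neg h6 h5]
  have hr0 : r = 0 := by
    ext i
    have := (Finset.sum_eq_zero_iff_of_nonneg (fun i _ => sq_nonneg (r i))).mp hz i (Finset.mem_univ i)
    simpa using this
  rw [hr, sub_eq_zero] at hr0
  exact hr0

open Classical in
/-- Fiedler's bound of the algebraic connectivity by the degree of a node. -/
theorem lambda2_le_degree (h : 2 ≤ Fintype.card V) (u : V) :
    lambda2 G * (1 - 1 / Fintype.card V) ≤ ∑ w, if G.Adj u w then (1 : ℝ) else 0 := by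
  have hN : (0 : ℝ) < Fintype.card V := by exact_mod_cast (by omega : 0 < Fintype.card V)
  set a : ℝ := 1 / Fintype.card V
  have haN : a * Fintype.card V = 1 := by simp only [a]; field_simp
  -- The centred point mass at `u`: its squared length is `1 - a` and its energy is the degree of
  -- `u`.
  set y : V → ℝ := Pi.single u 1 - fun _ => a with hy
  have hys : ∑ i, y i = 0 := by
    simp [hy, Finset.sum_sub_distrib]
    linarith
  have hy2 : ∑ i, y i ^ 2 = 1 - a := by
    have : ∀ i, y i ^ 2 = (1 - 2 * a) * Pi.single (M := fun _ : V => ℝ) u (1 : ℝ) i + a ^ 2 := by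
      intro i
      by_cases hi : i = u
      · subst hi; simp [hy]; ring
      · simp [hy, hi]
    simp only [this, Finset.sum_add_distrib, ← Finset.mul_sum]
    simp
    linear_combination a * haN
  have h1 := lambda2_mul_le G h hys
  rw [hy2] at h1
  have h2 : (graphLaplacian G).mulVec y = (graphLaplacian G).mulVec (Pi.single u 1) := by
    rw [hy, mulVec_sub, graphLaplacian_mulVec_const, sub_zero]
  have h3 : (graphLaplacian G).mulVec (Pi.single u 1) ⬝ᵥ (fun _ => a) = 0 := by
    rw [dotProduct_comm, graphLaplacian_dotProduct_comm, graphLaplacian_mulVec_const,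
      dotProduct_zero]
  rw [h2, hy, sub_dotProduct, dotProduct_comm (fun _ => a), h3, sub_zero, single_one_dotProduct,
    graphLaplacian_mulVec_apply] at h1
  refine h1.trans (Finset.sum_le_sum fun w _ => ?_)
  split_ifs with hw
  · have : w ≠ u := fun h => G.irrefl (h ▸ hw)
    simp [this]
  · rfl

end Laplacian

/-! ### Two clusters -/

section TwoCluster

variable {V W : Type*} [Fintype V] [Fintype W] (G : SimpleGraph V) (H : SimpleGraph W)
  (C : V → W → Bool)

theorem twoClusterGraph_mulVec_inl (y : V ⊕ W → ℝ) (u : V) :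
    (graphLaplacian (twoClusterGraph G H C)).mulVec y (Sum.inl u) =
      (graphLaplacian G).mulVec (y ∘ Sum.inl) u +
        ∑ v, (if C u v = true then (1 : ℝ) else 0) * (y (Sum.inl u) - y (Sum.inr v)) := by
  classical
  simp only [graphLaplacian_mulVec_apply, Fintype.sum_sum_type, ite_mul, one_mul, zero_mul]
  congr!

theorem twoClusterGraph_mulVec_inr (y : V ⊕ W → ℝ) (v : W) :
    (graphLaplacian (twoClusterGraph G H C)).mulVec y (Sum.inr v) =
      (graphLaplacian H).mulVec (y ∘ Sum.inr) v +
        ∑ u, (if C u v = true then (1 : ℝ) else 0) * (y (Sum.inr v) - y (Sum.inl u)) := by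
  classical
  simp only [graphLaplacian_mulVec_apply, Fintype.sum_sum_type, ite_mul, one_mul, zero_mul]
  rw [add_comm]
  congr!

theorem twoClusterGraph_bilin (x y : V ⊕ W → ℝ) :
    x ⬝ᵥ (graphLaplacian (twoClusterGraph G H C)).mulVec y =
      (x ∘ Sum.inl) ⬝ᵥ (graphLaplacian G).mulVec (y ∘ Sum.inl) +
      (x ∘ Sum.inr) ⬝ᵥ (graphLaplacian H).mulVec (y ∘ Sum.inr) +
      ∑ u, ∑ v, (if C u v = true then (1 : ℝ) else 0) *
        ((x (Sum.inl u) - x (Sum.inr v)) * (y (Sum.inl u) - y (Sum.inr v))) := by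
  simp only [dotProduct, Fintype.sum_sum_type, twoClusterGraph_mulVec_inl,
    twoClusterGraph_mulVec_inr, mul_add, Finset.sum_add_distrib, Finset.mul_sum,
    Function.comp_apply]
  rw [Finset.sum_comm (s := (Finset.univ : Finset W)) (t := (Finset.univ : Finset V))]
  have : ∀ u v, (if C u v = true then (1 : ℝ) else 0) *
        ((x (Sum.inl u) - x (Sum.inr v)) * (y (Sum.inl u) - y (Sum.inr v))) =
      x (Sum.inl u) * ((if C u v = true then (1 : ℝ) else 0) * (y (Sum.inl u) - y (Sum.inr v))) +
      x (Sum.inr v) * ((if C u v = true then (1 : ℝ) else 0) * (y (Sum.inr v) - y (Sum.inl u))) := by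
    intro u v; ring
  simp only [this, Finset.sum_add_distrib]
  ring

end TwoCluster

end

noncomputable section

open Matrix

/-! ### Functional calculus and spectral splitting -/

theorem l2norm_sq {ι : Type*} [Fintype ι] (x : ι → ℝ) : l2norm x ^ 2 = ∑ i, x i ^ 2 :=
  Real.sq_sqrt (Finset.sum_nonneg fun _ _ => sq_nonneg _)

theorem l2norm_nonneg {ι : Type*} [Fintype ι] (x : ι → ℝ) : 0 ≤ l2norm x := Real.sqrt_nonneg _

theorem dotProduct_le_l2norm {ι : Type*} [Fintype ι] (x y : ι → ℝ) :
    x ⬝ᵥ y ≤ l2norm x * l2norm y :=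
  Real.sum_mul_le_sqrt_mul_sqrt _ _ _

theorem l2norm_neg {ι : Type*} [Fintype ι] (x : ι → ℝ) : l2norm (-x) = l2norm x := by
  simp [l2norm]

theorem abs_dotProduct_le_l2norm {ι : Type*} [Fintype ι] (x y : ι → ℝ) :
    |x ⬝ᵥ y| ≤ l2norm x * l2norm y := by
  rw [abs_le']
  refine ⟨dotProduct_le_l2norm x y, ?_⟩
  rw [← neg_dotProduct, ← l2norm_neg x]
  exact dotProduct_le_l2norm _ y

theorem l2norm_eq_norm {ι : Type*} [Fintype ι] (x : ι → ℝ) : l2norm x = ‖WithLp.toLp 2 x‖ := by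
  simp [l2norm, EuclideanSpace.norm_eq]

theorem l2norm_smul {ι : Type*} [Fintype ι] (a : ℝ) (x : ι → ℝ) :
    l2norm (a • x) = |a| * l2norm x := by
  rw [l2norm_eq_norm, WithLp.toLp_smul, norm_smul, l2norm_eq_norm, Real.norm_eq_abs]

/-- For a real symmetric matrix `N`, a level `l` and a gap `τ`, the spectral projection `π` to the
eigenvalues up to `l + τ` and the inverse `A` of `N - l` on the complementary spectral subspace. -/
theorem exists_spectral_split {V : Type*} [Fintype V] [DecidableEq V] {N : Matrix V V ℝ}
    (hN : N.IsHermitian) (l : ℝ) {τ : ℝ} (hτ : 0 < τ) :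
    ∃ π A : Matrix V V ℝ, πᵀ = π ∧ π * π = π ∧ Aᵀ = A ∧
      (∀ z, N.mulVec (A.mulVec z) - l • A.mulVec z = z - π.mulVec z) ∧
      (∀ z, l2norm (A.mulVec z) ≤ l2norm z / τ) ∧
      (∀ z, π.mulVec z ⬝ᵥ N.mulVec (π.mulVec z) ≤ (l + τ) * ∑ i, π.mulVec z i ^ 2) ∧
      (∀ φ a, N.mulVec φ = a • φ → l + τ < a → ∀ z, φ ⬝ᵥ π.mulVec z = 0) := by
  obtain ⟨φ, h1, h2, h3⟩ := hN.exists_eigenbasis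
  set μ := hN.eigenvalues₀
  -- Functional calculus: `F g` multiplies the `i`-th eigencomponent by `g i`.
  let F : (Fin (Fintype.card V) → ℝ) → Matrix V V ℝ :=
    fun g => ∑ i, g i • vecMulVec (φ i) (φ i)
  have hF : ∀ g z, (F g).mulVec z = ∑ i, (g i * (φ i ⬝ᵥ z)) • φ i := by
    intro g z
    simp only [F, sum_mulVec, smul_mulVec, vecMulVec_mulVec]
    refine Finset.sum_congr rfl fun i _ => ?_
    ext u
    simp
    ring
  have hc : ∀ g z j, φ j ⬝ᵥ (F g).mulVec z = g j * (φ j ⬝ᵥ z) := by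
    intro g z j
    rw [hF, dotProduct_sum]
    simp [h2]
  have hT : ∀ g, (F g)ᵀ = F g := by
    intro g
    simp [F, transpose_sum, transpose_smul, transpose_vecMulVec]
  have hNc : ∀ z j, φ j ⬝ᵥ N.mulVec z = μ j * (φ j ⬝ᵥ z) := by
    intro z j
    rw [dotProduct_mulVec_comm hN, h1, dotProduct_smul, dotProduct_comm, smul_eq_mul]
  have hext : ∀ x y : V → ℝ, (∀ j, φ j ⬝ᵥ x = φ j ⬝ᵥ y) → x = y := by
    intro x y h
    rw [← h3 x, ← h3 y]
    simp [h]
  have hpars : ∀ y : V → ℝ, ∑ i, y i ^ 2 = ∑ i, (φ i ⬝ᵥ y) ^ 2 := by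
    intro y
    rw [← dotProduct_self_eq_sum_sq, dotProduct_eq_sum_of_expansion h3]
    simp [sq]
  -- All eigenvalues up to `l + τ`, including those below `l`, go to the projection. On the rest `μ
  -- i - l > τ`, so the inverse has norm at most `1 / τ`.
  refine ⟨F fun i => if μ i ≤ l + τ then 1 else 0,
    F fun i => if μ i ≤ l + τ then 0 else (μ i - l)⁻¹, hT _, ?_, hT _, ?_, ?_, ?_, ?_⟩
  · refine ext_of_mulVec_single fun i => hext _ _ fun j => ?_
    rw [← mulVec_mulVec, hc, hc]
    split_ifs <;> simp
  · intro z
    refine hext _ _ fun j => ?_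
    rw [dotProduct_sub, dotProduct_sub, dotProduct_smul, hNc, hc, hc, smul_eq_mul]
    split_ifs with h
    · simp
    · have : μ j - l ≠ 0 := by linarith
      field_simp
      ring
  · intro z
    rw [l2norm, l2norm, ← Real.sqrt_sq hτ.le, ← Real.sqrt_div' _ (sq_nonneg τ), Real.sqrt_sq hτ.le]
    refine Real.sqrt_le_sqrt ?_
    rw [hpars, hpars z, Finset.sum_div]
    refine Finset.sum_le_sum fun i _ => ?_
    rw [hc]
    split_ifs with h
    · rw [zero_mul, zero_pow two_ne_zero]
      positivity
    · push Not at h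
      have h4 : 0 < μ i - l := by linarith
      rw [inv_mul_eq_div, div_pow]
      refine div_le_div_of_nonneg_left (sq_nonneg _) (by positivity) ?_
      exact pow_le_pow_left₀ hτ.le (by linarith) 2
  · intro z
    rw [dotProduct_eq_sum_of_expansion h3, hpars, Finset.mul_sum]
    refine Finset.sum_le_sum fun i _ => ?_
    rw [hNc, hc]
    split_ifs with h
    · nlinarith [sq_nonneg (φ i ⬝ᵥ z)]
    · simp
  · intro ψ a hψ ha z
    rw [dotProduct_eq_sum_of_expansion h3]
    refine Finset.sum_eq_zero fun i _ => ?_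
    rw [hc]
    split_ifs with h
    · have h4 := hNc ψ i
      rw [hψ, dotProduct_smul, smul_eq_mul] at h4
      have h5 : (a - μ i) * (φ i ⬝ᵥ ψ) = 0 := by linarith
      rcases mul_eq_zero.mp h5 with h6 | h6
      · linarith
      · simp [h6]
    · simp

/-! ### Nets -/

/-- A maximal `1/2`-separated subset of the unit ball is a `1/2`-net. Doubled, it is `1`-separated
in the ball of radius `2`, where volume comparison allows at most `5 ^ d` points. -/
theorem exists_net (E : Type*) [NormedAddCommGroup E] [NormedSpace ℝ E] [FiniteDimensional ℝ E] :
    ∃ s : Finset E, s.card ≤ 5 ^ Module.finrank ℝ E ∧ (∀ z ∈ s, ‖z‖ ≤ 1) ∧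
      ∀ x : E, ‖x‖ ≤ 1 → ∃ z ∈ s, ‖x - z‖ ≤ 1 / 2 := by
  classical
  let Q : Finset E → Prop := fun s => (∀ z ∈ s, ‖z‖ ≤ 1) ∧
    ∀ z ∈ s, ∀ w ∈ s, z ≠ w → 1 / 2 ≤ ‖z - w‖
  have hcard : ∀ s, Q s → s.card ≤ 5 ^ Module.finrank ℝ E := by
    rintro s ⟨h1, h2⟩
    have hinj : Function.Injective fun x : E => (2 : ℝ) • x := smul_right_injective E two_ne_zero
    rw [← Finset.card_image_of_injective s hinj]
    apply Besicovitch.card_le_of_separated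
    · intro c hc
      obtain ⟨z, hz, rfl⟩ := Finset.mem_image.mp hc
      rw [norm_smul]
      have := h1 z hz
      norm_num; linarith
    · intro c hc d hd hcd
      obtain ⟨z, hz, rfl⟩ := Finset.mem_image.mp hc
      obtain ⟨w, hw, rfl⟩ := Finset.mem_image.mp hd
      have hzw : z ≠ w := fun h => hcd (by rw [h])
      have := h2 z hz w hw hzw
      rw [← smul_sub, norm_smul]
      norm_num; linarith
  -- Separated sets have bounded cardinality, so one of largest size exists; a point far from it
  -- could be inserted.
  let R : ℕ → Prop := fun n => ∃ s, Q s ∧ s.card = n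
  have hR0 : R 0 := ⟨∅, ⟨by simp, by simp⟩, rfl⟩
  obtain ⟨s, hs, hsc⟩ : R (Nat.findGreatest R (5 ^ Module.finrank ℝ E)) :=
    Nat.findGreatest_spec (Nat.zero_le _) hR0
  refine ⟨s, hcard s hs, hs.1, fun x hx => ?_⟩
  by_contra! hcon
  have hxs : x ∉ s := fun h => by
    have := hcon x h
    simp at this
    linarith
  have hQ : Q (insert x s) := by
    constructor
    · intro z hz
      rcases Finset.mem_insert.mp hz with rfl | hz
      · exact hx
      · exact hs.1 z hz
    · intro z hz w hw hzw
      rcases Finset.mem_insert.mp hz with h1 | h1 <;> rcases Finset.mem_insert.mp hw with h2 | h2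
      · exact absurd (h1.trans h2.symm) hzw
      · rw [h1]; exact (hcon w h2).le
      · rw [h2, norm_sub_rev]; exact (hcon z h1).le
      · exact hs.2 z h1 w h2 hzw
  have h1 := hcard _ hQ
  have h2 : R (insert x s).card := ⟨_, hQ, rfl⟩
  have h3 := Nat.le_findGreatest h1 h2
  rw [Finset.card_insert_of_notMem hxs, hsc] at h3
  omega

theorem ContinuousLinearMap.opNorm_le_of_net {E F : Type*} [NormedAddCommGroup E] [NormedSpace ℝ E]
    [NormedAddCommGroup F] [NormedSpace ℝ F] (A : E →L[ℝ] F) {s : Finset E} {r : ℝ} (hr : 0 ≤ r)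
    (hs : ∀ x : E, ‖x‖ ≤ 1 → ∃ z ∈ s, ‖x - z‖ ≤ 1 / 2) (hA : ∀ z ∈ s, ‖A z‖ ≤ r) :
    ‖A‖ ≤ 2 * r := by
  have h : ‖A‖ ≤ r + ‖A‖ * (1 / 2) := by
    refine A.opNorm_le_of_unit_norm (by positivity) fun x hx => ?_
    obtain ⟨z, hz, hxz⟩ := hs x hx.le
    calc ‖A x‖ = ‖A z + A (x - z)‖ := by rw [← map_add]; simp
      _ ≤ ‖A z‖ + ‖A (x - z)‖ := norm_add_le _ _
      _ ≤ r + ‖A‖ * (1 / 2) := by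
        gcongr
        · exact hA z hz
        · exact (A.le_opNorm _).trans (by gcongr)
  linarith

end

noncomputable section

open Matrix

/-! ### Subgaussian random vectors -/

section Subgaussian

variable {Ω V W : Type*} [MeasurableSpace Ω] [Fintype V] [Fintype W]

theorem measureReal_le_sum_of_subset {ι : Type*} {P : Measure Ω} [IsProbabilityMeasure P]
    {s : Set Ω} {t : Finset ι} {f : ι → Set Ω} (h : s ⊆ ⋃ i ∈ t, f i) :
    P.real s ≤ ∑ i ∈ t, P.real (f i) :=
  (measureReal_mono h (measure_ne_top _ _)).trans (measureReal_biUnion_finset_le _ _)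

/-- Every linear form of the random vector `h` has a Gaussian upper tail with variance proxy
`S / 2` times the squared length of the form. -/
def IsSubgaussianVector (P : Measure Ω) (h : Ω → V → ℝ) (S : ℝ) : Prop :=
  ∀ (z : V → ℝ) (t b : ℝ), 0 ≤ t → 0 < b → ∑ i, z i ^ 2 ≤ b →
    P.real {ω | t ≤ z ⬝ᵥ h ω} ≤ Real.exp (-t ^ 2 / (S * b))

theorem IsSubgaussianVector.mulVec {P : Measure Ω} {h : Ω → V → ℝ} {S τ : ℝ}
    (hh : IsSubgaussianVector P h S) (hτ : 0 < τ) {A : Matrix V V ℝ} (hA : Aᵀ = A)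
    (hAτ : ∀ z, l2norm (A.mulVec z) ≤ l2norm z / τ) :
    IsSubgaussianVector P (fun ω => A.mulVec (h ω)) (S / τ ^ 2) := by
  intro z t b ht hb hz
  have h1 := hh (A.mulVec z) t (b / τ ^ 2) ht (by positivity) (by
    rw [← l2norm_sq]
    calc l2norm (A.mulVec z) ^ 2 ≤ (l2norm z / τ) ^ 2 :=
          pow_le_pow_left₀ (l2norm_nonneg _) (hAτ z) 2
      _ ≤ b / τ ^ 2 := by rw [div_pow, l2norm_sq]; gcongr)
  have h2 : ∀ ω, z ⬝ᵥ A.mulVec (h ω) = A.mulVec z ⬝ᵥ h ω := by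
    intro ω
    rw [dotProduct_mulVec, ← mulVec_transpose, hA]
  simp only [h2]
  convert h1 using 2
  ring

theorem finrank_range_eq_trace [DecidableEq V] {π : Matrix V V ℝ} (hπ : π * π = π) :
    (Module.finrank ℝ (LinearMap.range (toEuclideanLin π)) : ℝ) = π.trace := by
  have h1 : IsIdempotentElem (toEuclideanLin π) := by
    rw [IsIdempotentElem]
    ext x i
    have h2 : (π * π).mulVec x.ofLp = π.mulVec x.ofLp := by rw [hπ]
    rw [← mulVec_mulVec] at h2
    simpa [toLpLin_apply] using congrFun h2 i
  have h2 := (LinearMap.IsIdempotentElem.isProj_range _ h1).trace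
  rw [← h2, toEuclideanLin_eq_toLin_orthonormal, Matrix.trace_toLin_eq]

theorem half_norm_le_inner {E : Type*} [NormedAddCommGroup E] [InnerProductSpace ℝ E] {x z : E}
    (hx : 0 < ‖x‖) (hz : ‖‖x‖⁻¹ • x - z‖ ≤ 1 / 2) : ‖x‖ / 2 ≤ inner ℝ x z := by
  have h3 : inner ℝ x (‖x‖⁻¹ • x) = ‖x‖ := by
    rw [real_inner_smul_right, real_inner_self_eq_norm_sq]
    field_simp
  have h4 : inner ℝ x (‖x‖⁻¹ • x - z) ≤ ‖x‖ * (1 / 2) :=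
    (real_inner_le_norm _ _).trans (by gcongr)
  rw [inner_sub_right, h3] at h4
  linarith

/-- The range of `π` has dimension `π.trace`, so it has a half-net of at most `5 ^ d ≤ exp (2 d)`
points. If the projected vector is longer than `2 t`, its inner product with some net point is at
least `t`, and a union bound finishes. -/
theorem IsSubgaussianVector.measureReal_projection_le [DecidableEq V] {P : Measure Ω}
    [IsProbabilityMeasure P] {h : Ω → V → ℝ} {S : ℝ} (hh : IsSubgaussianVector P h S)
    {π : Matrix V V ℝ} (hT : πᵀ = π) (hπ : π * π = π) {t : ℝ} (ht : 0 < t) :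
    P.real {ω | 2 * t ≤ l2norm (π.mulVec (h ω))} ≤ Real.exp (2 * π.trace - t ^ 2 / S) := by
  obtain ⟨s, hs1, hs2, hs3⟩ := exists_net (LinearMap.range (toEuclideanLin π))
  have hsub : {ω | 2 * t ≤ l2norm (π.mulVec (h ω))} ⊆
      ⋃ z ∈ s, {ω | t ≤ (z : EuclideanSpace ℝ V).ofLp ⬝ᵥ h ω} := by
    intro ω hω
    simp only [Set.mem_ofPred_eq] at hω
    let x : LinearMap.range (toEuclideanLin π) :=
      ⟨toEuclideanLin π (WithLp.toLp 2 (h ω)), LinearMap.mem_range_self _ _⟩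
    have hx : ‖x‖ = l2norm (π.mulVec (h ω)) := by
      rw [l2norm_eq_norm, Submodule.coe_norm]
      rfl
    have hx0 : 0 < ‖x‖ := by rw [hx]; linarith
    obtain ⟨z, hz, hxz⟩ := hs3 (‖x‖⁻¹ • x) (by
      rw [norm_smul, norm_inv, norm_norm, inv_mul_cancel₀ hx0.ne'])
    simp only [Set.mem_iUnion, Set.mem_ofPred_eq]
    refine ⟨z, hz, ?_⟩
    have hzx : (z : EuclideanSpace ℝ V).ofLp ⬝ᵥ h ω = inner ℝ x z := by
      obtain ⟨w, hw⟩ := z.2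
      have h1 : (z : EuclideanSpace ℝ V).ofLp = π.mulVec w.ofLp := by rw [← hw]; rfl
      have h2 : inner ℝ x z = (z : EuclideanSpace ℝ V).ofLp ⬝ᵥ π.mulVec (h ω) := by
        simp [x, PiLp.inner_apply, dotProduct, toLpLin_apply]
      rw [h2, dotProduct_mulVec, ← mulVec_transpose, hT, h1, mulVec_mulVec, hπ]
    have h3 := half_norm_le_inner hx0 hxz
    rw [hzx]
    linarith
  calc P.real {ω | 2 * t ≤ l2norm (π.mulVec (h ω))}
      ≤ ∑ z ∈ s, P.real {ω | t ≤ (z : EuclideanSpace ℝ V).ofLp ⬝ᵥ h ω} :=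
        measureReal_le_sum_of_subset hsub
    _ ≤ ∑ z ∈ s, Real.exp (-t ^ 2 / (S * 1)) := by
        refine Finset.sum_le_sum fun z hz => hh _ t 1 ht.le one_pos ?_
        rw [← l2norm_sq, l2norm_eq_norm]
        exact pow_le_one₀ (norm_nonneg _) (hs2 z hz)
    _ = s.card * Real.exp (-(t ^ 2 / S)) := by rw [Finset.sum_const, nsmul_eq_mul, mul_one, neg_div]
    _ ≤ Real.exp (2 * π.trace) * Real.exp (-(t ^ 2 / S)) := by
        gcongr
        rw [← finrank_range_eq_trace hπ, mul_comm, Real.exp_nat_mul]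
        have h5 : (5 : ℝ) ≤ Real.exp 2 := by
          have h6 := Real.exp_one_gt_d9
          have h7 : Real.exp 2 = Real.exp 1 * Real.exp 1 := by rw [← Real.exp_add]; norm_num
          nlinarith
        calc (s.card : ℝ) ≤ 5 ^ Module.finrank ℝ (LinearMap.range (toEuclideanLin π)) := by
              exact_mod_cast hs1
          _ ≤ _ := by gcongr
    _ = _ := by rw [← Real.exp_add]; ring_nf

/-- A random matrix with subgaussian bilinear forms has a small operator norm. -/
theorem measureReal_bilin_le [DecidableEq V] {P : Measure Ω} [IsProbabilityMeasure P]
    {X : Ω → V → W → ℝ} {S : ℝ}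
    (hX : ∀ (a : V → W → ℝ) (t b : ℝ), 0 ≤ t → 0 < b → ∑ u, ∑ v, a u v ^ 2 ≤ b →
      P.real {ω | t ≤ ∑ u, ∑ v, a u v * X ω u v} ≤ Real.exp (-t ^ 2 / (S * b)))
    {t : ℝ} (ht : 0 < t) :
    P.real {ω | ¬ ∀ (z : V → ℝ) (w : W → ℝ),
      ∑ u, ∑ v, z u * w v * X ω u v ≤ 4 * t * (l2norm z * l2norm w)} ≤
      Real.exp (2 * (Fintype.card V + Fintype.card W) - t ^ 2 / S) := by
  classical
  obtain ⟨s, hs1, hs2, hs3⟩ := exists_net (EuclideanSpace ℝ W)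
  -- For a fixed net vector on one side, the image is a subgaussian vector, to which the projection
  -- bound applies with `π = 1`. The two nets each cost a factor `2` in the norm.
  have hvec : ∀ z ∈ s, IsSubgaussianVector P (fun ω => (Matrix.of (X ω)).mulVec z.ofLp) S := by
    intro z hz y t b ht hb hy
    have h1 := hX (fun u v => y u * z v) t b ht hb (by
      simp only [mul_pow, ← Finset.mul_sum, ← Finset.sum_mul]
      have h2 : ∑ v, z v ^ 2 ≤ 1 := by
        rw [← l2norm_sq, l2norm_eq_norm]
        exact pow_le_one₀ (norm_nonneg _) (hs2 z hz)
      calc (∑ i, y i ^ 2) * ∑ v, z v ^ 2 ≤ (∑ i, y i ^ 2) * 1 := by gcongr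
        _ ≤ b := by rwa [mul_one])
    convert h1 using 4
    simp only [dotProduct, Matrix.mulVec, Finset.mul_sum, Matrix.of_apply]
    refine iff_of_eq (congrArg _ (Finset.sum_congr rfl fun u _ => Finset.sum_congr rfl fun v _ => ?_))
    ring
  have hsub : {ω | ¬ ∀ (z : V → ℝ) (w : W → ℝ),
      ∑ u, ∑ v, z u * w v * X ω u v ≤ 4 * t * (l2norm z * l2norm w)} ⊆
      ⋃ z ∈ s, {ω | 2 * t ≤ l2norm ((1 : Matrix V V ℝ).mulVec
        ((Matrix.of (X ω)).mulVec z.ofLp))} := by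
    intro ω hω
    by_contra hcon
    simp only [Set.mem_iUnion, Set.mem_ofPred_eq, not_exists, not_le, one_mulVec] at hcon
    refine hω fun z w => ?_
    let A : EuclideanSpace ℝ W →L[ℝ] EuclideanSpace ℝ V :=
      LinearMap.toContinuousLinearMap (toEuclideanLin (Matrix.of (X ω)))
    have hA : ∀ w : EuclideanSpace ℝ W, ‖A w‖ = l2norm ((Matrix.of (X ω)).mulVec w.ofLp) := by
      intro w
      rw [l2norm_eq_norm]
      rfl
    have hn := A.opNorm_le_of_net (r := 2 * t) (by positivity) hs3 (fun z hz => by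
      rw [hA]; exact (hcon z hz).le)
    have h1 := A.le_opNorm (WithLp.toLp 2 w)
    rw [hA, ← l2norm_eq_norm] at h1
    have h2 : ∑ u, ∑ v, z u * w v * X ω u v = z ⬝ᵥ (Matrix.of (X ω)).mulVec w := by
      simp only [dotProduct, Matrix.mulVec, Finset.mul_sum, Matrix.of_apply]
      exact Finset.sum_congr rfl fun u _ => Finset.sum_congr rfl fun v _ => by ring
    rw [h2]
    calc z ⬝ᵥ (Matrix.of (X ω)).mulVec w ≤ l2norm z * (‖A‖ * l2norm w) :=
          (dotProduct_le_l2norm _ _).trans (mul_le_mul_of_nonneg_left h1 (l2norm_nonneg _))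
      _ ≤ l2norm z * (2 * (2 * t) * l2norm w) := by
          have := l2norm_nonneg w
          have := l2norm_nonneg z
          gcongr
      _ = _ := by ring
  calc _ ≤ ∑ z ∈ s, P.real {ω | 2 * t ≤ l2norm ((1 : Matrix V V ℝ).mulVec
        ((Matrix.of (X ω)).mulVec z.ofLp))} :=
        measureReal_le_sum_of_subset hsub
    _ ≤ ∑ z ∈ s, Real.exp (2 * Fintype.card V - t ^ 2 / S) := by
        refine Finset.sum_le_sum fun z hz => ?_
        have := (hvec z hz).measureReal_projection_le (π := 1) (by simp) (by simp) ht
        rwa [trace_one] at this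
    _ = s.card * Real.exp (2 * Fintype.card V - t ^ 2 / S) := by
        rw [Finset.sum_const, nsmul_eq_mul]
    _ ≤ Real.exp (2 * Fintype.card W) * Real.exp (2 * Fintype.card V - t ^ 2 / S) := by
        gcongr
        rw [mul_comm, Real.exp_nat_mul]
        have h5 : (5 : ℝ) ≤ Real.exp 2 := by
          have h6 := Real.exp_one_gt_d9
          have h7 : Real.exp 2 = Real.exp 1 * Real.exp 1 := by rw [← Real.exp_add]; norm_num
          nlinarith
        calc (s.card : ℝ) ≤ 5 ^ Fintype.card W := by
              rw [finrank_euclideanSpace] at hs1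
              exact_mod_cast hs1
          _ ≤ _ := by gcongr
    _ = _ := by rw [← Real.exp_add]; ring_nf

/-! ### Large entries and fourth moments of subgaussian vectors -/

theorem Nat.choose_le_exp_mul_div_pow {N k : ℕ} (hk : 0 < k) :
    (N.choose k : ℝ) ≤ (Real.exp 1 * (N / k)) ^ k := by
  have hk' : (0 : ℝ) < k := by exact_mod_cast hk
  have h1 : (N.choose k : ℝ) ≤ N ^ k / k.factorial := Nat.choose_le_pow_div k N
  have h2 := Real.pow_div_factorial_le_exp (k : ℝ) hk'.le k
  have h3 : (0 : ℝ) < k.factorial := by exact_mod_cast k.factorial_pos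
  calc (N.choose k : ℝ) ≤ N ^ k / k.factorial := h1
    _ = ((k : ℝ) ^ k / k.factorial) * (N / k) ^ k := by
        rw [div_pow]; field_simp
    _ ≤ Real.exp k * (N / k) ^ k := by gcongr
    _ = _ := by rw [mul_pow, ← Real.exp_nat_mul, mul_one]

/-- The number of large entries of a subgaussian vector. -/
theorem IsSubgaussianVector.measureReal_card_le {P : Measure Ω} [IsProbabilityMeasure P]
    {h : Ω → V → ℝ} {s : ℝ} (hs : 0 < s) (hh : IsSubgaussianVector P h (s ^ 2)) (i : ℕ) {r : ℝ}
    (hr0 : 0 ≤ r) (hr : r ^ 3 ≤ Fintype.card V) (hV : 0 < Fintype.card V) :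
    P.real {ω | (Fintype.card V : ℝ) / 64 ^ i ≤
      (Finset.univ.filter fun u => 3 * s * 2 ^ i < |h ω u|).card} ≤ Real.exp (-4 * r) := by
  classical
  set N := Fintype.card V with hN
  set k := ⌈(N : ℝ) / 64 ^ i⌉₊ with hk
  have hN' : (0 : ℝ) < N := by exact_mod_cast hV
  have hkpos : 0 < k := Nat.ceil_pos.mpr (by positivity)
  have hk1 : (1 : ℝ) ≤ k := by exact_mod_cast hkpos
  have hkN : (N : ℝ) / 64 ^ i ≤ k := Nat.le_ceil _
  -- `Z` is a candidate set of `k` large coordinates and `Y` the part where the entries are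
  -- nonnegative; pairing with this sign vector gives the sum of the absolute values over `Z`.
  let z : Finset V → Finset V → V → ℝ := fun Z Y u => if u ∈ Z then (if u ∈ Y then 1 else -1) else 0
  have hsub : {ω | (N : ℝ) / 64 ^ i ≤
      (Finset.univ.filter fun u => 3 * s * 2 ^ i < |h ω u|).card} ⊆
      ⋃ q ∈ (Finset.univ.powersetCard k).sigma fun Z : Finset V => Z.powerset,
        {ω | k * (3 * s * 2 ^ i) ≤ z q.1 q.2 ⬝ᵥ h ω} := by
    intro ω hω
    have h1 : k ≤ (Finset.univ.filter fun u => 3 * s * 2 ^ i < |h ω u|).card := Nat.ceil_le.mpr hω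
    obtain ⟨Z, hZ, hZk⟩ := Finset.exists_subset_card_eq h1
    simp only [Set.mem_iUnion, Set.mem_ofPred_eq]
    refine ⟨⟨Z, Z.filter fun u => 0 ≤ h ω u⟩, ?_, ?_⟩
    · simp [hZk]
    · have h2 : z Z (Z.filter fun u => 0 ≤ h ω u) ⬝ᵥ h ω = ∑ u ∈ Z, |h ω u| := by
        simp only [dotProduct, z, ite_mul, zero_mul, Finset.sum_ite_mem, Finset.univ_inter]
        refine Finset.sum_congr rfl fun u hu => ?_
        simp only [Finset.mem_filter, hu, true_and]
        split_ifs with h0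
        · rw [abs_of_nonneg h0, one_mul]
        · rw [abs_of_neg (not_le.mp h0)]; ring
      simp only
      rw [h2, ← hZk, ← nsmul_eq_mul]
      refine Finset.card_nsmul_le_sum _ _ _ fun u hu => ?_
      exact (Finset.mem_filter.mp (hZ hu)).2.le
  have hterm : ∀ q ∈ (Finset.univ.powersetCard k).sigma fun Z : Finset V => Z.powerset,
      P.real {ω | k * (3 * s * 2 ^ i) ≤ z q.1 q.2 ⬝ᵥ h ω} ≤ Real.exp (-(9 * 4 ^ i * k)) := by
    rintro ⟨Z, Y⟩ hq
    simp only [Finset.mem_sigma, Finset.mem_powersetCard, Finset.subset_univ, true_and,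
      Finset.mem_powerset] at hq
    have h1 := hh (z Z Y) (k * (3 * s * 2 ^ i)) k (by positivity) (by positivity) (by
      rw [← hq.1]
      have : ∀ u, z Z Y u ^ 2 = if u ∈ Z then 1 else 0 := by
        intro u
        simp only [z]
        split_ifs <;> norm_num
      simp [this])
    refine h1.trans (le_of_eq ?_)
    congr 1
    have : (4 : ℝ) ^ i = 2 ^ i * 2 ^ i := by rw [← mul_pow]; norm_num
    rw [this]
    field_simp
    ring
  have h4i : (1 : ℝ) + 3 * i ≤ 4 ^ i := by
    have := one_add_mul_le_pow (a := (3 : ℝ)) (by norm_num) i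
    norm_num at this
    linarith
  -- The number of choices of `(Z, Y)` uses up at most half of the tail exponent `9 * 4 ^ i * k`.
  have hcount : ((N.choose k : ℝ) * 2 ^ k) ≤ Real.exp (9 / 2 * 4 ^ i * k) := by
    have h64 : (N : ℝ) / k ≤ 64 ^ i := by
      rw [div_le_iff₀ (by positivity)]
      rw [div_le_iff₀ (by positivity)] at hkN
      linarith
    have he1 := Real.exp_one_gt_d9
    have he5 : (64 : ℝ) ≤ Real.exp 5 := by
      have : Real.exp 5 = Real.exp 1 ^ 5 := by rw [← Real.exp_nat_mul]; norm_num
      rw [this]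
      calc (64 : ℝ) ≤ 2.7 ^ 5 := by norm_num
        _ ≤ _ := by gcongr; linarith
    calc ((N.choose k : ℝ) * 2 ^ k) ≤ (Real.exp 1 * (N / k)) ^ k * 2 ^ k := by
          gcongr
          exact Nat.choose_le_exp_mul_div_pow hkpos
      _ ≤ (Real.exp 1 * 64 ^ i) ^ k * 2 ^ k := by gcongr
      _ = (2 * Real.exp 1 * 64 ^ i) ^ k := by rw [← mul_pow]; ring
      _ ≤ (Real.exp 1 * Real.exp 1 * Real.exp 5 ^ i) ^ k := by
          gcongr
          linarith
      _ = Real.exp ((2 + 5 * i) * k) := by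
          rw [← Real.exp_add, ← Real.exp_nat_mul, ← Real.exp_add, ← Real.exp_nat_mul]
          congr 1
          ring
      _ ≤ Real.exp (9 / 2 * 4 ^ i * k) := by
          gcongr
          nlinarith [(Nat.cast_nonneg i : (0 : ℝ) ≤ i)]
  -- Either `4 ^ i ≥ r`, or `k ≥ N / 64 ^ i` is large; since `64 ^ i = (4 ^ i) ^ 3`, the hypothesis
  -- `r ^ 3 ≤ N` is what is needed in the second case.
  have hexp : r ≤ 4 ^ i * k := by
    set a : ℝ := 4 ^ i
    have ha : 0 < a := by positivity
    have ha3 : (64 : ℝ) ^ i = a ^ 3 := by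
      simp only [a]
      rw [← pow_mul, mul_comm i 3, pow_mul]
      norm_num
    rcases le_or_gt r a with h0 | h0
    · nlinarith
    · rw [ha3, div_le_iff₀ (by positivity)] at hkN
      have h5 : r * a ^ 2 ≤ (a * k) * a ^ 2 := by
        calc r * a ^ 2 ≤ r * r ^ 2 := by gcongr
          _ = r ^ 3 := by ring
          _ ≤ _ := hr.trans (hkN.trans (le_of_eq (by ring)))
      exact le_of_mul_le_mul_right h5 (by positivity)
  calc _ ≤ ∑ q ∈ (Finset.univ.powersetCard k).sigma fun Z : Finset V => Z.powerset,
        P.real {ω | k * (3 * s * 2 ^ i) ≤ z q.1 q.2 ⬝ᵥ h ω} :=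
        measureReal_le_sum_of_subset hsub
    _ ≤ ∑ q ∈ (Finset.univ.powersetCard k).sigma fun Z : Finset V => Z.powerset,
        Real.exp (-(9 * 4 ^ i * k)) := Finset.sum_le_sum hterm
    _ = ((N.choose k : ℝ) * 2 ^ k) * Real.exp (-(9 * 4 ^ i * k)) := by
        rw [Finset.sum_const, nsmul_eq_mul, Finset.card_sigma,
          Finset.sum_congr rfl (g := fun _ => 2 ^ k) (fun Z hZ => by
            rw [Finset.card_powerset, (Finset.mem_powersetCard.mp hZ).2]),
          Finset.sum_const, Finset.card_powersetCard, Finset.card_univ]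
        simp [hN]
    _ ≤ Real.exp (9 / 2 * 4 ^ i * k) * Real.exp (-(9 * 4 ^ i * k)) := by gcongr
    _ = Real.exp (-(9 / 2) * (4 ^ i * k)) := by rw [← Real.exp_add]; ring_nf
    _ ≤ Real.exp (-4 * r) := Real.exp_le_exp.mpr (by linarith)

/-- The single term of the dyadic block containing `|x|` already dominates. The sum over blocks
turns counts of large entries into fourth moments. -/
theorem pow_four_le_dyadic {K x : ℝ} (D : ℕ) (hx : |x| ≤ K * 2 ^ D) :
    x ^ 4 ≤ K ^ 4 + ∑ i ∈ Finset.range D, if K * 2 ^ i < |x| then 16 * K ^ 4 * 16 ^ i else 0 := by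
  induction D with
  | zero =>
    simp only [pow_zero, mul_one] at hx
    simp only [Finset.range_zero, Finset.sum_empty, add_zero]
    rw [← Even.pow_abs (by decide : Even 4) x]
    gcongr
  | succ D ih =>
    rw [Finset.sum_range_succ]
    by_cases h : |x| ≤ K * 2 ^ D
    · rw [if_neg (not_lt.mpr h), add_zero]
      exact ih h
    · rw [if_pos (not_le.mp h)]
      have h1 : x ^ 4 ≤ 16 * K ^ 4 * 16 ^ D := by
        rw [← Even.pow_abs (by decide : Even 4) x]
        calc |x| ^ 4 ≤ (K * 2 ^ (D + 1)) ^ 4 := by gcongr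
          _ = _ := by
            rw [mul_pow, ← pow_mul, mul_comm (D + 1) 4, pow_mul, pow_succ]
            norm_num
            ring
      have h2 : 0 ≤ ∑ i ∈ Finset.range D, if K * 2 ^ i < |x| then 16 * K ^ 4 * 16 ^ i else 0 :=
        Finset.sum_nonneg fun i _ => by split_ifs <;> positivity
      have : 0 ≤ K ^ 4 := by positivity
      linarith

/-- The fourth moment of the entries of a subgaussian vector is of the expected order, with
stretched exponentially small failure probability. -/
theorem IsSubgaussianVector.measureReal_sum_pow_four_le {P : Measure Ω} [IsProbabilityMeasure P]
    {h : Ω → V → ℝ} {s : ℝ} (hs : 0 < s) (hh : IsSubgaussianVector P h (s ^ 2)) {r : ℝ}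
    (hr0 : 0 ≤ r) (hr : r ^ 3 ≤ Fintype.card V) (hV : 0 < Fintype.card V) :
    P.real {ω | ¬ ∑ u, h ω u ^ 4 ≤ 2000 * s ^ 4 * Fintype.card V} ≤
      (Fintype.card V + 1) * Real.exp (-4 * r) := by
  classical
  set N := Fintype.card V with hN
  have hN' : (0 : ℝ) < N := by exact_mod_cast hV
  have hsub : {ω | ¬ ∑ u, h ω u ^ 4 ≤ 2000 * s ^ 4 * N} ⊆
      ⋃ i ∈ Finset.range (N + 1), {ω | (N : ℝ) / 64 ^ i ≤
        (Finset.univ.filter fun u => 3 * s * 2 ^ i < |h ω u|).card} := by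
    intro ω hω
    by_contra hcon
    simp only [Set.mem_iUnion, Set.mem_ofPred_eq, not_exists, not_le, Finset.mem_range] at hcon
    refine hω ?_
    -- At level `N` the count is below `N / 64 ^ N ≤ 1`, hence zero, so `N` dyadic blocks suffice.
    -- Their total is the geometric series with ratio `16 / 64`.
    have htop : ∀ u, |h ω u| ≤ 3 * s * 2 ^ N := by
      intro u
      by_contra hu
      have h1 := hcon N (by omega)
      have h2 : 1 ≤ (Finset.univ.filter fun u => 3 * s * 2 ^ N < |h ω u|).card :=
        Finset.card_pos.mpr ⟨u, by simpa using hu⟩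
      have h3 : (N : ℝ) / 64 ^ N ≤ 1 := by
        rw [div_le_one (by positivity)]
        have : N < 64 ^ N := Nat.lt_pow_self (by norm_num)
        exact_mod_cast this.le
      have h4 : (1 : ℝ) ≤ (Finset.univ.filter fun u => 3 * s * 2 ^ N < |h ω u|).card := by
        exact_mod_cast h2
      linarith
    calc ∑ u, h ω u ^ 4 ≤ ∑ u, ((3 * s) ^ 4 + ∑ i ∈ Finset.range N,
          if 3 * s * 2 ^ i < |h ω u| then 16 * (3 * s) ^ 4 * 16 ^ i else 0) :=
          Finset.sum_le_sum fun u _ => pow_four_le_dyadic N (htop u)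
      _ = N * (3 * s) ^ 4 + ∑ i ∈ Finset.range N,
          (Finset.univ.filter fun u => 3 * s * 2 ^ i < |h ω u|).card *
            (16 * (3 * s) ^ 4 * 16 ^ i) := by
          rw [Finset.sum_add_distrib, Finset.sum_comm]
          simp only [← Finset.sum_filter, Finset.sum_const, nsmul_eq_mul, Finset.card_univ, ← hN]
      _ ≤ N * (3 * s) ^ 4 + ∑ i ∈ Finset.range N, N / 64 ^ i * (16 * (3 * s) ^ 4 * 16 ^ i) := by
          gcongr with i hi
          exact (hcon i (by have := Finset.mem_range.mp hi; omega)).le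
      _ = N * (3 * s) ^ 4 * (1 + 16 * ∑ i ∈ Finset.range N, (1 / 4 : ℝ) ^ i) := by
          rw [mul_add, mul_one, ← mul_assoc, Finset.mul_sum]
          congr 1
          refine Finset.sum_congr rfl fun i _ => ?_
          have : (64 : ℝ) ^ i = 16 ^ i * 4 ^ i := by rw [← mul_pow]; norm_num
          rw [this, one_div, inv_pow]
          field_simp
      _ ≤ N * (3 * s) ^ 4 * (1 + 16 * (4 / 3)) := by
          gcongr
          rw [geom_sum_eq (by norm_num)]
          have : (0 : ℝ) ≤ (1 / 4) ^ N := by positivity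
          rw [div_le_iff_of_neg (by norm_num)]
          linarith
      _ ≤ _ := by
          have : 0 ≤ s ^ 4 * N := by positivity
          nlinarith
  calc _ ≤ ∑ i ∈ Finset.range (N + 1), P.real {ω | (N : ℝ) / 64 ^ i ≤
        (Finset.univ.filter fun u => 3 * s * 2 ^ i < |h ω u|).card} :=
        measureReal_le_sum_of_subset hsub
    _ ≤ ∑ i ∈ Finset.range (N + 1), Real.exp (-4 * r) :=
        Finset.sum_le_sum fun i _ => hh.measureReal_card_le hs i hr0 hr hV
    _ = _ := by simp

end Subgaussian

end

noncomputable section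

open Matrix

/-! ### Bernoulli matrices -/

section Bernoulli

variable {Ω V W : Type*} [MeasurableSpace Ω]

/-- The entry of the centred interconnection matrix `C - p`. -/
def centredEntry (p : ℝ) (C : V → W → Bool) (u : V) (v : W) : ℝ :=
  (if C u v = true then 1 else 0) - p

/-- The row sums of the centred interconnection matrix. -/
def rowDeviation [Fintype W] (p : ℝ) (C : V → W → Bool) (u : V) : ℝ :=
  ∑ v, centredEntry p C u v

variable {P : Measure Ω} {C : Ω → V → W → Bool} {p : ℝ}

theorem IsIIDBernoulli.swap (h : IsIIDBernoulli P C p) :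
    IsIIDBernoulli P (fun ω v u => C ω u v) p where
  measurable v u := h.measurable u v
  prob v u := h.prob u v
  indep := h.indep.precomp (g := Prod.swap) Prod.swap_injective

theorem measurable_bool_ite_sub (p : ℝ) :
    Measurable fun b : Bool => (if b = true then (1 : ℝ) else 0) - p :=
  measurable_of_countable _

theorem IsIIDBernoulli.measurable_centredEntry (h : IsIIDBernoulli P C p) (u : V) (v : W) :
    Measurable fun ω => centredEntry p (C ω) u v :=
  (measurable_bool_ite_sub p).comp (h.measurable u v)

theorem IsIIDBernoulli.measurable_rowDeviation [Fintype W] (h : IsIIDBernoulli P C p) (u : V) :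
    Measurable fun ω => rowDeviation p (C ω) u :=
  Finset.measurable_sum _ fun v _ => h.measurable_centredEntry u v

theorem IsIIDBernoulli.iIndepFun_centredEntry (h : IsIIDBernoulli P C p) :
    iIndepFun (fun (e : V × W) ω => centredEntry p (C ω) e.1 e.2) P :=
  h.indep.comp (fun _ b => (if b = true then (1 : ℝ) else 0) - p)
    fun _ => measurable_bool_ite_sub p

theorem centredEntry_mem_Icc (p : ℝ) (C : V → W → Bool) (u : V) (v : W) :
    centredEntry p C u v ∈ Set.Icc (-p) (1 - p) := by
  rw [centredEntry]
  split_ifs <;> simp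

variable [IsProbabilityMeasure P]

theorem IsIIDBernoulli.integrable_centredEntry (h : IsIIDBernoulli P C p) (u : V) (v : W) :
    Integrable (fun ω => centredEntry p (C ω) u v) P :=
  Integrable.of_mem_Icc (-p) (1 - p) (h.measurable_centredEntry u v).aemeasurable
    (ae_of_all _ fun ω => centredEntry_mem_Icc p (C ω) u v)

theorem IsIIDBernoulli.integral_centredEntry (h : IsIIDBernoulli P C p) (hp : 0 ≤ p) (u : V)
    (v : W) : ∫ ω, centredEntry p (C ω) u v ∂P = 0 := by
  have hms : MeasurableSet {ω | C ω u v = true} := h.measurable u v (measurableSet_singleton true)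
  have h1 : (fun ω => centredEntry p (C ω) u v) =
      fun ω => Set.indicator {ω | C ω u v = true} (fun _ => (1 : ℝ)) ω - p := by
    ext ω
    simp [centredEntry, Set.indicator_apply]
  rw [h1, integral_sub ((integrable_const 1).indicator hms) (integrable_const p),
    integral_indicator_const _ hms, Measure.real, h.prob, ENNReal.toReal_ofReal hp]
  simp

theorem IsIIDBernoulli.hasSubgaussianMGF (h : IsIIDBernoulli P C p) (hp : 0 ≤ p) (u : V) (v : W) :
    HasSubgaussianMGF (fun ω => centredEntry p (C ω) u v) (1 / 4) P := by
  have h1 := hasSubgaussianMGF_of_mem_Icc_of_integral_eq_zero (μ := P)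
    (h.measurable_centredEntry u v).aemeasurable
    (ae_of_all _ fun ω => centredEntry_mem_Icc p (C ω) u v) (h.integral_centredEntry hp u v)
  convert h1 using 1
  have : (1 - p - -p) = 1 := by ring
  rw [this, nnnorm_one]
  norm_num

variable [Fintype V] [Fintype W]

/-- Hoeffding's inequality for linear functions of the centred interconnection matrix. -/
theorem IsIIDBernoulli.measureReal_sum_le (h : IsIIDBernoulli P C p) (hp : 0 ≤ p)
    (a : V → W → ℝ) (t b : ℝ) (ht : 0 ≤ t) (hb : 0 < b) (ha : ∑ u, ∑ v, a u v ^ 2 ≤ b) :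
    P.real {ω | t ≤ ∑ u, ∑ v, a u v * centredEntry p (C ω) u v} ≤
      Real.exp (-t ^ 2 / (1 / 2 * b)) := by
  have h1 : iIndepFun (fun (e : V × W) ω => a e.1 e.2 * centredEntry p (C ω) e.1 e.2) P :=
    h.iIndepFun_centredEntry.comp (fun e x => a e.1 e.2 * x) fun e => measurable_const_mul _
  have hce : ∀ e : V × W, HasSubgaussianMGF
      (fun ω => a e.1 e.2 * centredEntry p (C ω) e.1 e.2) (a e.1 e.2 ^ 2 / 4).toNNReal P := by
    intro e
    convert (h.hasSubgaussianMGF hp e.1 e.2).const_mul (a e.1 e.2) using 1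
    ext
    rw [Real.coe_toNNReal _ (by positivity)]
    change _ = a e.1 e.2 ^ 2 * ((1 / 4 : NNReal) : ℝ)
    norm_num
    ring
  have h2 := HasSubgaussianMGF.sum_of_iIndepFun h1 (s := Finset.univ) (fun e _ => hce e)
  have h3 : HasSubgaussianMGF (fun ω => ∑ e : V × W, a e.1 e.2 * centredEntry p (C ω) e.1 e.2)
      (b / 4).toNNReal P := by
    refine ⟨h2.integrable_exp_mul, fun s => (h2.mgf_le s).trans ?_⟩
    have hc : ((∑ e : V × W, (a e.1 e.2 ^ 2 / 4).toNNReal : NNReal) : ℝ) ≤ b / 4 := by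
      rw [NNReal.coe_sum]
      calc ∑ e : V × W, ((a e.1 e.2 ^ 2 / 4).toNNReal : ℝ) = ∑ e : V × W, a e.1 e.2 ^ 2 / 4 :=
            Finset.sum_congr rfl fun e _ => Real.coe_toNNReal _ (by positivity)
        _ = (∑ u, ∑ v, a u v ^ 2) / 4 := by rw [← Finset.sum_div, Fintype.sum_prod_type]
        _ ≤ b / 4 := by gcongr
    rw [Real.coe_toNNReal _ (by positivity)]
    refine Real.exp_le_exp.mpr ?_
    gcongr
  have h4 := h3.measure_ge_le ht
  simp only [Fintype.sum_prod_type, Real.coe_toNNReal _ (show 0 ≤ b / 4 by positivity)] at h4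
  refine h4.trans (le_of_eq ?_)
  congr 2
  ring

theorem IsIIDBernoulli.isSubgaussianVector_rowDeviation [Nonempty W] (h : IsIIDBernoulli P C p)
    (hp : 0 ≤ p) :
    IsSubgaussianVector P (fun ω => rowDeviation p (C ω)) (Fintype.card W / 2) := by
  intro z t b ht hb hz
  have hW : (0 : ℝ) < Fintype.card W := by exact_mod_cast Fintype.card_pos
  have h1 := h.measureReal_sum_le hp (fun u _ => z u) t (Fintype.card W * b) ht (by positivity) (by
    simp only [Finset.sum_const, Finset.card_univ, nsmul_eq_mul, ← Finset.mul_sum]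
    gcongr)
  have h2 : ∀ ω, z ⬝ᵥ rowDeviation p (C ω) = ∑ u, ∑ v, z u * centredEntry p (C ω) u v := by
    intro ω
    simp only [dotProduct, rowDeviation, Finset.mul_sum]
  simp only [h2]
  refine h1.trans (le_of_eq ?_)
  congr 2
  ring

/-! ### Independence of the rows -/

omit [Fintype V] [Fintype W] in
theorem IsIIDBernoulli.map_entry_eq (h : IsIIDBernoulli P C p) (u u' : V) (v v' : W) :
    P.map (fun ω => C ω u v) = P.map (fun ω => C ω u' v') := by
  have hpr : ∀ u v, IsProbabilityMeasure (P.map fun ω => C ω u v) := fun u v =>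
    Measure.isProbabilityMeasure_map (h.measurable u v).aemeasurable
  have htrue : ∀ u v, (P.map fun ω => C ω u v) {true} = ENNReal.ofReal p := by
    intro u v
    rw [Measure.map_apply (h.measurable u v) (measurableSet_singleton _), ← h.prob u v]
    rfl
  refine Measure.ext_of_singleton fun b => ?_
  have hfalse : ∀ u v, (P.map fun ω => C ω u v) {false} = 1 - ENNReal.ofReal p := by
    intro u v
    have : ({false} : Set Bool) = {true}ᶜ := by ext b; cases b <;> simp
    rw [this, prob_compl_eq_one_sub (measurableSet_singleton _), htrue]
  cases b
  · rw [hfalse, hfalse]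
  · rw [htrue, htrue]

omit [Fintype V] [Fintype W] in
-- The joint law is a product measure over pairs; currying it gives a product over rows of the row
-- laws.
theorem IsIIDBernoulli.iIndepFun_row (h : IsIIDBernoulli P C p) :
    iIndepFun (fun u ω => C ω u) P := by
  have hpr : ∀ u v, IsProbabilityMeasure (P.map fun ω => C ω u v) := fun u v =>
    Measure.isProbabilityMeasure_map (h.measurable u v).aemeasurable
  have hm := h.measurable
  rw [iIndepFun_iff_map_fun_eq_infinitePi_map (by fun_prop)]
  have h1 := (iIndepFun_iff_map_fun_eq_infinitePi_map (by fun_prop)).mp h.indep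
  have h2 := Measure.infinitePi_map_curry fun u v => P.map fun ω => C ω u v
  rw [← h1, Measure.map_map (by fun_prop) (by fun_prop)] at h2
  refine (Eq.trans ?_ h2).trans ?_
  · rfl
  · congr 1
    ext1 u
    have h3 : iIndepFun (fun v ω => C ω u v) P :=
      h.indep.precomp (g := fun v => (u, v)) fun v v' hv => by simpa using hv
    exact ((iIndepFun_iff_map_fun_eq_infinitePi_map (by fun_prop)).mp h3).symm

omit [Fintype V] in
theorem measurable_row_sum (p : ℝ) :
    Measurable fun b : W → Bool => ∑ v, ((if b v = true then (1 : ℝ) else 0) - p) :=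
  Finset.measurable_sum _ fun v _ => (measurable_bool_ite_sub p).comp (measurable_pi_apply v)

omit [Fintype V] in
theorem IsIIDBernoulli.iIndepFun_rowDeviation (h : IsIIDBernoulli P C p) :
    iIndepFun (fun u ω => rowDeviation p (C ω) u) P :=
  h.iIndepFun_row.comp (fun _ b => ∑ v, ((if b v = true then (1 : ℝ) else 0) - p))
    fun _ => measurable_row_sum p

omit [Fintype V] in
-- The union bound over sets of low rows needs one exact common probability `q`: the factor `q ^ k`
-- must offset the number of sets, which a mere lower bound on `q` would not allow.
theorem IsIIDBernoulli.measureReal_rowDeviation_eq (h : IsIIDBernoulli P C p) (s : ℝ) (u u' : V) :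
    P.real {ω | rowDeviation p (C ω) u ≤ s} = P.real {ω | rowDeviation p (C ω) u' ≤ s} := by
  have hm := h.measurable
  have hrow : ∀ u, P.map (fun ω v => C ω u v) =
      Measure.infinitePi fun v => P.map fun ω => C ω u v := fun u =>
    (iIndepFun_iff_map_fun_eq_infinitePi_map (by fun_prop)).mp
      (h.indep.precomp (g := fun v => (u, v)) fun v v' hv => by simpa using hv)
  have heq : P.map (fun ω v => C ω u v) = P.map (fun ω v => C ω u' v) := by
    rw [hrow, hrow]
    congr 1
    ext1 v
    exact h.map_entry_eq u u' v v
  have hmeas : MeasurableSet {b : W → Bool |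
      ∑ v, ((if b v = true then (1 : ℝ) else 0) - p) ≤ s} :=
    measurableSet_le (measurable_row_sum p) measurable_const
  have h1 : ∀ u, P.real {ω | rowDeviation p (C ω) u ≤ s} = (P.map (fun ω v => C ω u v)).real
      {b : W → Bool | ∑ v, ((if b v = true then (1 : ℝ) else 0) - p) ≤ s} := by
    intro u
    rw [map_measureReal_apply (by fun_prop) hmeas]
    rfl
  rw [h1, h1, heq]

/-! ### A lower bound for the lower tail -/

omit [Fintype V] in
/-- The row sums are below `-a` standard deviations with a probability bounded from below. -/
theorem exists_lower_tail {p : ℝ} (hp0 : 0 < p) (hp1 : p < 1) {a : ℝ} (ha : 0 ≤ a) :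
    ∃ q > 0, ∃ M₀ : ℕ, ∀ {Ω V W : Type*} [MeasurableSpace Ω] [Fintype W] {P : Measure Ω}
      [IsProbabilityMeasure P] {C : Ω → V → W → Bool}, IsIIDBernoulli P C p →
      M₀ ≤ Fintype.card W → ∀ u,
      q ≤ P.real {ω | rowDeviation p (C ω) u ≤ -(a * √(Fintype.card W))} := by
  set m : ℝ := min p (1 - p) with hm
  have hm0 : 0 < m := lt_min hp0 (by linarith)
  -- A second moment argument for `exp (-η e)` with `η = θ / √M`: its mean is at least `exp (θ a) +
  -- 1`, its second moment is at most `exp (θ ^ 2 / 2)`, and off the target event it stays below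
  -- `exp (θ a)`. A large `θ` makes the quadratic gain in the mean beat `θ a`.
  obtain ⟨θ, hθ0, hθ⟩ : ∃ θ : ℝ, 0 < θ ∧ θ * a + 1 ≤ m ^ 2 * θ ^ 2 / 8 := by
    refine ⟨8 * (a + 1) / m ^ 2 + 1, by positivity, ?_⟩
    set θ : ℝ := 8 * (a + 1) / m ^ 2 + 1
    have h1 : 8 * (a + 1) ≤ m ^ 2 * θ := by
      have : m ^ 2 * θ = 8 * (a + 1) + m ^ 2 := by
        simp only [θ]
        field_simp
      nlinarith [sq_nonneg m]
    have h2 : 1 ≤ θ := by simp only [θ]; linarith [show 0 ≤ 8 * (a + 1) / m ^ 2 by positivity]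
    nlinarith
  refine ⟨Real.exp (-(θ ^ 2 / 2)), Real.exp_pos _, ⌈θ ^ 2⌉₊ + ⌈m ^ 2 * θ ^ 2 / 4⌉₊ + 1, ?_⟩
  intro Ω V W _ _ P _ C h hM u
  set M := Fintype.card W with hMdef
  have hM1 : (1 : ℝ) ≤ M := by exact_mod_cast (by omega : 1 ≤ M)
  have hMθ : θ ^ 2 ≤ M := (Nat.le_ceil _).trans (by exact_mod_cast (by omega))
  have hMy : m ^ 2 * θ ^ 2 / 4 ≤ M := (Nat.le_ceil _).trans (by exact_mod_cast (by omega))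
  have hsM : 0 < √(M : ℝ) := Real.sqrt_pos.mpr (by linarith)
  have hsM2 : √(M : ℝ) ^ 2 = M := Real.sq_sqrt (by linarith)
  set η : ℝ := θ / √M with hη
  have hη0 : 0 < η := by positivity
  have hη2 : η ^ 2 * M = θ ^ 2 := by
    rw [hη, div_pow, hsM2]
    field_simp
  have hη1 : η ≤ 1 := by
    rw [hη, div_le_one hsM]
    exact Real.le_sqrt_of_sq_le hMθ
  set e : Ω → ℝ := fun ω => rowDeviation p (C ω) u with he
  have hemeas : Measurable e := h.measurable_rowDeviation u
  have hind : iIndepFun (fun v ω => centredEntry p (C ω) u v) P :=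
    h.iIndepFun_centredEntry.precomp (g := fun v => (u, v)) fun v v' hv => by simpa using hv
  have hsub : HasSubgaussianMGF e (∑ v : W, (1 / 4 : NNReal)) P :=
    HasSubgaussianMGF.sum_of_iIndepFun hind fun v _ => h.hasSubgaussianMGF hp0.le u v
  have hint : ∀ s, Integrable (fun ω => Real.exp (s * e ω)) P := hsub.integrable_exp_mul
  have hb2 : ∫ ω, Real.exp (-2 * η * e ω) ∂P ≤ Real.exp (θ ^ 2 / 2) := by
    refine (hsub.mgf_le (-2 * η)).trans (Real.exp_le_exp.mpr (le_of_eq ?_))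
    simp only [Finset.sum_const, Finset.card_univ, nsmul_eq_mul, ← hMdef]
    push_cast
    rw [← hη2]
    ring
  have hentry : ∀ v, 1 + η ^ 2 * m ^ 2 / 4 ≤ mgf (fun ω => centredEntry p (C ω) u v) P (-η) := by
    intro v
    -- Taylor expansion to second order. The entry has modulus `p` or `1 - p`, hence at least `m`;
    -- this is where `0 < p < 1` enters.
    have hpt : ∀ ω, 1 - η * centredEntry p (C ω) u v + η ^ 2 * m ^ 2 / 4 ≤
        Real.exp (-η * centredEntry p (C ω) u v) := by
      intro ω
      set x := centredEntry p (C ω) u v with hx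
      have hx1 : |x| ≤ 1 := by
        have := centredEntry_mem_Icc p (C ω) u v
        rw [Set.mem_Icc] at this
        rw [abs_le]
        constructor <;> linarith
      have hx2 : m ^ 2 ≤ x ^ 2 := by
        rw [hx, centredEntry]
        split_ifs
        · exact pow_le_pow_left₀ hm0.le (min_le_right _ _) 2
        · rw [zero_sub, neg_sq]
          exact pow_le_pow_left₀ hm0.le (min_le_left _ _) 2
      have hx3 : |-η * x| ≤ 1 := by
        rw [abs_mul, abs_neg, abs_of_pos hη0]
        exact mul_le_one₀ hη1 (abs_nonneg _) hx1
      have h2 := Real.exp_bound (x := -η * x) hx3 (n := 3) (by norm_num)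
      simp only [Finset.sum_range_succ, Finset.range_zero, Finset.sum_empty, pow_zero,
        Nat.factorial_zero, Nat.cast_one, pow_one, Nat.factorial_one] at h2
      norm_num [Nat.factorial] at h2
      have h3 := (abs_le.mp h2).1
      have h4 : (|η| * |x|) ^ 3 ≤ (η * x) ^ 2 := by
        rw [← abs_mul, ← sq_abs (η * x)]
        have h5 : |η * x| ≤ 1 := by simpa using hx3
        have := abs_nonneg (η * x)
        nlinarith [sq_nonneg (|η * x|)]
      have h5 : η ^ 2 * m ^ 2 ≤ (η * x) ^ 2 := by
        rw [mul_pow]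
        gcongr
      have h6 : -η * x = -(η * x) := by ring
      rw [h6]
      linarith [sq_nonneg (η * x)]
    calc 1 + η ^ 2 * m ^ 2 / 4 =
        ∫ ω, (1 - η * centredEntry p (C ω) u v + η ^ 2 * m ^ 2 / 4) ∂P := by
          rw [integral_add, integral_sub, integral_const_mul, h.integral_centredEntry hp0.le]
          · simp
          · exact integrable_const _
          · exact (h.integrable_centredEntry u v).const_mul _
          · exact (integrable_const _).sub ((h.integrable_centredEntry u v).const_mul _)
          · exact integrable_const _
      _ ≤ _ := by
          refine integral_mono ?_ ((h.hasSubgaussianMGF hp0.le u v).integrable_exp_mul _) hpt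
          exact ((integrable_const _).sub
            ((h.integrable_centredEntry u v).const_mul _)).add (integrable_const _)
  have hlow : Real.exp (θ * a) + 1 ≤ ∫ ω, Real.exp (-η * e ω) ∂P := by
    have h1 : ∫ ω, Real.exp (-η * e ω) ∂P =
        ∏ v, mgf (fun ω => centredEntry p (C ω) u v) P (-η) := by
      have := iIndepFun.mgf_sum hind (fun v => h.measurable_centredEntry u v) (t := -η)
        Finset.univ
      rw [← this, mgf]
      simp only [he, rowDeviation, Finset.sum_apply]
    set y : ℝ := η ^ 2 * m ^ 2 / 4 with hy
    have hyM : y * M = m ^ 2 * θ ^ 2 / 4 := by rw [hy, ← hη2]; ring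
    have hy0 : 0 ≤ y := by positivity
    have hy1 : y ≤ 1 := by
      have : y * M ≤ 1 * M := by rw [hyM]; linarith
      exact le_of_mul_le_mul_right this (by linarith)
    have hexp : Real.exp (y / 2) ≤ 1 + y := by
      have h2 := Real.add_one_le_exp (-(y / 2))
      have h3 : Real.exp (y / 2) * Real.exp (-(y / 2)) = 1 := by
        rw [← Real.exp_add]; simp
      have h4 := Real.exp_pos (y / 2)
      nlinarith
    calc Real.exp (θ * a) + 1 ≤ Real.exp (θ * a) * Real.exp 1 := by
          have h2 := Real.exp_one_gt_d9
          have h3 : 1 ≤ Real.exp (θ * a) := Real.one_le_exp (by positivity)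
          nlinarith
      _ = Real.exp (θ * a + 1) := by rw [Real.exp_add]
      _ ≤ Real.exp (M * (y / 2)) := by
          refine Real.exp_le_exp.mpr (hθ.trans (le_of_eq ?_))
          linarith
      _ = Real.exp (y / 2) ^ M := by rw [← Real.exp_nat_mul]
      _ ≤ (1 + y) ^ M := by gcongr
      _ = ∏ _v : W, (1 + y) := by simp [hMdef]
      _ ≤ ∏ v, mgf (fun ω => centredEntry p (C ω) u v) P (-η) :=
          Finset.prod_le_prod (fun v _ => by positivity) fun v _ => hentry v
      _ = _ := h1.symm
  set τ : ℝ := Real.exp (θ ^ 2 / 2) with hτ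
  have hτ0 : 0 < τ := Real.exp_pos _
  set E : Set Ω := {ω | e ω ≤ -(a * √M)} with hE
  have hEm : MeasurableSet E := measurableSet_le hemeas measurable_const
  -- On the event, `b ≤ b ^ 2 / (2 τ) + τ / 2`; the choice of `τ` as the second moment bound makes
  -- the middle term at most `1 / 2` in mean.
  have hpt : ∀ ω, Real.exp (-η * e ω) ≤ Real.exp (θ * a) +
      Real.exp (-2 * η * e ω) / (2 * τ) + τ / 2 * E.indicator (fun _ => (1 : ℝ)) ω := by
    intro ω
    have hsq : Real.exp (-2 * η * e ω) = Real.exp (-η * e ω) ^ 2 := by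
      rw [← Real.exp_nat_mul]
      congr 1
      push_cast
      ring
    by_cases hω : ω ∈ E
    · rw [Set.indicator_of_mem hω, hsq]
      set b := Real.exp (-η * e ω)
      have h1 : 0 ≤ (b - τ) ^ 2 / (2 * τ) := by positivity
      have h2 : (b - τ) ^ 2 / (2 * τ) = b ^ 2 / (2 * τ) + τ / 2 - b := by
        field_simp
        ring
      have := Real.exp_pos (θ * a)
      linarith
    · rw [Set.indicator_of_notMem hω]
      have h1 : -(a * √M) < e ω := not_le.mp hω
      have h2 : Real.exp (-η * e ω) ≤ Real.exp (θ * a) := by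
        refine Real.exp_le_exp.mpr ?_
        have h3 : η * √M = θ := by rw [hη]; field_simp
        nlinarith
      have h3 : 0 ≤ Real.exp (-2 * η * e ω) / (2 * τ) := by positivity
      linarith
  have hI : ∫ ω, Real.exp (-η * e ω) ∂P ≤ Real.exp (θ * a) +
      (∫ ω, Real.exp (-2 * η * e ω) ∂P) / (2 * τ) + τ / 2 * P.real E := by
    have h1 : Integrable (fun ω => Real.exp (-2 * η * e ω) / (2 * τ)) P :=
      (hint (-2 * η)).div_const _
    have h2 : Integrable (fun ω => τ / 2 * E.indicator (fun _ => (1 : ℝ)) ω) P :=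
      ((integrable_const 1).indicator hEm).const_mul _
    have h3 := integral_mono (hint (-η)) (((integrable_const (Real.exp (θ * a))).add h1).add h2) hpt
    refine h3.trans (le_of_eq ?_)
    have h4 := integral_add (integrable_const (μ := P) (Real.exp (θ * a))) h1
    have h5 := integral_add ((integrable_const (μ := P) (Real.exp (θ * a))).add h1) h2
    simp only [Pi.add_apply] at h4 h5 ⊢
    rw [h5, h4, integral_div, integral_const_mul, integral_indicator_const _ hEm]
    simp
  have h5 : (∫ ω, Real.exp (-2 * η * e ω) ∂P) / (2 * τ) ≤ 1 / 2 := by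
    rw [div_le_iff₀ (by positivity)]
    linarith
  have h6 : 1 / 2 ≤ τ / 2 * P.real E := by linarith
  have h7 : Real.exp (-(θ ^ 2 / 2)) = 1 / τ := by rw [Real.exp_neg, hτ, one_div]
  rw [h7, div_le_iff₀ hτ0]
  linarith

end Bernoulli

end

noncomputable section

open Matrix

/-! ### Trial vectors of low energy -/

section Trial

variable {Ω V : Type*} [MeasurableSpace Ω] [Fintype V] [DecidableEq V]

omit [DecidableEq V] in
-- Column `u` is the projection of a unit vector; its squared length is its own `u`-th entry. These
-- columns are the later trial vectors.
theorem projection_sum_sq {π : Matrix V V ℝ} (hT : πᵀ = π) (hπ : π * π = π) (u : V) :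
    ∑ w, π w u ^ 2 = π u u := by
  have h1 : (π * π) u u = π u u := by rw [hπ]
  rw [← h1, Matrix.mul_apply]
  refine Finset.sum_congr rfl fun w _ => ?_
  rw [show π u w = π w u from congrFun (congrFun hT w) u, sq]

theorem projection_diag_sq_le {π : Matrix V V ℝ} (hT : πᵀ = π) (hπ : π * π = π) (u : V) :
    π u u ^ 2 ≤ π u u := by
  conv_rhs => rw [← projection_sum_sq hT hπ u]
  exact Finset.single_le_sum (f := fun w => π w u ^ 2) (fun w _ => sq_nonneg _)
    (Finset.mem_univ u)

theorem projection_diag_le_one {π : Matrix V V ℝ} (hT : πᵀ = π) (hπ : π * π = π) (u : V) :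
    π u u ≤ 1 := by
  nlinarith [projection_diag_sq_le hT hπ u]

/-- With its coefficients on `J` set to zero, the linear form depends only on coordinates outside
`J` and is independent of the event on `J`. -/
theorem iIndepFun.measureReal_biInter_inter_eq {P : Measure Ω}
    [IsProbabilityMeasure P]
    {e : Ω → V → ℝ} (hind : iIndepFun (fun u ω => e ω u) P)
    (hm : ∀ u, Measurable fun ω => e ω u) {s q : ℝ}
    (hlow : ∀ u, P.real {ω | e ω u ≤ -s} = q) (J : Finset V) (t : V → ℝ) (a : ℝ) :
    P.real ({ω | ∀ u ∈ J, e ω u ≤ -s} ∩ {ω | a ≤ (fun w => if w ∈ J then 0 else t w) ⬝ᵥ e ω}) =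
      q ^ J.card * P.real {ω | a ≤ (fun w => if w ∈ J then 0 else t w) ⬝ᵥ e ω} := by
  have h1 := hind.indepFun_finset J Jᶜ disjoint_compl_right hm
  have h2 := h1.measure_inter_preimage_eq_mul {x : J → ℝ | ∀ i, x i ≤ -s}
    {x : ((Jᶜ : Finset V) : Type _) → ℝ | a ≤ ∑ i : ((Jᶜ : Finset V) : Type _), t i * x i}
    (by
      rw [Set.ofPred_forall]
      exact MeasurableSet.iInter fun i => measurableSet_le (measurable_pi_apply i) measurable_const)
    (measurableSet_le measurable_const (Finset.measurable_sum _ fun i _ =>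
      (measurable_pi_apply i).const_mul _))
  have hA : (fun ω (i : J) => e ω i) ⁻¹' {x : J → ℝ | ∀ i, x i ≤ -s} =
      {ω | ∀ u ∈ J, e ω u ≤ -s} := by
    ext ω
    simp
  have hB : (fun ω (i : (Jᶜ : Finset V)) => e ω i) ⁻¹' {x | a ≤ ∑ i : ((Jᶜ : Finset V) : Type _), t i * x i} =
      {ω | a ≤ (fun w => if w ∈ J then 0 else t w) ⬝ᵥ e ω} := by
    ext ω
    simp only [Set.mem_preimage, Set.mem_ofPred_eq, dotProduct]
    have : ∑ i : (Jᶜ : Finset V), t i * e ω i = ∑ w, (if w ∈ J then 0 else t w) * e ω w := by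
      rw [Finset.sum_coe_sort (Jᶜ) fun w => t w * e ω w]
      have h3 : ∀ w, (if w ∈ J then 0 else t w) * e ω w = if w ∈ Jᶜ then t w * e ω w else 0 := by
        intro w
        by_cases hw : w ∈ J <;> simp [hw]
      simp only [h3, Finset.sum_ite_mem, Finset.univ_inter]
    rw [this]
  rw [hA, hB] at h2
  have h3 : P.real {ω | ∀ u ∈ J, e ω u ≤ -s} = q ^ J.card := by
    have h4 := hind.measure_inter_preimage_eq_mul J (sets := fun _ => Set.Iic (-s))
      (fun _ _ => measurableSet_Iic)
    have h5 : (⋂ u ∈ J, (fun ω => e ω u) ⁻¹' Set.Iic (-s)) = {ω | ∀ u ∈ J, e ω u ≤ -s} := by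
      ext ω
      simp
    rw [h5] at h4
    rw [Measure.real, h4, ENNReal.toReal_prod, ← Finset.prod_const]
    exact Finset.prod_congr rfl fun u _ => hlow u
  rw [Measure.real, h2, ENNReal.toReal_mul]
  change P.real _ * P.real _ = _
  rw [h3]

omit [Fintype V] [DecidableEq V] in
/-- A lower bound for the number of low coordinates of a vector with independent entries. -/
theorem iIndepFun.measureReal_card_low_le {P : Measure Ω} [IsProbabilityMeasure P]
    {e : Ω → V → ℝ} (hind : iIndepFun (fun u ω => e ω u) P)
    (hm : ∀ u, Measurable fun ω => e ω u) {s q : ℝ} (hq : 0 ≤ q)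
    (hlow : ∀ u, P.real {ω | e ω u ≤ -s} = q) (G : Finset V) :
    P.real {ω | ((G.filter fun u => e ω u ≤ -s).card : ℝ) ≤ q * G.card / 2} ≤
      Real.exp (-(q ^ 2 * G.card / 2)) := by
  classical
  set g : ℝ → ℝ := fun x => q - (Set.Iic (-s)).indicator (fun _ => (1 : ℝ)) x with hg
  have hgm : Measurable g := measurable_const.sub (measurable_const.indicator measurableSet_Iic)
  have h1 : iIndepFun (fun u ω => g (e ω u)) P := hind.comp (fun _ => g) fun _ => hgm
  have h2 : ∀ u, HasSubgaussianMGF (fun ω => g (e ω u)) (1 / 4) P := by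
    intro u
    have hI : ∀ ω, g (e ω u) = q - {ω | e ω u ≤ -s}.indicator (fun _ => (1 : ℝ)) ω := by
      intro ω
      simp [hg, Set.indicator_apply]
    have hms : MeasurableSet {ω | e ω u ≤ -s} := measurableSet_le (hm u) measurable_const
    have h3 := hasSubgaussianMGF_of_mem_Icc_of_integral_eq_zero (μ := P) (a := q - 1) (b := q)
      (X := fun ω => g (e ω u)) (hgm.comp (hm u)).aemeasurable
      (ae_of_all _ fun ω => by
        rw [hI, Set.indicator_apply]
        split_ifs <;> simp)
      (by
        simp only [hI]
        rw [integral_sub (integrable_const _) ((integrable_const _).indicator hms),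
          integral_indicator_const _ hms, hlow]
        simp)
    convert h3 using 1
    rw [sub_sub_cancel, nnnorm_one]
    norm_num
  have h4 := HasSubgaussianMGF.measure_sum_ge_le_of_iIndepFun h1 (s := G) (fun u _ => h2 u)
    (ε := q * G.card / 2) (by positivity)
  have hsum : ∀ ω, ∑ u ∈ G, g (e ω u) = q * G.card - (G.filter fun u => e ω u ≤ -s).card := by
    intro ω
    simp only [hg, Finset.sum_sub_distrib, Finset.sum_const, nsmul_eq_mul, Set.indicator_apply,
      Set.mem_Iic, Finset.card_filter]
    push_cast
    ring
  have h5 : {ω | ((G.filter fun u => e ω u ≤ -s).card : ℝ) ≤ q * G.card / 2} =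
      {ω | q * G.card / 2 ≤ ∑ u ∈ G, g (e ω u)} := by
    ext ω
    simp only [Set.mem_ofPred_eq, hsum]
    constructor <;> intro h <;> linarith
  rw [h5]
  refine h4.trans (le_of_eq ?_)
  simp only [Finset.sum_const, nsmul_eq_mul]
  push_cast
  rcases Nat.eq_zero_or_pos G.card with h0 | h0
  · simp [h0]
  · have : (0 : ℝ) < G.card := by exact_mod_cast h0
    congr 1
    field_simp
    ring

/-- Sum the form over the columns in `J`. Each row `w ∈ J` carries weight at least `π w w ^ 2 ≥ δ ^
2 / 4` and value at most `-s`, while the rows outside `J` add less than `K` per column. If every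
column failed, the sum would exceed `-R |J|`, a contradiction. -/
theorem trial_of_low_set {e : V → ℝ} {π : Matrix V V ℝ} (hT : πᵀ = π) (hπ : π * π = π)
    {s K R δ : ℝ} (hδ : 0 < δ) (hs : R + K ≤ s * δ ^ 2 / 4) (hR : 0 ≤ R) (hK : 0 ≤ K)
    {J : Finset V} (hJ : 0 < J.card) (hJδ : ∀ u ∈ J, δ / 2 ≤ π u u) (hJs : ∀ u ∈ J, e u ≤ -s)
    (hJK : (fun w => if w ∈ J then 0 else ∑ u ∈ J, π w u ^ 2) ⬝ᵥ e < K * J.card) :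
    ∃ u, 0 < π u u ∧ ∑ w, e w * π w u ^ 2 ≤ -R * π u u := by
  by_contra! hcon
  have hs0 : 0 ≤ s := by
    by_contra hs0
    push Not at hs0
    have : s * δ ^ 2 / 4 < 0 := by
      have := mul_neg_of_neg_of_pos hs0 (pow_pos hδ 2)
      linarith
    linarith
  have h1 : ∑ u ∈ J, -R * π u u < ∑ u ∈ J, ∑ w, e w * π w u ^ 2 := by
    refine Finset.sum_lt_sum_of_nonempty (Finset.card_pos.mp hJ) fun u hu => hcon u ?_
    linarith [hJδ u hu]
  have h2 : ∑ u ∈ J, ∑ w, e w * π w u ^ 2 =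
      (∑ w ∈ J, e w * ∑ u ∈ J, π w u ^ 2) +
        (fun w => if w ∈ J then 0 else ∑ u ∈ J, π w u ^ 2) ⬝ᵥ e := by
    rw [Finset.sum_comm]
    simp only [← Finset.mul_sum, dotProduct]
    rw [← Finset.sum_filter_add_sum_filter_not Finset.univ (fun w => w ∈ J), Finset.filter_mem_eq_inter,
      Finset.univ_inter]
    congr 1
    rw [Finset.sum_filter]
    refine Finset.sum_congr rfl fun w _ => ?_
    by_cases hw : w ∈ J <;> simp [hw, mul_comm]
  have h3 : ∑ w ∈ J, e w * ∑ u ∈ J, π w u ^ 2 ≤ ∑ w ∈ J, -(s * δ ^ 2 / 4) := by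
    refine Finset.sum_le_sum fun w hw => ?_
    have h4 : δ ^ 2 / 4 ≤ ∑ u ∈ J, π w u ^ 2 := by
      have h5 : π w w ^ 2 ≤ ∑ u ∈ J, π w u ^ 2 :=
        Finset.single_le_sum (f := fun u => π w u ^ 2) (fun u _ => sq_nonneg _) hw
      have h6 : (δ / 2) ^ 2 ≤ π w w ^ 2 := pow_le_pow_left₀ (by positivity) (hJδ w hw) 2
      nlinarith
    calc e w * ∑ u ∈ J, π w u ^ 2 ≤ -s * ∑ u ∈ J, π w u ^ 2 := by
          gcongr
          exact hJs w hw
      _ ≤ -(s * δ ^ 2 / 4) := by nlinarith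
  have h4 : ∑ u ∈ J, π u u ≤ J.card := by
    have := Finset.sum_le_sum (s := J) fun u _ => projection_diag_le_one hT hπ u
    simpa using this
  rw [h2, ← Finset.mul_sum] at h1
  rw [Finset.sum_const, nsmul_eq_mul] at h3
  have h5 : (0 : ℝ) < J.card := by exact_mod_cast hJ
  nlinarith

/-- In a subspace of positive relative dimension there is, with overwhelming probability, a
vector on which a random diagonal form is very negative. -/
theorem measureReal_no_trial_le {P : Measure Ω} [IsProbabilityMeasure P] {e : Ω → V → ℝ}
    (hind : iIndepFun (fun u ω => e ω u) P) (hm : ∀ u, Measurable fun ω => e ω u)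
    {S : ℝ} (hS : 0 < S) (hsub : IsSubgaussianVector P e S) {s q δ R : ℝ} (hq : 0 < q)
    (hlow : ∀ u, P.real {ω | e ω u ≤ -s} = q) {π : Matrix V V ℝ} (hT : πᵀ = π) (hπ : π * π = π)
    (hδ : 0 < δ) (htr : δ * Fintype.card V ≤ π.trace) (hR : 0 ≤ R)
    (hs : R + 2 * √S ≤ s * δ ^ 2 / 4) (hV : 0 < Fintype.card V) :
    P.real {ω | ¬ ∃ u, 0 < π u u ∧ ∑ w, e ω w * π w u ^ 2 ≤ -R * π u u} ≤
      2 * Real.exp (-(q ^ 2 * δ * Fintype.card V / 4)) := by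
  set N := Fintype.card V with hN
  have hN' : (0 : ℝ) < N := by exact_mod_cast hV
  have hq1 : q ≤ 1 := by
    obtain ⟨u⟩ : Nonempty V := Fintype.card_pos_iff.mp hV
    rw [← hlow u]
    exact measureReal_le_one
  -- Diagonal entries are at most `1`, so a trace of at least `δ N` forces at least `δ N / 2`
  -- coordinates into `G`.
  set G : Finset V := Finset.univ.filter fun u => δ / 2 ≤ π u u with hG
  have hGcard : δ / 2 * N ≤ G.card := by
    have h1 : π.trace ≤ ∑ u, ((if u ∈ G then (1 : ℝ) else 0) + δ / 2) := by
      refine Finset.sum_le_sum fun u _ => ?_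
      rw [Matrix.diag_apply]
      split_ifs with hu
      · linarith [projection_diag_le_one hT hπ u]
      · simp only [hG, Finset.mem_filter, Finset.mem_univ, true_and, not_le] at hu
        linarith
    rw [Finset.sum_add_distrib] at h1
    simp only [Finset.sum_ite_mem, Finset.univ_inter, Finset.sum_const, nsmul_eq_mul, mul_one,
      Finset.card_univ, ← hN] at h1
    linarith
  have hG0 : (0 : ℝ) < G.card := lt_of_lt_of_le (by positivity) hGcard
  set k := ⌈q * G.card / 2⌉₊ with hk
  have hkpos : 0 < k := Nat.ceil_pos.mpr (by positivity)
  have hk' : (0 : ℝ) < k := by exact_mod_cast hkpos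
  have hkG : q * G.card / 2 ≤ k := Nat.le_ceil _
  -- This constant makes the tail of the outside contribution at height `K k` equal to `exp (-4 k)`.
  set K : ℝ := 2 * √S with hK
  have hK0 : 0 ≤ K := by positivity
  let B : Finset V → Set Ω := fun J => {ω | ∀ u ∈ J, e ω u ≤ -s} ∩
    {ω | K * k ≤ (fun w => if w ∈ J then 0 else ∑ u ∈ J, π w u ^ 2) ⬝ᵥ e ω}
  have hcover : {ω | ¬ ∃ u, 0 < π u u ∧ ∑ w, e ω w * π w u ^ 2 ≤ -R * π u u} ⊆
      {ω | ((G.filter fun u => e ω u ≤ -s).card : ℝ) ≤ q * G.card / 2} ∪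
        ⋃ J ∈ G.powersetCard k, B J := by
    intro ω hω
    by_contra hcon
    simp only [Set.mem_union, Set.mem_ofPred_eq, Set.mem_iUnion, not_or, not_le, not_exists] at hcon
    obtain ⟨hc1, hc2⟩ := hcon
    have h1 : k ≤ (G.filter fun u => e ω u ≤ -s).card := Nat.ceil_le.mpr hc1.le
    obtain ⟨J, hJ, hJk⟩ := Finset.exists_subset_card_eq h1
    have hJ1 : ∀ u ∈ J, u ∈ G ∧ e ω u ≤ -s := fun u hu => by simpa using hJ hu
    have h2 := hc2 J (Finset.mem_powersetCard.mpr ⟨fun u hu => (hJ1 u hu).1, hJk⟩)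
    have h3 : (fun w => if w ∈ J then 0 else ∑ u ∈ J, π w u ^ 2) ⬝ᵥ e ω < K * J.card := by
      rw [hJk]
      by_contra h4
      exact h2 ⟨fun u hu => (hJ1 u hu).2, not_lt.mp h4⟩
    exact hω (trial_of_low_set hT hπ hδ hs hR hK0 (by omega)
      (fun u hu => by simpa [hG] using (hJ1 u hu).1) (fun u hu => (hJ1 u hu).2) h3)
  have hB : ∀ J ∈ G.powersetCard k, P.real (B J) ≤ q ^ k * Real.exp (-4 * k) := by
    intro J hJ
    have hJk := (Finset.mem_powersetCard.mp hJ).2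
    rw [iIndepFun.measureReal_biInter_inter_eq hind hm hlow J, hJk]
    gcongr
    have hsymm : ∀ w u, π w u = π u w := fun w u => congrFun (congrFun hT u) w
    have h1 : ∑ w, (if w ∈ J then 0 else ∑ u ∈ J, π w u ^ 2) ^ 2 ≤ k := by
      calc ∑ w, (if w ∈ J then 0 else ∑ u ∈ J, π w u ^ 2) ^ 2 ≤ ∑ w, ∑ u ∈ J, π w u ^ 2 := by
            refine Finset.sum_le_sum fun w _ => ?_
            have h2 : 0 ≤ ∑ u ∈ J, π w u ^ 2 := Finset.sum_nonneg fun u _ => sq_nonneg _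
            have h3 : ∑ u ∈ J, π w u ^ 2 ≤ 1 := by
              refine (Finset.sum_le_univ_sum_of_nonneg fun u => sq_nonneg _).trans ?_
              simp only [hsymm w]
              rw [projection_sum_sq hT hπ]
              exact projection_diag_le_one hT hπ w
            split_ifs
            · simpa using h2
            · nlinarith
        _ = ∑ u ∈ J, π u u := by
            rw [Finset.sum_comm]
            exact Finset.sum_congr rfl fun u _ => projection_sum_sq hT hπ u
        _ ≤ k := by
            rw [← hJk]
            simpa using Finset.sum_le_sum (s := J) fun u _ => projection_diag_le_one hT hπ u
    refine (hsub _ (K * k) k (by positivity) hk' h1).trans (le_of_eq ?_)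
    congr 1
    have : √S ^ 2 = S := Real.sq_sqrt hS.le
    rw [hK, mul_pow, mul_pow, this]
    field_simp
    norm_num
  -- The lowness of `J` pays for its choice: `choose |G| k * q ^ k ≤ (e q |G| / k) ^ k ≤ (2 e) ^ k`,
  -- because `k ≥ q |G| / 2`. The factor `exp (-4 k)` then wins.
  have hU : P.real (⋃ J ∈ G.powersetCard k, B J) ≤ Real.exp (-(q * G.card)) := by
    have he : 2 * Real.exp 1 ≤ Real.exp 2 := by
      have h7 : Real.exp 2 = Real.exp 1 * Real.exp 1 := by rw [← Real.exp_add]; norm_num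
      have := Real.exp_one_gt_d9
      nlinarith
    calc P.real (⋃ J ∈ G.powersetCard k, B J) ≤ ∑ J ∈ G.powersetCard k, P.real (B J) :=
          measureReal_biUnion_finset_le _ _
      _ ≤ ∑ J ∈ G.powersetCard k, q ^ k * Real.exp (-4 * k) := Finset.sum_le_sum hB
      _ = (G.card.choose k : ℝ) * (q ^ k * Real.exp (-4 * k)) := by
          rw [Finset.sum_const, Finset.card_powersetCard, nsmul_eq_mul]
      _ ≤ (Real.exp 1 * (G.card / k)) ^ k * (q ^ k * Real.exp (-4 * k)) := by
          gcongr
          exact Nat.choose_le_exp_mul_div_pow hkpos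
      _ = (Real.exp 1 * (q * G.card / k)) ^ k * Real.exp (-4 * k) := by
          rw [← mul_assoc, ← mul_pow]
          congr 2
          ring
      _ ≤ (Real.exp 2) ^ k * Real.exp (-4 * k) := by
          gcongr
          refine le_trans ?_ he
          rw [mul_comm]
          gcongr
          rw [div_le_iff₀ hk']
          linarith
      _ = Real.exp (-2 * k) := by
          rw [← Real.exp_nat_mul, ← Real.exp_add]
          ring_nf
      _ ≤ _ := Real.exp_le_exp.mpr (by linarith)
  calc _ ≤ P.real {ω | ((G.filter fun u => e ω u ≤ -s).card : ℝ) ≤ q * G.card / 2} +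
        P.real (⋃ J ∈ G.powersetCard k, B J) :=
        (measureReal_mono hcover (measure_ne_top _ _)).trans (measureReal_union_le _ _)
    _ ≤ Real.exp (-(q ^ 2 * G.card / 2)) + Real.exp (-(q * G.card)) :=
        add_le_add (iIndepFun.measureReal_card_low_le hind hm hq.le hlow G) hU
    _ ≤ Real.exp (-(q ^ 2 * δ * N / 4)) + Real.exp (-(q ^ 2 * δ * N / 4)) := by
        have h1 : q ^ 2 * (δ / 2 * N) ≤ q ^ 2 * G.card := by gcongr
        have h2 : q ^ 2 * G.card ≤ q * G.card := by
          gcongr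
          nlinarith
        have h3 : 0 ≤ q * G.card := by positivity
        exact add_le_add (Real.exp_le_exp.mpr (by linarith)) (Real.exp_le_exp.mpr (by linarith))
    _ = _ := by ring

end Trial

end

noncomputable section

open Matrix

/-! ### Energy of vectors on the two-cluster graph -/

section Energy

theorem sq_sum_div_card_le {V : Type*} [Fintype V] (x : V → ℝ) :
    (∑ i, x i) ^ 2 / Fintype.card V ≤ ∑ i, x i ^ 2 := by
  refine div_le_of_le_mul₀ (by positivity) (Finset.sum_nonneg fun _ _ => sq_nonneg _) ?_
  rw [mul_comm]
  exact sq_sum_le_card_mul_sum_sq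

theorem abs_sum_mul_sq_le {V : Type*} [Fintype V] {f : V → ℝ} {D : ℝ} (hf : ∀ u, |f u| ≤ D)
    (x : V → ℝ) : |∑ u, f u * x u ^ 2| ≤ D * ∑ u, x u ^ 2 := by
  refine (Finset.abs_sum_le_sum_abs _ _).trans ?_
  rw [Finset.mul_sum]
  refine Finset.sum_le_sum fun u _ => ?_
  rw [abs_mul, abs_of_nonneg (sq_nonneg (x u))]
  exact mul_le_mul_of_nonneg_right (hf u) (sq_nonneg _)

theorem lambda2_mul_centred_le {V : Type*} [Fintype V] (G : SimpleGraph V)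
    (h : 2 ≤ Fintype.card V) (x : V → ℝ) :
    lambda2 G * (∑ i, x i ^ 2 - (∑ i, x i) ^ 2 / Fintype.card V) ≤
      x ⬝ᵥ (graphLaplacian G).mulVec x := by
  have hN : (0 : ℝ) < Fintype.card V := by exact_mod_cast (by omega : 0 < Fintype.card V)
  set a : ℝ := (∑ i, x i) / Fintype.card V with ha
  have haN : a * Fintype.card V = ∑ i, x i := by rw [ha]; field_simp
  have h1 := lambda2_mul_le G h (y := x - fun _ => a) (by
    simp only [Pi.sub_apply, Finset.sum_sub_distrib, Finset.sum_const, Finset.card_univ,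
      nsmul_eq_mul]
    linarith)
  have h2 : (x - fun _ => a) ⬝ᵥ (graphLaplacian G).mulVec (x - fun _ => a) =
      x ⬝ᵥ (graphLaplacian G).mulVec x := by
    rw [mulVec_sub, graphLaplacian_mulVec_const, sub_zero, sub_dotProduct,
      graphLaplacian_dotProduct_comm G (fun _ => a) x, graphLaplacian_mulVec_const]
    simp
  have h3 : ∑ i, (x - fun _ : V => a) i ^ 2 =
      ∑ i, x i ^ 2 - (∑ i, x i) ^ 2 / Fintype.card V := by
    have h4 : ∀ i, (x - fun _ : V => a) i ^ 2 = x i ^ 2 - 2 * a * x i + a ^ 2 := fun i => by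
      simp only [Pi.sub_apply]; ring
    simp only [h4, Finset.sum_add_distrib, Finset.sum_sub_distrib, ← Finset.mul_sum,
      Finset.sum_const, Finset.card_univ, nsmul_eq_mul]
    rw [← haN]
    field_simp
    ring
  rwa [h2, h3] at h1

variable {V W : Type*} [Fintype V] [Fintype W]

/-- The deviation of the interconnection matrix from its mean is at most `B` as a bilinear form,
and its row and column sums are at most `D`. -/
structure HasSmallDeviation (p : ℝ) (C : V → W → Bool) (B D : ℝ) : Prop where
  bilin : ∀ (z : V → ℝ) (w : W → ℝ),
    |∑ u, ∑ v, z u * w v * centredEntry p C u v| ≤ B * (l2norm z * l2norm w)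
  row : ∀ u, |rowDeviation p C u| ≤ D
  col : ∀ v, |rowDeviation p (fun v u => C u v) v| ≤ D

theorem HasSmallDeviation.swap {p : ℝ} {C : V → W → Bool} {B D : ℝ}
    (h : HasSmallDeviation p C B D) : HasSmallDeviation p (fun v u => C u v) B D where
  bilin z w := by
    have h1 := h.bilin w z
    rw [Finset.sum_comm, mul_comm (l2norm w)] at h1
    simpa only [centredEntry, mul_comm] using h1
  row := h.col
  col := h.row

omit [Fintype V] in
theorem sum_entry_eq (p : ℝ) (C : V → W → Bool) (u : V) :
    ∑ v, (if C u v = true then (1 : ℝ) else 0) = p * Fintype.card W + rowDeviation p C u := by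
  simp [rowDeviation, centredEntry, Finset.sum_sub_distrib, mul_comm]

/-- The part of the energy coming from the deviation of the interconnection matrix. -/
def deviationEnergy (p : ℝ) (C : V → W → Bool) (y₁ : V → ℝ) (y₂ : W → ℝ) : ℝ :=
  ∑ u, rowDeviation p C u * y₁ u ^ 2 + ∑ v, rowDeviation p (fun v u => C u v) v * y₂ v ^ 2 -
    2 * ∑ u, ∑ v, y₁ u * y₂ v * centredEntry p C u v

theorem HasSmallDeviation.abs_deviationEnergy_le {p : ℝ} {C : V → W → Bool} {B D : ℝ}
    (h : HasSmallDeviation p C B D) (hB : 0 ≤ B) (y₁ : V → ℝ) (y₂ : W → ℝ) :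
    |deviationEnergy p C y₁ y₂| ≤ (B + D) * (∑ u, y₁ u ^ 2 + ∑ v, y₂ v ^ 2) := by
  have h1 := abs_sum_mul_sq_le h.row y₁
  have h2 := abs_sum_mul_sq_le h.col y₂
  have h3 := h.bilin y₁ y₂
  have h4 : B * (2 * (l2norm y₁ * l2norm y₂)) ≤ B * (∑ u, y₁ u ^ 2 + ∑ v, y₂ v ^ 2) := by
    rw [← l2norm_sq, ← l2norm_sq]
    refine mul_le_mul_of_nonneg_left ?_ hB
    nlinarith [sq_nonneg (l2norm y₁ - l2norm y₂)]
  rw [abs_le] at h1 h2 h3 ⊢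
  rw [deviationEnergy]
  constructor <;> nlinarith

variable (G : SimpleGraph V) (H : SimpleGraph W)

theorem twoClusterGraph_energy_eq (p : ℝ) (C : V → W → Bool) (y : V ⊕ W → ℝ) :
    y ⬝ᵥ (graphLaplacian (twoClusterGraph G H C)).mulVec y =
      (y ∘ Sum.inl) ⬝ᵥ (graphLaplacian G).mulVec (y ∘ Sum.inl) +
      (y ∘ Sum.inr) ⬝ᵥ (graphLaplacian H).mulVec (y ∘ Sum.inr) +
      p * (Fintype.card W * ∑ u, y (Sum.inl u) ^ 2 + Fintype.card V * ∑ v, y (Sum.inr v) ^ 2 -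
        2 * ((∑ u, y (Sum.inl u)) * ∑ v, y (Sum.inr v))) +
      deviationEnergy p C (y ∘ Sum.inl) (y ∘ Sum.inr) := by
  have h1 : ∀ u v, (if C u v = true then (1 : ℝ) else 0) *
      ((y (Sum.inl u) - y (Sum.inr v)) * (y (Sum.inl u) - y (Sum.inr v))) =
      p * y (Sum.inl u) ^ 2 + p * y (Sum.inr v) ^ 2 -
        2 * p * (y (Sum.inl u) * y (Sum.inr v)) +
      (centredEntry p C u v * y (Sum.inl u) ^ 2 +
        centredEntry p (fun v u => C u v) v u * y (Sum.inr v) ^ 2 -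
        2 * (y (Sum.inl u) * y (Sum.inr v) * centredEntry p C u v)) := by
    intro u v
    simp only [centredEntry]
    ring
  have h2 : ∑ u, ∑ v, centredEntry p (fun v u => C u v) v u * y (Sum.inr v) ^ 2 =
      ∑ v, rowDeviation p (fun v u => C u v) v * y (Sum.inr v) ^ 2 := by
    rw [Finset.sum_comm]
    simp only [rowDeviation, Finset.sum_mul]
  rw [twoClusterGraph_bilin, deviationEnergy, add_assoc (_ + _)]
  congr 1
  simp only [h1, Finset.sum_add_distrib, Finset.sum_sub_distrib, ← Finset.mul_sum, h2,
    Finset.sum_const, Finset.card_univ, nsmul_eq_mul, Function.comp_apply, rowDeviation,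
    ← Finset.sum_mul]
  ring

variable {G H} {p : ℝ} {C : V → W → Bool} {B D : ℝ}

/-- A lower bound for the energy of a feasible vector in terms of the sum over the first cluster
and the distances of the two blocks to the constant vectors. -/
theorem HasSmallDeviation.energy_ge (h : HasSmallDeviation p C B D) (hB : 0 ≤ B)
    (hV : 2 ≤ Fintype.card V) (hW : 2 ≤ Fintype.card W) {y : V ⊕ W → ℝ} (hy : IsFeasible y) :
    p * (Fintype.card V + Fintype.card W) +
      (lambda2 G - p * Fintype.card V) *
        (∑ u, y (Sum.inl u) ^ 2 - (∑ u, y (Sum.inl u)) ^ 2 / Fintype.card V) +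
      (lambda2 H - p * Fintype.card W) *
        (∑ v, y (Sum.inr v) ^ 2 - (∑ u, y (Sum.inl u)) ^ 2 / Fintype.card W) - (B + D) ≤
    y ⬝ᵥ (graphLaplacian (twoClusterGraph G H C)).mulVec y := by
  have hV' : (0 : ℝ) < Fintype.card V := by exact_mod_cast (by omega : 0 < Fintype.card V)
  have hW' : (0 : ℝ) < Fintype.card W := by exact_mod_cast (by omega : 0 < Fintype.card W)
  rw [twoClusterGraph_energy_eq G H p C y]
  obtain ⟨h1, h2⟩ := hy
  rw [Fintype.sum_sum_type] at h1 h2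
  have h3 : ∑ v, y (Sum.inr v) = -∑ u, y (Sum.inl u) := by linarith
  have h4 := lambda2_mul_centred_le G hV (y ∘ Sum.inl)
  have h5 := lambda2_mul_centred_le H hW (y ∘ Sum.inr)
  have h6 := (abs_le.mp (h.abs_deviationEnergy_le hB (y ∘ Sum.inl) (y ∘ Sum.inr))).1
  simp only [Function.comp_apply, h3, h1, mul_one, neg_sq] at h4 h5 h6
  rw [h3]
  set s := ∑ u, y (Sum.inl u)
  set b := ∑ v, y (Sum.inr v) ^ 2
  have h8 : ∑ u, y (Sum.inl u) ^ 2 = 1 - b := by linarith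
  rw [h8] at h4 ⊢
  set m := (Fintype.card V : ℝ)
  set k := (Fintype.card W : ℝ)
  -- For a centred unit vector the mean coupling is `p (m + k)` minus its deficits on the two parts
  -- centred within the clusters.
  have h9 : p * (k * (1 - b) + m * b - 2 * (s * -s)) = p * (m + k) -
      p * m * (1 - b - s ^ 2 / m) - p * k * (b - s ^ 2 / k) := by
    field_simp
    ring
  rw [h9]
  linarith

/-- The trial vector is the normalized two-cluster indicator, which has no internal energy. -/
theorem HasSmallDeviation.lambda2_le_mul (h : HasSmallDeviation p C B D) (hB : 0 ≤ B)
    (hV : 2 ≤ Fintype.card V) (hW : 2 ≤ Fintype.card W) :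
    lambda2 (twoClusterGraph G H C) ≤ p * (Fintype.card V + Fintype.card W) + (B + D) := by
  have hV' : (0 : ℝ) < Fintype.card V := by exact_mod_cast (by omega : 0 < Fintype.card V)
  have hW' : (0 : ℝ) < Fintype.card W := by exact_mod_cast (by omega : 0 < Fintype.card W)
  set m := (Fintype.card V : ℝ) with hm
  set k := (Fintype.card W : ℝ) with hk
  set y : V ⊕ W → ℝ := Sum.elim (fun _ => √(k / ((m + k) * m))) (fun _ => -√(m / ((m + k) * k)))
    with hy
  have e1 : √(k / ((m + k) * m)) ^ 2 = k / ((m + k) * m) := Real.sq_sqrt (by positivity)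
  have e2 : √(m / ((m + k) * k)) ^ 2 = m / ((m + k) * k) := Real.sq_sqrt (by positivity)
  have e3 : m * √(k / ((m + k) * m)) = k * √(m / ((m + k) * k)) := by
    rw [← sq_eq_sq₀ (by positivity) (by positivity), mul_pow, mul_pow, e1, e2]
    field_simp
  have hs1 : ∑ i, y i = 0 := by
    simp only [hy, Fintype.sum_sum_type, Sum.elim_inl, Sum.elim_inr, Finset.sum_const,
      Finset.card_univ, nsmul_eq_mul, ← hm, ← hk]
    linarith
  have hs2 : ∑ i, y i ^ 2 = 1 := by
    simp only [hy, Fintype.sum_sum_type, Sum.elim_inl, Sum.elim_inr, Finset.sum_const,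
      Finset.card_univ, nsmul_eq_mul, ← hm, ← hk, neg_sq, e1, e2]
    field_simp
    ring
  have h1 := lambda2_mul_le (twoClusterGraph G H C)
    (by rw [Fintype.card_sum]; omega) hs1
  rw [hs2, mul_one, twoClusterGraph_energy_eq G H p C y] at h1
  have h2 := (abs_le.mp (h.abs_deviationEnergy_le hB (y ∘ Sum.inl) (y ∘ Sum.inr))).2
  rw [Fintype.sum_sum_type] at hs2
  simp only [Function.comp_apply, hs2, mul_one] at h2
  have h3 : y ∘ Sum.inl = fun _ => √(k / ((m + k) * m)) := rfl
  have h4 : y ∘ Sum.inr = fun _ => -√(m / ((m + k) * k)) := rfl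
  rw [h3, h4, graphLaplacian_mulVec_const, graphLaplacian_mulVec_const, dotProduct_zero,
    dotProduct_zero, ← h3, ← h4] at h1
  have h5 : k * ∑ u, y (Sum.inl u) ^ 2 + m * ∑ v, y (Sum.inr v) ^ 2 -
      2 * ((∑ u, y (Sum.inl u)) * ∑ v, y (Sum.inr v)) = m + k := by
    simp only [hy, Sum.elim_inl, Sum.elim_inr, Finset.sum_const,
      Finset.card_univ, nsmul_eq_mul, ← hm, ← hk, neg_sq, e1, e2]
    have h6 : m * √(k / ((m + k) * m)) * (k * -√(m / ((m + k) * k))) = -(m * k / (m + k)) := by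
      rw [mul_neg, mul_neg, ← e3, neg_inj, ← sq, mul_pow, e1]
      field_simp
    rw [h6]
    field_simp
    ring
  rw [h5] at h1
  linarith

/-- The trial vector is an optimal centred vector of the first cluster, extended by zero. -/
theorem HasSmallDeviation.lambda2_le_inl (h : HasSmallDeviation p C B D) (hB : 0 ≤ B)
    (hV : 2 ≤ Fintype.card V) :
    lambda2 (twoClusterGraph G H C) ≤ lambda2 G + p * Fintype.card W + (B + D) := by
  obtain ⟨x, hx, hx'⟩ := (lambda2_spec G hV).2
  set y : V ⊕ W → ℝ := Sum.elim x 0 with hy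
  have hs1 : ∑ i, y i = 0 := by simp [hy, hx.2]
  have hs2 : ∑ i, y i ^ 2 = 1 := by simp [hy, hx.1]
  have h1 := lambda2_mul_le (twoClusterGraph G H C)
    (by rw [Fintype.card_sum]; omega) hs1
  rw [hs2, mul_one, twoClusterGraph_energy_eq G H p C y] at h1
  have h2 := (abs_le.mp (h.abs_deviationEnergy_le hB (y ∘ Sum.inl) (y ∘ Sum.inr))).2
  rw [Fintype.sum_sum_type] at hs2
  simp only [Function.comp_apply, hs2, mul_one] at h2
  have h3 : y ∘ Sum.inl = x := rfl
  have h4 : y ∘ Sum.inr = 0 := rfl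
  simp only [h3, h4] at h1 h2
  simp only [hy, Sum.elim_inl, Sum.elim_inr, hx.1, hx.2, mulVec_zero,
    dotProduct_zero, Pi.zero_apply] at h1
  simp only [ne_eq, OfNat.ofNat_ne_zero, not_false_eq_true, zero_pow, Finset.sum_const_zero,
    mul_zero, mul_one, add_zero, sub_zero] at h1
  linarith

theorem HasSmallDeviation.lambda2_le_inr (h : HasSmallDeviation p C B D) (hB : 0 ≤ B)
    (hW : 2 ≤ Fintype.card W) :
    lambda2 (twoClusterGraph G H C) ≤ lambda2 H + p * Fintype.card V + (B + D) := by
  obtain ⟨x, hx, hx'⟩ := (lambda2_spec H hW).2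
  set y : V ⊕ W → ℝ := Sum.elim 0 x with hy
  have hs1 : ∑ i, y i = 0 := by simp [hy, hx.2]
  have hs2 : ∑ i, y i ^ 2 = 1 := by simp [hy, hx.1]
  have h1 := lambda2_mul_le (twoClusterGraph G H C)
    (by rw [Fintype.card_sum]; omega) hs1
  rw [hs2, mul_one, twoClusterGraph_energy_eq G H p C y] at h1
  have h2 := (abs_le.mp (h.abs_deviationEnergy_le hB (y ∘ Sum.inl) (y ∘ Sum.inr))).2
  rw [Fintype.sum_sum_type] at hs2
  simp only [Function.comp_apply, hs2, mul_one] at h2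
  have h3 : y ∘ Sum.inr = x := rfl
  have h4 : y ∘ Sum.inl = 0 := rfl
  simp only [h3, h4] at h1 h2
  simp only [hy, Sum.elim_inl, Sum.elim_inr, hx.1, hx.2, mulVec_zero,
    dotProduct_zero, Pi.zero_apply] at h1
  simp only [ne_eq, OfNat.ofNat_ne_zero, not_false_eq_true, zero_pow, Finset.sum_const_zero,
    mul_zero, mul_one, sub_zero, zero_add] at h1
  linarith

/-- The weighted distance of a minimizer from the span of the two-cluster indicator. -/
theorem HasSmallDeviation.centred_le (h : HasSmallDeviation p C B D) (hB : 0 ≤ B)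
    (hV : 2 ≤ Fintype.card V) (hW : 2 ≤ Fintype.card W) {y : V ⊕ W → ℝ}
    (hy : IsSpectralSolution (twoClusterGraph G H C) y) :
    (lambda2 G - p * Fintype.card V) *
        (∑ u, y (Sum.inl u) ^ 2 - (∑ u, y (Sum.inl u)) ^ 2 / Fintype.card V) +
      (lambda2 H - p * Fintype.card W) *
        (∑ v, y (Sum.inr v) ^ 2 - (∑ u, y (Sum.inl u)) ^ 2 / Fintype.card W) ≤ 2 * (B + D) := by
  have h1 := h.energy_ge (G := G) (H := H) hB hV hW hy.1
  rw [hy.energy_eq (by rw [Fintype.card_sum]; omega)] at h1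
  have h2 := h.lambda2_le_mul (G := G) (H := H) hB hV hW
  linarith

/-- The squared lengths of the indicator part and of the two centred parts are nonnegative weights
of sum one, so up to `B + D` the energy is at least a convex combination of the three candidates. -/
theorem HasSmallDeviation.min_le_lambda2 (h : HasSmallDeviation p C B D) (hB : 0 ≤ B)
    (hV : 2 ≤ Fintype.card V) (hW : 2 ≤ Fintype.card W) :
    min (p * (Fintype.card V + Fintype.card W))
      (min (lambda2 G + p * Fintype.card W) (lambda2 H + p * Fintype.card V)) - (B + D) ≤
    lambda2 (twoClusterGraph G H C) := by
  obtain ⟨y, hy, hy'⟩ := (lambda2_spec (twoClusterGraph G H C)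
    (by rw [Fintype.card_sum]; omega)).2
  have hV' : (0 : ℝ) < Fintype.card V := by exact_mod_cast (by omega : 0 < Fintype.card V)
  have hW' : (0 : ℝ) < Fintype.card W := by exact_mod_cast (by omega : 0 < Fintype.card W)
  refine le_trans ?_ ((h.energy_ge (G := G) (H := H) hB hV hW hy).trans hy')
  obtain ⟨h1, h2⟩ := hy
  rw [Fintype.sum_sum_type] at h1 h2
  have h3 : ∑ v, y (Sum.inr v) = -∑ u, y (Sum.inl u) := by linarith
  have h4 := sq_sum_div_card_le fun u => y (Sum.inl u)
  have h5 := sq_sum_div_card_le fun v => y (Sum.inr v)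
  rw [h3, neg_sq] at h5
  set s := ∑ u, y (Sum.inl u)
  set a := ∑ u, y (Sum.inl u) ^ 2
  set b := ∑ v, y (Sum.inr v) ^ 2
  set m := (Fintype.card V : ℝ)
  set k := (Fintype.card W : ℝ)
  set μ := min (p * (m + k)) (min (lambda2 G + p * k) (lambda2 H + p * m))
  have m1 : μ ≤ p * (m + k) := min_le_left _ _
  have m2 : μ ≤ lambda2 G + p * k := (min_le_right _ _).trans (min_le_left _ _)
  have m3 : μ ≤ lambda2 H + p * m := (min_le_right _ _).trans (min_le_right _ _)
  have h6 : 0 ≤ s ^ 2 / m + s ^ 2 / k := by positivity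
  have h7 : 0 ≤ a - s ^ 2 / m := by linarith
  have h8 : 0 ≤ b - s ^ 2 / k := by linarith
  have i1 := mul_le_mul_of_nonneg_right m1 h6
  have i2 := mul_le_mul_of_nonneg_right m2 h7
  have i3 := mul_le_mul_of_nonneg_right m3 h8
  have h9 : b = 1 - a := by linarith
  rw [h9] at i3 ⊢
  linarith

end Energy

end

noncomputable section

open Matrix

/-! ### Eigenvectors of the two-cluster graph -/

section Eigenvector

theorem l2norm_le_one_of_sum_le {ι : Type*} [Fintype ι] {x : ι → ℝ} (h : ∑ i, x i ^ 2 ≤ 1) :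
    l2norm x ≤ 1 := by
  rw [l2norm]
  exact Real.sqrt_le_one.mpr h

theorem abs_sum_ite_mul_le {V : Type*} [Fintype V] (q : V → Prop) [DecidablePred q] (h : V → ℝ) :
    |∑ w, (if q w then (1 : ℝ) else 0) * h w| ≤ √(Fintype.card V) * l2norm h := by
  refine (abs_dotProduct_le_l2norm (fun w => if q w then (1 : ℝ) else 0) h).trans ?_
  refine mul_le_mul_of_nonneg_right ?_ (l2norm_nonneg _)
  rw [l2norm]
  refine Real.sqrt_le_sqrt ?_
  calc ∑ w, (if q w then (1 : ℝ) else 0) ^ 2 ≤ ∑ _w : V, (1 : ℝ) :=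
        Finset.sum_le_sum fun w _ => by split_ifs <;> norm_num
    _ = Fintype.card V := by simp

variable {V W : Type*} [Fintype V] [Fintype W]

/-- If a centred unit vector is close to the span of the two-cluster indicator, then it is close
to the normalized indicator, up to sign. -/
theorem IsFeasible.sum_sq_block_le {y : V ⊕ W → ℝ} (hy : IsFeasible y)
    (hV : 0 < Fintype.card V) (hW : 0 < Fintype.card W) :
    ∃ σ : ℝ, (σ = 1 ∨ σ = -1) ∧
      (∑ u, (y (Sum.inl u) - σ * √(Fintype.card W /
          (((Fintype.card V : ℝ) + Fintype.card W) * Fintype.card V))) ^ 2) +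
        ∑ v, (y (Sum.inr v) + σ * √(Fintype.card V /
          (((Fintype.card V : ℝ) + Fintype.card W) * Fintype.card W))) ^ 2 ≤
      2 * ((∑ u, y (Sum.inl u) ^ 2 - (∑ u, y (Sum.inl u)) ^ 2 / Fintype.card V) +
        (∑ v, y (Sum.inr v) ^ 2 - (∑ u, y (Sum.inl u)) ^ 2 / Fintype.card W)) := by
  have hV' : (0 : ℝ) < Fintype.card V := by exact_mod_cast hV
  have hW' : (0 : ℝ) < Fintype.card W := by exact_mod_cast hW
  obtain ⟨h1, h2⟩ := hy
  rw [Fintype.sum_sum_type] at h1 h2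
  have h3 : ∑ v, y (Sum.inr v) = -∑ u, y (Sum.inl u) := by linarith
  have h4 := sq_sum_div_card_le fun u => y (Sum.inl u)
  have h5 := sq_sum_div_card_le fun v => y (Sum.inr v)
  rw [h3, neg_sq] at h5
  set s := ∑ u, y (Sum.inl u)
  set m := (Fintype.card V : ℝ) with hm
  set k := (Fintype.card W : ℝ) with hk
  set a := √(k / ((m + k) * m)) with ha
  set b := √(m / ((m + k) * k)) with hb
  have e1 : a ^ 2 = k / ((m + k) * m) := Real.sq_sqrt (by positivity)
  have e2 : b ^ 2 = m / ((m + k) * k) := Real.sq_sqrt (by positivity)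
  have e3 : m * a = k * b := by
    rw [← sq_eq_sq₀ (by positivity) (by positivity), mul_pow, mul_pow, e1, e2]
    field_simp
  have e4 : (a + b) ^ 2 = 1 / m + 1 / k := by
    have : b = m * a / k := by field_simp; linarith
    rw [this, show a + m * a / k = a * ((m + k) / k) by field_simp; ring, mul_pow, e1]
    field_simp
    ring
  have hσ : ∃ σ : ℝ, (σ = 1 ∨ σ = -1) ∧ σ * s = |s| := by
    rcases le_total 0 s with h | h
    · exact ⟨1, Or.inl rfl, by rw [abs_of_nonneg h, one_mul]⟩
    · exact ⟨-1, Or.inr rfl, by rw [abs_of_nonpos h]; ring⟩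
  obtain ⟨σ, hσ, hσs⟩ := hσ
  refine ⟨σ, hσ, ?_⟩
  have hσ2 : σ ^ 2 = 1 := by rcases hσ with h | h <;> rw [h] <;> norm_num
  have h6 : ∑ u, (y (Sum.inl u) - σ * a) ^ 2 =
      ∑ u, y (Sum.inl u) ^ 2 - 2 * a * (σ * s) + m * a ^ 2 := by
    have : ∀ u, (y (Sum.inl u) - σ * a) ^ 2 =
        y (Sum.inl u) ^ 2 - 2 * a * σ * y (Sum.inl u) + σ ^ 2 * a ^ 2 := fun u => by ring
    simp only [this, Finset.sum_add_distrib, Finset.sum_sub_distrib, ← Finset.mul_sum,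
      Finset.sum_const, Finset.card_univ, nsmul_eq_mul, hσ2, ← hm]
    ring
  have h7 : ∑ v, (y (Sum.inr v) + σ * b) ^ 2 =
      ∑ v, y (Sum.inr v) ^ 2 - 2 * b * (σ * s) + k * b ^ 2 := by
    have : ∀ v, (y (Sum.inr v) + σ * b) ^ 2 =
        y (Sum.inr v) ^ 2 + 2 * b * σ * y (Sum.inr v) + σ ^ 2 * b ^ 2 := fun v => by ring
    simp only [this, Finset.sum_add_distrib, ← Finset.mul_sum,
      Finset.sum_const, Finset.card_univ, nsmul_eq_mul, hσ2, ← hk, h3]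
    ring
  have h8 : m * a ^ 2 + k * b ^ 2 = 1 := by
    rw [e1, e2]
    field_simp
    exact add_comm k m
  have h9 : s ^ 2 / m + s ^ 2 / k = ((a + b) * |s|) ^ 2 := by
    rw [mul_pow, e4, sq_abs]
    ring
  have h10 : 0 ≤ (a + b) * |s| := by positivity
  rw [h6, h7, hσs]
  -- `t = (a + b) |s|` is the cosine of the angle to the indicator; the claim is `2 - 2 t ≤ 2 (1 - t
  -- ^ 2)` for `0 ≤ t ≤ 1`.
  have h11 : ((a + b) * |s|) ^ 2 ≤ 1 := by rw [← h9]; linarith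
  have h12 : (a + b) * |s| ≤ 1 := (sq_le_one_iff₀ h10).mp h11
  nlinarith

/-- A bound for the entries of a solution of the eigenvector equation in one cluster. -/
theorem abs_entry_mul_le {G : SimpleGraph V} (hV : 2 ≤ Fintype.card V) {p : ℝ}
    {C : V → W → Bool} {D : ℝ} (hD : ∀ u, |rowDeviation p C u| ≤ D) {h : V → ℝ} {h' : W → ℝ}
    {r σ l : ℝ} (hr : 0 ≤ r) (hrW : r * Fintype.card W = Fintype.card V) (hσ : |σ| = 1)
    (heq : ∀ u, (graphLaplacian G).mulVec h u +
      ∑ v, (if C u v = true then (1 : ℝ) else 0) * (h u + σ - r * (h' v - σ)) = l * (h u + σ))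
    (u : V) :
    (lambda2 G * (1 - 1 / Fintype.card V) + p * Fintype.card W - D - l) * |h u| ≤
      √(Fintype.card V) * l2norm h + r * (√(Fintype.card W) * l2norm h') +
        |l - p * (Fintype.card V + Fintype.card W)| + D * (1 + r) := by
  classical
  set d := ∑ w, if G.Adj u w then (1 : ℝ) else 0 with hd
  have h1 : (graphLaplacian G).mulVec h u =
      d * h u - ∑ w, (if G.Adj u w then (1 : ℝ) else 0) * h w := by
    rw [graphLaplacian_mulVec_apply, hd, Finset.sum_mul, ← Finset.sum_sub_distrib]
    refine Finset.sum_congr rfl fun w _ => ?_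
    split_ifs <;> ring
  have h2 : ∑ v, (if C u v = true then (1 : ℝ) else 0) * (h u + σ - r * (h' v - σ)) =
      (p * Fintype.card W + rowDeviation p C u) * (h u + σ + r * σ) -
        r * ∑ v, (if C u v = true then (1 : ℝ) else 0) * h' v := by
    rw [← sum_entry_eq, Finset.sum_mul, Finset.mul_sum, ← Finset.sum_sub_distrib]
    refine Finset.sum_congr rfl fun v _ => ?_
    ring
  have h3 := heq u
  rw [h1, h2] at h3
  have h4 := abs_sum_ite_mul_le (fun w => G.Adj u w) h
  have h5 := abs_sum_ite_mul_le (fun v => C u v = true) h'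
  have h6 := lambda2_le_degree G hV u
  have h7 : d = ∑ w, if G.Adj u w then (1 : ℝ) else 0 := rfl
  have h8 := hD u
  set S1 := ∑ w, (if G.Adj u w then (1 : ℝ) else 0) * h w
  set S2 := ∑ v, (if C u v = true then (1 : ℝ) else 0) * h' v
  set e := rowDeviation p C u
  set m := (Fintype.card V : ℝ)
  set k := (Fintype.card W : ℝ)
  -- All diagonal terms are collected on the left; the degree bound `lambda2_le_degree` makes their
  -- coefficient large. The right side only involves sums over neighbours, the eigenvalue error and
  -- the row deviation.
  have h9 : (d + p * k + e - l) * h u =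
      S1 + r * S2 + σ * (l - p * (m + k)) - σ * (e * (1 + r)) := by
    rw [← hrW]
    linarith
  have h10 : (lambda2 G * (1 - 1 / m) + p * k - D - l) * |h u| ≤ |(d + p * k + e - l) * h u| := by
    rw [abs_mul]
    refine mul_le_mul_of_nonneg_right ?_ (abs_nonneg _)
    refine le_trans ?_ (le_abs_self _)
    have : lambda2 G * (1 - 1 / m) ≤ d := by convert h6
    linarith [(abs_le.mp h8).1]
  refine h10.trans ?_
  rw [h9]
  have a1 : |σ * (l - p * (m + k))| = |l - p * (m + k)| := by rw [abs_mul, hσ, one_mul]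
  have a2 : |σ * (e * (1 + r))| ≤ D * (1 + r) := by
    rw [abs_mul, hσ, one_mul, abs_mul, abs_of_nonneg (by linarith : 0 ≤ 1 + r)]
    gcongr
  have a3 : |r * S2| ≤ r * (√k * l2norm h') := by
    rw [abs_mul, abs_of_nonneg hr]
    gcongr
  calc |S1 + r * S2 + σ * (l - p * (m + k)) - σ * (e * (1 + r))|
      ≤ |S1| + |r * S2| + |σ * (l - p * (m + k))| + |σ * (e * (1 + r))| := by
        refine (abs_sub _ _).trans (add_le_add_left ?_ _)
        refine (abs_add_le _ _).trans (add_le_add_left ?_ _)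
        exact abs_add_le _ _
    _ ≤ _ := by rw [a1]; gcongr

/-! ### Mean matrix of a cluster and its spectral splitting -/

/-- The mean of the block of the Laplacian belonging to one cluster, plus the constant matrix
`p`, where `b` is the size of the other cluster. -/
def meanClusterMatrix [DecidableEq V] (G : SimpleGraph V) (p b : ℝ) : Matrix V V ℝ :=
  graphLaplacian G + (p * b) • (1 : Matrix V V ℝ) + Matrix.of fun _ _ => p

section

variable [DecidableEq V]

theorem meanClusterMatrix_isHermitian (G : SimpleGraph V) (p b : ℝ) :
    (meanClusterMatrix G p b).IsHermitian := by
  refine ((graphLaplacian_isHermitian G).add ?_).add ?_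
  · ext u w
    simp [Matrix.one_apply, eq_comm]
  · ext u w
    simp

theorem meanClusterMatrix_mulVec (G : SimpleGraph V) (p b : ℝ) (x : V → ℝ) (u : V) :
    (meanClusterMatrix G p b).mulVec x u =
      (graphLaplacian G).mulVec x u + p * b * x u + p * ∑ w, x w := by
  rw [meanClusterMatrix, add_mulVec, add_mulVec, smul_mulVec, one_mulVec]
  simp [mulVec, dotProduct, Finset.mul_sum]

/-- The constant matrix encodes the mean coupling to the other block, whose sum is minus that of
this block. It puts the constants at eigenvalue `p N`, above every level used, so low spectral
vectors are centred. -/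
theorem meanClusterMatrix_mulVec_one (G : SimpleGraph V) (p b : ℝ) :
    (meanClusterMatrix G p b).mulVec (fun _ => 1) =
      (p * (Fintype.card V + b)) • (fun _ => (1 : ℝ)) := by
  ext u
  rw [meanClusterMatrix_mulVec, graphLaplacian_mulVec_const]
  simp
  ring

theorem meanClusterMatrix_energy (G : SimpleGraph V) (p b : ℝ) (x : V → ℝ) :
    x ⬝ᵥ (meanClusterMatrix G p b).mulVec x =
      x ⬝ᵥ (graphLaplacian G).mulVec x + p * b * ∑ u, x u ^ 2 + p * (∑ u, x u) ^ 2 := by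
  simp only [dotProduct, meanClusterMatrix_mulVec, mul_add, Finset.sum_add_distrib,
    Finset.mul_sum, sq, Finset.sum_mul]
  congr 1
  · congr 1
    exact Finset.sum_congr rfl fun u _ => by ring
  · refine Finset.sum_congr rfl fun u _ => Finset.sum_congr rfl fun w _ => by ring

/-- Vectors extended by zero see only the mean matrix and the diagonal deviation; no bilinear error
remains. -/
theorem lambda2_mul_le_inl (G : SimpleGraph V) (H : SimpleGraph W) (p : ℝ) (C : V → W → Bool)
    (hV : 2 ≤ Fintype.card V) {x : V → ℝ} (hx : ∑ u, x u = 0) :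
    lambda2 (twoClusterGraph G H C) * ∑ u, x u ^ 2 ≤
      x ⬝ᵥ (meanClusterMatrix G p (Fintype.card W)).mulVec x +
        ∑ u, rowDeviation p C u * x u ^ 2 := by
  have h1 := lambda2_mul_le (twoClusterGraph G H C) (y := Sum.elim x 0)
    (by rw [Fintype.card_sum]; omega) (by simp [hx])
  rw [twoClusterGraph_energy_eq G H p C] at h1
  simp only [Sum.elim_comp_inl, Sum.elim_comp_inr, Fintype.sum_sum_type, Sum.elim_inl,
    Sum.elim_inr, mulVec_zero, dotProduct_zero, Pi.zero_apply, deviationEnergy, hx] at h1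
  simp only [ne_eq, OfNat.ofNat_ne_zero, not_false_eq_true, zero_pow, Finset.sum_const_zero,
    mul_zero, zero_mul, add_zero, sub_zero] at h1
  rw [meanClusterMatrix_energy, hx]
  linarith

omit [DecidableEq V] in
theorem lambda2_mul_le_inr [DecidableEq W] (G : SimpleGraph V) (H : SimpleGraph W) (p : ℝ)
    (C : V → W → Bool) (hW : 2 ≤ Fintype.card W) {x : W → ℝ} (hx : ∑ v, x v = 0) :
    lambda2 (twoClusterGraph G H C) * ∑ v, x v ^ 2 ≤
      x ⬝ᵥ (meanClusterMatrix H p (Fintype.card V)).mulVec x +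
        ∑ v, rowDeviation p (fun v u => C u v) v * x v ^ 2 := by
  have h1 := lambda2_mul_le (twoClusterGraph G H C) (y := Sum.elim 0 x)
    (by rw [Fintype.card_sum]; omega) (by simp [hx])
  rw [twoClusterGraph_energy_eq G H p C] at h1
  simp only [Sum.elim_comp_inl, Sum.elim_comp_inr, Fintype.sum_sum_type, Sum.elim_inl,
    Sum.elim_inr, mulVec_zero, dotProduct_zero, Pi.zero_apply, deviationEnergy, hx] at h1
  simp only [ne_eq, OfNat.ofNat_ne_zero, not_false_eq_true, zero_pow, Finset.sum_const_zero,
    mul_zero, zero_mul, zero_add, sub_zero] at h1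
  rw [meanClusterMatrix_energy, hx]
  linarith

/-- A spectral splitting of the symmetric matrix `N` at level `l` with gap `τ`. -/
structure IsSpectralSplit (N : Matrix V V ℝ) (l τ : ℝ) (π A : Matrix V V ℝ) : Prop where
  proj_transpose : πᵀ = π
  proj_mul_self : π * π = π
  transpose : Aᵀ = A
  mulVec_eq : ∀ z, N.mulVec (A.mulVec z) - l • A.mulVec z = z - π.mulVec z
  l2norm_le : ∀ z, l2norm (A.mulVec z) ≤ l2norm z / τ
  energy_le : ∀ z, π.mulVec z ⬝ᵥ N.mulVec (π.mulVec z) ≤ (l + τ) * ∑ i, π.mulVec z i ^ 2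
  orthogonal : ∀ φ a, N.mulVec φ = a • φ → l + τ < a → ∀ z, φ ⬝ᵥ π.mulVec z = 0

theorem IsSpectralSplit.exists {N : Matrix V V ℝ} (hN : N.IsHermitian) (l : ℝ) {τ : ℝ}
    (hτ : 0 < τ) : ∃ π A, IsSpectralSplit N l τ π A := by
  obtain ⟨π, A, h1, h2, h3, h4, h5, h6, h7⟩ := exists_spectral_split hN l hτ
  exact ⟨π, A, h1, h2, h3, h4, h5, h6, h7⟩

/-- A trial vector in the low spectral subspace bounds the Rayleigh quotient. -/
theorem IsSpectralSplit.le_of_trial {G : SimpleGraph V} {p b l τ μ R : ℝ} {π A : Matrix V V ℝ}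
    (h : IsSpectralSplit (meanClusterMatrix G p b) l τ π A) {e : V → ℝ}
    (hμ : ∀ x : V → ℝ, ∑ u, x u = 0 → μ * ∑ u, x u ^ 2 ≤
      x ⬝ᵥ (meanClusterMatrix G p b).mulVec x + ∑ u, e u * x u ^ 2)
    (hl : l + τ < p * (Fintype.card V + b)) {u : V} (hu : 0 < π u u)
    (hR : ∑ w, e w * π w u ^ 2 ≤ -R * π u u) : μ ≤ l + τ - R := by
  have hx : ∀ w, π.mulVec (Pi.single u 1) w = π w u := fun w => by simp
  -- The trial vector is column `u` of `π`, which is orthogonal to the constants by the gap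
  -- hypothesis and has squared length `π u u`.
  have h1 := h.orthogonal _ _ (meanClusterMatrix_mulVec_one G p b) hl (Pi.single u 1)
  have h2 := hμ (π.mulVec (Pi.single u 1)) (by simpa [dotProduct] using h1)
  have h3 := h.energy_le (Pi.single u 1)
  simp only [hx, projection_sum_sq h.proj_transpose h.proj_mul_self] at h2 h3
  have h4 : μ * π u u ≤ (l + τ - R) * π u u := by linarith
  exact le_of_mul_le_mul_right h4 hu

/-- The correlation of an eigenvector with the row deviations, bounded by means of a spectral
splitting of the mean matrix. -/
theorem IsSpectralSplit.abs_dotProduct_rowDeviation_le {G : SimpleGraph V} {p l τ μ B D : ℝ}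
    {π A : Matrix V V ℝ} {C : V → W → Bool} (hC : HasSmallDeviation p C B D)
    (h : IsSpectralSplit (meanClusterMatrix G p (Fintype.card W)) l τ π A)
    {y₁ : V → ℝ} {y₂ : W → ℝ} (hs : ∑ u, y₁ u + ∑ v, y₂ v = 0)
    (heq : ∀ u, (graphLaplacian G).mulVec y₁ u +
      ∑ v, (if C u v = true then (1 : ℝ) else 0) * (y₁ u - y₂ v) = μ * y₁ u) :
    |rowDeviation p C ⬝ᵥ y₁| ≤ l2norm (π.mulVec (rowDeviation p C)) * l2norm y₁ +
      |μ - l| * (l2norm (A.mulVec (rowDeviation p C)) * l2norm y₁) +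
      l2norm (fun u => rowDeviation p C u * A.mulVec (rowDeviation p C) u) * l2norm y₁ +
      B * (l2norm (A.mulVec (rowDeviation p C)) * l2norm y₂) := by
  set e := rowDeviation p C with he
  set f := A.mulVec e with hf
  set N := meanClusterMatrix G p (Fintype.card W)
  have h1 : ∀ u, N.mulVec y₁ u = μ * y₁ u - e u * y₁ u + ∑ v, centredEntry p C u v * y₂ v := by
    intro u
    have h2 : ∑ v, (if C u v = true then (1 : ℝ) else 0) * (y₁ u - y₂ v) =
        (p * Fintype.card W + e u) * y₁ u - ∑ v, centredEntry p C u v * y₂ v -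
          p * ∑ v, y₂ v := by
      rw [he, ← sum_entry_eq, Finset.sum_mul, Finset.mul_sum, ← Finset.sum_sub_distrib,
        ← Finset.sum_sub_distrib]
      refine Finset.sum_congr rfl fun v _ => ?_
      rw [centredEntry]
      ring
    have h3 := heq u
    rw [h2] at h3
    rw [meanClusterMatrix_mulVec]
    have h4 : ∑ v, y₂ v = -∑ u, y₁ u := by linarith
    rw [h4] at h3
    linarith
  -- Pairing this with `y₁` and moving `N` over to `y₁` brings in the eigenvector equation `h1`;
  -- every resulting term except `π e` contains `f`, which is short.
  have h2 : e = π.mulVec e + (N.mulVec f - l • f) := by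
    rw [hf, h.mulVec_eq]
    simp
  have h3 : N.mulVec f ⬝ᵥ y₁ = f ⬝ᵥ N.mulVec y₁ := by
    rw [dotProduct_comm, dotProduct_mulVec_comm (meanClusterMatrix_isHermitian G p _)]
  have h4 : f ⬝ᵥ N.mulVec y₁ = μ * (f ⬝ᵥ y₁) - (fun u => e u * f u) ⬝ᵥ y₁ +
      ∑ u, ∑ v, f u * y₂ v * centredEntry p C u v := by
    simp only [dotProduct, h1, Finset.mul_sum, ← Finset.sum_sub_distrib,
      ← Finset.sum_add_distrib, mul_add]
    refine Finset.sum_congr rfl fun u _ => ?_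
    congr 1
    · ring
    · exact Finset.sum_congr rfl fun v _ => by ring
  have h5 : e ⬝ᵥ y₁ = π.mulVec e ⬝ᵥ y₁ + (μ - l) * (f ⬝ᵥ y₁) - (fun u => e u * f u) ⬝ᵥ y₁ +
      ∑ u, ∑ v, f u * y₂ v * centredEntry p C u v := by
    conv_lhs => rw [h2]
    rw [add_dotProduct, sub_dotProduct, h3, h4, smul_dotProduct, smul_eq_mul]
    ring
  rw [h5]
  have a1 := abs_dotProduct_le_l2norm (π.mulVec e) y₁
  have a2 : |(μ - l) * (f ⬝ᵥ y₁)| ≤ |μ - l| * (l2norm f * l2norm y₁) := by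
    rw [abs_mul]
    gcongr
    exact abs_dotProduct_le_l2norm f y₁
  have a3 := abs_dotProduct_le_l2norm (fun u => e u * f u) y₁
  have a4 := hC.bilin f y₂
  refine (abs_add_le _ _).trans (add_le_add ((abs_sub _ _).trans (add_le_add
    ((abs_add_le _ _).trans (add_le_add a1 a2)) a3)) a4)

end

end Eigenvector

end

noncomputable section

open Matrix

/-! ### Correlation of the eigenvector with the row deviations -/

section Correlation

variable {V W : Type*} [Fintype V] [Fintype W]

/-- Cauchy–Schwarz applied to the squares. It bounds the product of `e` and `f` by fourth moments,
which have the right order, whereas the bound `N^(3/4)` on single entries of `e` would lose too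
much. -/
theorem sum_mul_sq_sq_le (x y : V → ℝ) :
    l2norm (fun u => x u * y u) ^ 4 ≤ (∑ u, x u ^ 4) * ∑ u, y u ^ 4 := by
  have h := Finset.sum_mul_sq_le_sq_mul_sq Finset.univ (fun u => x u ^ 2) fun u => y u ^ 2
  calc l2norm (fun u => x u * y u) ^ 4 = (∑ u, x u ^ 2 * y u ^ 2) ^ 2 := by
        rw [show 4 = 2 * 2 from rfl, pow_mul, l2norm_sq]
        simp only [mul_pow]
    _ ≤ _ := h
    _ = _ := by simp only [← pow_mul]

theorem l2norm_pow_four_le (x : V → ℝ) :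
    l2norm x ^ 4 ≤ Fintype.card V * ∑ u, x u ^ 4 := by
  have h := sum_mul_sq_sq_le (fun _ : V => 1) x
  simpa using h

/-- For the `j`-th level, the row deviations have a spectral splitting which is either
negligible on low frequencies or admits a trial vector of low energy. -/
def IsSpectrallyRegular [DecidableEq V] (G : SimpleGraph V) (p : ℝ) (C : V → W → Bool)
    (T κ : ℝ) (j : ℕ) : Prop :=
  ∃ π A, IsSpectralSplit (meanClusterMatrix G p (Fintype.card W))
      (j * √(Fintype.card V + Fintype.card W)) (T * √(Fintype.card V + Fintype.card W)) π A ∧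
    ∑ u, A.mulVec (rowDeviation p C) u ^ 4 ≤
      2000 * (√(Fintype.card W / 2) / (T * √(Fintype.card V + Fintype.card W))) ^ 4 *
        Fintype.card V ∧
    (l2norm (π.mulVec (rowDeviation p C)) ≤ κ * (Fintype.card V + Fintype.card W) ∨
      ∃ u, 0 < π u u ∧ ∑ w, rowDeviation p C w * π w u ^ 2 ≤
        -((T + 1) * √(Fintype.card V + Fintype.card W)) * π u u)

/-- The level is the multiple of `√N` just below `μ`. With `f` of length `O(√N / T)`, the eigenvalue
error, the product `e f` and the bilinear form contribute `5`, `12` and `30` times `N / T`. -/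
theorem IsSpectrallyRegular.abs_dotProduct_rowDeviation_le [DecidableEq V] {G : SimpleGraph V}
    {p T κ μ D : ℝ} {C : V → W → Bool} (hV : 0 < Fintype.card V) (hW : 0 < Fintype.card W)
    (hT : 0 < T) (hμ0 : 0 ≤ μ)
    (h : IsSpectrallyRegular G p C T κ ⌊μ / √(Fintype.card V + Fintype.card W)⌋₊)
    (hC : HasSmallDeviation p C (6 * √(Fintype.card V + Fintype.card W)) D)
    (he4 : ∑ u, rowDeviation p C u ^ 4 ≤ 2000 * √(Fintype.card W / 2) ^ 4 * Fintype.card V)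
    (hμp : μ + T * √(Fintype.card V + Fintype.card W) <
      p * (Fintype.card V + Fintype.card W))
    (hμ : ∀ x : V → ℝ, ∑ u, x u = 0 → μ * ∑ u, x u ^ 2 ≤
      x ⬝ᵥ (meanClusterMatrix G p (Fintype.card W)).mulVec x + ∑ u, rowDeviation p C u * x u ^ 2)
    {y₁ : V → ℝ} {y₂ : W → ℝ} (hs : ∑ u, y₁ u + ∑ v, y₂ v = 0)
    (hy₁ : l2norm y₁ ≤ 1) (hy₂ : l2norm y₂ ≤ 1)
    (heq : ∀ u, (graphLaplacian G).mulVec y₁ u +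
      ∑ v, (if C u v = true then (1 : ℝ) else 0) * (y₁ u - y₂ v) = μ * y₁ u) :
    |rowDeviation p C ⬝ᵥ y₁| ≤ (κ + 50 / T) * (Fintype.card V + Fintype.card W) := by
  obtain ⟨π, A, hsplit, hf4, hcase⟩ := h
  have hm0 : (0 : ℝ) < Fintype.card V := by exact_mod_cast hV
  have hk0 : (0 : ℝ) < Fintype.card W := by exact_mod_cast hW
  have hmain := hsplit.abs_dotProduct_rowDeviation_le hC hs heq
  set m := (Fintype.card V : ℝ)
  set k := (Fintype.card W : ℝ)
  set q := √(m + k) with hq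
  have hq0 : 0 < q := Real.sqrt_pos.mpr (by positivity)
  have hq2 : q ^ 2 = m + k := Real.sq_sqrt (by positivity)
  set j := ⌊μ / q⌋₊
  have hj1 : j * q ≤ μ := by
    rw [← le_div_iff₀ hq0]
    exact Nat.floor_le (by positivity)
  have hj2 : μ < j * q + q := by
    have := Nat.lt_floor_add_one (μ / q)
    rw [div_lt_iff₀ hq0] at this
    linarith
  -- The second alternative is impossible: a trial vector would give `μ ≤ j q + T q - (T + 1) q < j
  -- q`.
  have hπ : l2norm (π.mulVec (rowDeviation p C)) ≤ κ * (m + k) := by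
    refine hcase.resolve_right ?_
    rintro ⟨u, hu, hu'⟩
    have := hsplit.le_of_trial hμ (by linarith) hu hu'
    nlinarith
  set e := rowDeviation p C
  set f := A.mulVec e
  have hs4 : √(k / 2) ^ 4 = k ^ 2 / 4 := by
    rw [show 4 = 2 * 2 from rfl, pow_mul, Real.sq_sqrt (by positivity)]
    ring
  rw [div_pow, mul_pow, show q ^ 4 = (q ^ 2) ^ 2 by ring, hs4] at hf4
  rw [hs4] at he4
  rw [← hq2] at hπ ⊢
  have hmq : m ≤ q ^ 2 := by linarith
  have hkq : k ≤ q ^ 2 := by linarith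
  have he : l2norm e ≤ 5 * q ^ 2 := by
    refine le_of_pow_le_pow_left₀ (by norm_num : 4 ≠ 0) (by positivity) ?_
    calc l2norm e ^ 4 ≤ m * ∑ u, e u ^ 4 := l2norm_pow_four_le e
      _ ≤ m * (2000 * (k ^ 2 / 4) * m) := by gcongr
      _ = 500 * (m ^ 2 * k ^ 2) := by ring
      _ ≤ 500 * ((q ^ 2) ^ 2 * (q ^ 2) ^ 2) := by gcongr
      _ ≤ _ := by
        have : 0 ≤ q ^ 8 := by positivity
        nlinarith
  have hf : l2norm f ≤ 5 * q / T := by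
    refine (hsplit.l2norm_le e).trans ?_
    calc l2norm e / (T * q) ≤ 5 * q ^ 2 / (T * q) := by gcongr
      _ = _ := by field_simp
  have hef : l2norm (fun u => e u * f u) ≤ 12 * q ^ 2 / T := by
    refine le_of_pow_le_pow_left₀ (by norm_num : 4 ≠ 0) (by positivity) ?_
    have hkm : k * m ≤ q ^ 4 / 4 := by
      rw [show q ^ 4 = (q ^ 2) ^ 2 by ring, hq2]
      nlinarith [sq_nonneg (k - m)]
    calc l2norm (fun u => e u * f u) ^ 4 ≤ (∑ u, e u ^ 4) * ∑ u, f u ^ 4 := sum_mul_sq_sq_le e f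
      _ ≤ (2000 * (k ^ 2 / 4) * m) * (2000 * (k ^ 2 / 4 / (T ^ 4 * (q ^ 2) ^ 2)) * m) := by gcongr
      _ = 250000 * ((k * m) ^ 2 * k ^ 2) / (T ^ 4 * q ^ 4) := by field_simp; ring
      _ ≤ 250000 * ((q ^ 4 / 4) ^ 2 * (q ^ 2) ^ 2) / (T ^ 4 * q ^ 4) := by gcongr
      _ = 15625 * (q ^ 8 / T ^ 4) := by field_simp; ring
      _ ≤ 20736 * (q ^ 8 / T ^ 4) := by gcongr; norm_num
      _ = _ := by field_simp; ring
  have hμl : |μ - j * q| ≤ q := by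
    rw [abs_of_nonneg (by linarith)]
    linarith
  calc |e ⬝ᵥ y₁| ≤ _ := hmain
    _ ≤ κ * q ^ 2 * 1 + q * (5 * q / T * 1) + 12 * q ^ 2 / T * 1 + 6 * q * (5 * q / T * 1) := by
      have a1 := l2norm_nonneg y₁
      have a2 := l2norm_nonneg y₂
      have a3 : 0 ≤ κ * q ^ 2 := (l2norm_nonneg _).trans hπ
      have a4 := mul_nonneg (l2norm_nonneg f) a1
      have a5 := mul_nonneg (l2norm_nonneg f) a2
      gcongr
    _ = κ * q ^ 2 + 47 / T * q ^ 2 := by field_simp; ring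
    _ ≤ κ * q ^ 2 + 50 / T * q ^ 2 := by gcongr; norm_num
    _ = _ := by ring

end Correlation

end

noncomputable section

open Matrix

/-! ### Probabilities of the exceptional events -/

section Exceptional

variable {Ω V W : Type*} [MeasurableSpace Ω] [Fintype V] [Fintype W]

theorem IsIIDBernoulli.measureReal_not_bilin_le [DecidableEq V] {P : Measure Ω}
    [IsProbabilityMeasure P] {C : Ω → V → W → Bool} {p : ℝ} (h : IsIIDBernoulli P C p)
    (hp : 0 ≤ p) (hV : 0 < Fintype.card V) :
    P.real {ω | ¬ ∀ (z : V → ℝ) (w : W → ℝ), |∑ u, ∑ v, z u * w v * centredEntry p (C ω) u v| ≤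
      6 * √(Fintype.card V + Fintype.card W) * (l2norm z * l2norm w)} ≤
      Real.exp (-(2 * (Fintype.card V + Fintype.card W))) := by
  have hm0 : (0 : ℝ) < Fintype.card V := by exact_mod_cast hV
  have hq0 : 0 < √((Fintype.card V : ℝ) + Fintype.card W) := Real.sqrt_pos.mpr (by positivity)
  have hq2 : √((Fintype.card V : ℝ) + Fintype.card W) ^ 2 = Fintype.card V + Fintype.card W :=
    Real.sq_sqrt (by positivity)
  -- With this `t` the norm bound is `4 t = 6 √N` and the exponent is `2 N - 9 N / 2`.
  have h1 := measureReal_bilin_le (h.measureReal_sum_le hp)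
    (t := 3 / 2 * √((Fintype.card V : ℝ) + Fintype.card W)) (by positivity)
  refine (measureReal_mono ?_ (measure_ne_top _ _)).trans (h1.trans (Real.exp_le_exp.mpr ?_))
  · intro ω hω
    simp only [Set.mem_ofPred_eq] at hω ⊢
    contrapose! hω
    intro z w
    rw [abs_le']
    refine ⟨(hω z w).trans (le_of_eq (by ring)), ?_⟩
    have h2 := hω (-z) w
    rw [l2norm_neg] at h2
    simp only [Pi.neg_apply, neg_mul, Finset.sum_neg_distrib] at h2
    linarith
  · rw [mul_pow, hq2]
    have : (0 : ℝ) ≤ Fintype.card V + Fintype.card W := by positivity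
    linarith

theorem IsIIDBernoulli.measureReal_not_sum_pow_four_le {P : Measure Ω}
    [IsProbabilityMeasure P] {C : Ω → V → W → Bool} {p : ℝ} (h : IsIIDBernoulli P C p)
    (hp : 0 ≤ p) (hV : 0 < Fintype.card V) (hW : 0 < Fintype.card W) {r : ℝ} (hr0 : 0 ≤ r)
    (hr : r ^ 3 ≤ Fintype.card V) :
    P.real {ω | ¬ ∑ u, rowDeviation p (C ω) u ^ 4 ≤
      2000 * √(Fintype.card W / 2) ^ 4 * Fintype.card V} ≤
      (Fintype.card V + 1) * Real.exp (-4 * r) := by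
  have : Nonempty W := Fintype.card_pos_iff.mp hW
  have hk0 : (0 : ℝ) < Fintype.card W := by exact_mod_cast hW
  have h1 := h.isSubgaussianVector_rowDeviation hp
  rw [← Real.sq_sqrt (by positivity : (0 : ℝ) ≤ Fintype.card W / 2)] at h1
  exact h1.measureReal_sum_pow_four_le (by positivity) hr0 hr hV

theorem exists_measureReal_not_isSpectrallyRegular_le {p T κ K : ℝ} (hp0 : 0 < p) (hp1 : p < 1)
    (hT : 0 < T) (hκ : 0 < κ) (hK : 0 < K) :
    ∃ c > 0, ∃ M₀ : ℕ, ∀ {Ω V W : Type*} [MeasurableSpace Ω] [Fintype V] [DecidableEq V]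
      [Fintype W] {P : Measure Ω} [IsProbabilityMeasure P] {C : Ω → V → W → Bool},
      IsIIDBernoulli P C p → 0 < Fintype.card V → 0 < Fintype.card W → M₀ ≤ Fintype.card W →
      (Fintype.card V + Fintype.card W : ℝ) ≤ K * Fintype.card W →
      ∀ r : ℝ, 0 ≤ r → r ^ 3 ≤ Fintype.card V → ∀ (G : SimpleGraph V) (j : ℕ),
      P.real {ω | ¬ IsSpectrallyRegular G p (C ω) T κ j} ≤
        (Fintype.card V + 1) * Real.exp (-4 * r) + 2 * Real.exp (-(c * Fintype.card V)) := by
  set δ : ℝ := κ ^ 2 / 8 with hδ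
  have hδ0 : 0 < δ := by positivity
  -- Low rows must be this many standard deviations down so that `a √k δ ^ 2 / 4` covers both the
  -- target `(T + 1) √N` and the fluctuation `2 √(k / 2)`.
  set a : ℝ := 4 * ((T + 1) * √K + 2) / δ ^ 2 with ha
  have ha0 : 0 ≤ a := by positivity
  obtain ⟨q₀, hq₀, M₀, hM₀⟩ := exists_lower_tail hp0 hp1 ha0
  refine ⟨min (κ ^ 2 / 4) (q₀ ^ 2 * δ / 4), lt_min (by positivity) (by positivity), M₀, ?_⟩
  intro Ω V W _ _ _ _ P _ C hC hV hW hMW hKW r hr0 hr G j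
  have hq := hM₀ hC hMW
  have : Nonempty W := Fintype.card_pos_iff.mp hW
  obtain ⟨u₀⟩ : Nonempty V := Fintype.card_pos_iff.mp hV
  have hsub := hC.isSubgaussianVector_rowDeviation hp0.le
  have hm0 : (0 : ℝ) < Fintype.card V := by exact_mod_cast hV
  have hk0 : (0 : ℝ) < Fintype.card W := by exact_mod_cast hW
  have hind := hC.iIndepFun_rowDeviation
  have hmeas := hC.measurable_rowDeviation
  have heq := fun u => hC.measureReal_rowDeviation_eq (-(a * √(Fintype.card W))) u u₀
  unfold IsSpectrallyRegular
  set m := (Fintype.card V : ℝ) with hm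
  set k := (Fintype.card W : ℝ) with hk
  have hq0 : 0 < √(m + k) := Real.sqrt_pos.mpr (by positivity)
  obtain ⟨π, A, hs⟩ := IsSpectralSplit.exists (meanClusterMatrix_isHermitian G p k)
    (j * √(m + k)) (mul_pos hT hq0)
  have hs0 : 0 < √(k / 2) := by positivity
  have hE1 : P.real {ω | ¬ ∑ u, A.mulVec (rowDeviation p (C ω)) u ^ 4 ≤
      2000 * (√(k / 2) / (T * √(m + k))) ^ 4 * m} ≤ (m + 1) * Real.exp (-4 * r) := by
    have h1 := hsub.mulVec (mul_pos hT hq0) hs.transpose hs.l2norm_le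
    rw [← Real.sq_sqrt (by positivity : (0 : ℝ) ≤ k / 2), ← div_pow] at h1
    exact h1.measureReal_sum_pow_four_le (by positivity) hr0 hr hV
  have hE2 : P.real {ω | ¬ (l2norm (π.mulVec (rowDeviation p (C ω))) ≤ κ * (m + k) ∨
      ∃ u, 0 < π u u ∧ ∑ w, rowDeviation p (C ω) w * π w u ^ 2 ≤
        -((T + 1) * √(m + k)) * π u u)} ≤
      2 * Real.exp (-(min (κ ^ 2 / 4) (q₀ ^ 2 * δ / 4) * m)) := by
    -- At small rank the net costs at most `κ ^ 2 m / 4` in the exponent, against a tail of at least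
    -- `κ ^ 2 m / 2`; this fixes `δ = κ ^ 2 / 8`. At large rank a trial vector exists.
    rcases lt_or_ge π.trace (δ * m) with htr | htr
    · refine (measureReal_mono (s₂ := {ω | 2 * (κ * (m + k) / 2) ≤
        l2norm (π.mulVec (rowDeviation p (C ω)))}) ?_ (measure_ne_top _ _)).trans ?_
      · intro ω hω
        simp only [Set.mem_ofPred_eq, not_or, not_le] at hω ⊢
        linarith [hω.1]
      · refine (hsub.measureReal_projection_le hs.proj_transpose hs.proj_mul_self
          (by positivity)).trans ?_
        have h1 : 2 * π.trace - (κ * (m + k) / 2) ^ 2 / (k / 2) ≤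
            -(min (κ ^ 2 / 4) (q₀ ^ 2 * δ / 4) * m) := by
          have h2 : κ ^ 2 / 2 * m ≤ (κ * (m + k) / 2) ^ 2 / (k / 2) := by
            rw [le_div_iff₀ (by positivity)]
            have : k * m ≤ (m + k) ^ 2 := by nlinarith
            nlinarith [sq_nonneg κ]
          have h3 := mul_le_mul_of_nonneg_right
            (min_le_left (κ ^ 2 / 4) (q₀ ^ 2 * δ / 4)) hm0.le
          rw [hδ] at htr
          linarith
        have h2 := Real.exp_le_exp.mpr h1
        have h3 := Real.exp_pos (-(min (κ ^ 2 / 4) (q₀ ^ 2 * δ / 4) * m))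
        linarith
    · refine (measureReal_mono (s₂ := {ω | ¬ ∃ u, 0 < π u u ∧
        ∑ w, rowDeviation p (C ω) w * π w u ^ 2 ≤ -((T + 1) * √(m + k)) * π u u}) ?_
        (measure_ne_top _ _)).trans ?_
      · intro ω hω
        simp only [Set.mem_ofPred_eq, not_or] at hω ⊢
        exact hω.2
      · refine (measureReal_no_trial_le hind hmeas (by positivity) hsub
          (lt_of_lt_of_le hq₀ (hq u₀)) heq hs.proj_transpose hs.proj_mul_self hδ0 htr
          (by positivity) ?_ hV).trans ?_
        · have h1 : √(m + k) ≤ √K * √k := by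
            rw [← Real.sqrt_mul hK.le]
            exact Real.sqrt_le_sqrt hKW
          have h2 : √(k / 2) ≤ √k := Real.sqrt_le_sqrt (by linarith)
          have h3 : a * √k * δ ^ 2 / 4 = ((T + 1) * √K + 2) * √k := by
            rw [ha]
            field_simp
          rw [h3]
          have h4 : (T + 1) * √(m + k) ≤ (T + 1) * (√K * √k) := by gcongr
          linarith
        · gcongr 2 * Real.exp (-?_)
          have h1 : q₀ ^ 2 ≤ P.real {ω | rowDeviation p (C ω) u₀ ≤ -(a * √k)} ^ 2 :=
            pow_le_pow_left₀ hq₀.le (hq u₀) 2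
          calc min (κ ^ 2 / 4) (q₀ ^ 2 * δ / 4) * m ≤ q₀ ^ 2 * δ / 4 * m := by
                gcongr
                exact min_le_right _ _
            _ = q₀ ^ 2 * (δ * m / 4) := by ring
            _ ≤ P.real {ω | rowDeviation p (C ω) u₀ ≤ -(a * √k)} ^ 2 * (δ * m / 4) := by gcongr
            _ = _ := by ring
  refine le_trans ?_ (add_le_add hE1 hE2)
  refine (measureReal_mono ?_ (measure_ne_top _ _)).trans (measureReal_union_le _ _)
  intro ω hω
  by_contra hcon
  exact hω ⟨π, A, hs, not_not.mp fun h => hcon (Or.inl h), not_not.mp fun h => hcon (Or.inr h)⟩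

/-- A Borel–Cantelli lemma for events indexed by distinct pairs of sizes. -/
theorem ae_eventually_forall_notMem {P : Measure Ω} [IsProbabilityMeasure P] {n₁ n₂ : ℕ → ℕ}
    (hinj : Function.Injective fun m => (n₁ m, n₂ m)) {bad : ℕ → ℕ → Set Ω}
    (hbad : ∀ᶠ m in atTop, ∀ j ≤ n₁ m + n₂ m,
      P.real (bad m j) ≤ 4 / ((n₁ m : ℝ) + n₂ m + 1) ^ 7) :
    ∀ᵐ ω ∂P, ∀ᶠ m in atTop, ∀ j ≤ n₁ m + n₂ m, ω ∉ bad m j := by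
  classical
  let good : ℕ → Prop := fun m => ∀ j ≤ n₁ m + n₂ m,
    P.real (bad m j) ≤ 4 / ((n₁ m : ℝ) + n₂ m + 1) ^ 7
  -- Empty at the exceptional `m`, so that the bound below holds for every `m` and not just
  -- eventually.
  let B : ℕ → Set Ω := fun m =>
    if good m then ⋃ j ∈ Finset.range (n₁ m + n₂ m + 1), bad m j else ∅
  have hB : ∀ m, P.real (B m) ≤ 4 * (1 / ((n₁ m : ℝ) + 1) ^ 2 * (1 / ((n₂ m : ℝ) + 1) ^ 2)) := by
    intro m
    by_cases hm : good m
    · simp only [B, if_pos hm]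
      calc P.real (⋃ j ∈ Finset.range (n₁ m + n₂ m + 1), bad m j)
          ≤ ∑ j ∈ Finset.range (n₁ m + n₂ m + 1), P.real (bad m j) :=
            measureReal_biUnion_finset_le _ _
        _ ≤ ∑ j ∈ Finset.range (n₁ m + n₂ m + 1), 4 / ((n₁ m : ℝ) + n₂ m + 1) ^ 7 :=
            Finset.sum_le_sum fun j hj => hm j (by simpa [Nat.lt_succ_iff] using hj)
        _ = 4 * (1 / (((n₁ m : ℝ) + n₂ m + 1) ^ 2 * ((n₁ m : ℝ) + n₂ m + 1) ^ 4)) := by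
            rw [Finset.sum_const, Finset.card_range, nsmul_eq_mul]
            push_cast
            field_simp
        -- One power of the size has paid for the values of `j`; what remains is a product that is
        -- summable over all pairs, hence along distinct pairs.
        _ ≤ 4 * (1 / (((n₁ m : ℝ) + 1) ^ 2 * ((n₂ m : ℝ) + 1) ^ 2)) := by
            have h1 : (0 : ℝ) ≤ n₁ m := by positivity
            have h2 : (0 : ℝ) ≤ n₂ m := by positivity
            gcongr
            · linarith
            · calc ((n₂ m : ℝ) + 1) ^ 2 ≤ ((n₁ m : ℝ) + n₂ m + 1) ^ 2 := by
                    gcongr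
                    linarith
                _ ≤ _ := pow_le_pow_right₀ (by linarith) (by norm_num)
        _ = _ := by field_simp
    · simp only [B, if_neg hm, measureReal_empty]
      positivity
  have hone : Summable fun i : ℕ => 1 / ((i : ℝ) + 1) ^ 2 := by
    have := (summable_nat_add_iff 1).mpr
      (Real.summable_one_div_nat_pow (p := 2).mpr (by norm_num))
    simpa using this
  have hsum : Summable fun m => P.real (B m) := by
    refine Summable.of_nonneg_of_le (fun m => measureReal_nonneg) hB (Summable.mul_left _ ?_)
    have h2 := hone.mul_of_nonneg hone (fun i => by positivity) (fun i => by positivity)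
    have h3 := h2.comp_injective hinj
    simpa only [Function.comp_def] using h3
  have htsum : ∑' m, P (B m) ≠ ⊤ := by
    have h1 : ∀ m, P (B m) = ENNReal.ofReal (P.real (B m)) := fun m => by
      rw [Measure.real, ENNReal.ofReal_toReal (measure_ne_top _ _)]
    simp only [h1]
    exact hsum.tsum_ofReal_ne_top
  filter_upwards [ae_eventually_notMem htsum] with ω hω
  filter_upwards [hω, hbad] with m h1 h2 j hj hcon
  have hg : good m := h2
  apply h1
  simp only [B, if_pos hg, Set.mem_iUnion]
  exact ⟨j, by simpa [Nat.lt_succ_iff] using hj, hcon⟩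

theorem eventually_exp_neg_mul_le {c : ℝ} (hc : 0 < c) :
    ∀ᶠ N : ℕ in atTop, Real.exp (-(c * N)) ≤ 1 / ((N : ℝ) + 1) ^ 7 := by
  have h1 : Tendsto (fun x : ℝ => (x + 1) ^ 7 * Real.exp (-(c * x))) atTop (𝓝 0) := by
    have h2 := ((Real.tendsto_pow_mul_exp_neg_atTop_nhds_zero 7).comp
      ((tendsto_id.atTop_add tendsto_const_nhds).const_mul_atTop hc :
        Tendsto (fun x : ℝ => c * (x + 1)) atTop atTop)).const_mul (Real.exp c / c ^ 7)
    rw [mul_zero] at h2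
    refine h2.congr fun x => ?_
    simp only [Function.comp_apply, mul_pow]
    rw [show -(c * x) = c + -(c * (x + 1)) by ring, Real.exp_add]
    field_simp
  filter_upwards [(h1.comp tendsto_natCast_atTop_atTop).eventually_le_const one_pos] with N hN
  rw [le_div_iff₀ (by positivity), mul_comm]
  exact hN

theorem eventually_log_pow_le {c : ℝ} (hc : 0 < c) :
    ∀ᶠ N : ℕ in atTop, (2 * Real.log (N + 1)) ^ 3 ≤ c * N := by
  have h1 : (fun x : ℝ => Real.log x ^ 3) =o[atTop] fun x => x :=
    Real.isLittleO_pow_log_id_atTop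
  have h2 := (h1.def (by positivity : 0 < c / 16)).natCast_atTop
  have h3 := (tendsto_add_atTop_iff_nat 1).mpr tendsto_id |>.eventually h2
  filter_upwards [h3, eventually_ge_atTop 1] with N hN hN1
  have hN1' : (1 : ℝ) ≤ N := by exact_mod_cast hN1
  simp only [id, Real.norm_eq_abs, Nat.cast_add, Nat.cast_one] at hN
  rw [abs_of_nonneg (by positivity : (0 : ℝ) ≤ N + 1)] at hN
  have h4 := (le_abs_self _).trans hN
  rw [mul_pow]
  nlinarith

end Exceptional

end

noncomputable section

open Matrix

/-! ### Almost sure regularity of the interconnection matrices -/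

section AlmostSure

/-- The choice `r = 2 log (N + 1)` makes `exp (-4 r)` the power `(N + 1) ^ (-8)`, while `r ^ 3` is
still `o(N)`. -/
theorem add_one_mul_exp_log_le {a N : ℝ} (ha : a ≤ N) (hN : 0 ≤ N) :
    (a + 1) * Real.exp (-4 * (2 * Real.log (N + 1))) ≤ 1 / (N + 1) ^ 7 := by
  have h1 : Real.exp (-4 * (2 * Real.log (N + 1))) = 1 / (N + 1) ^ 8 := by
    rw [show -4 * (2 * Real.log (N + 1)) = -(Real.log ((N + 1) ^ 8)) by
      rw [Real.log_pow]; push_cast; ring, Real.exp_neg, Real.exp_log (by positivity), one_div]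
  rw [h1]
  calc (a + 1) * (1 / (N + 1) ^ 8) ≤ (N + 1) * (1 / (N + 1) ^ 8) := by gcongr
    _ = _ := by field_simp

variable {Ω : Type*} [MeasurableSpace Ω] {P : Measure Ω} [IsProbabilityMeasure P]
  {n₁ n₂ : ℕ → ℕ} {C : ∀ m, Ω → Fin (n₁ m) → Fin (n₂ m) → Bool} {p K : ℝ}

theorem ae_eventually_sum_rowDeviation_pow_four_le
    (hinj : Function.Injective fun m => (n₁ m, n₂ m)) (hn₁ : Tendsto n₁ atTop atTop)
    (hn₂ : Tendsto n₂ atTop atTop) (hK0 : 0 < K)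
    (hK : ∀ᶠ m in atTop, (n₁ m + n₂ m : ℝ) ≤ K * n₁ m) (hp : 0 ≤ p)
    (hC : ∀ m, IsIIDBernoulli P (C m) p) :
    ∀ᵐ ω ∂P, ∀ᶠ m in atTop, ∑ u, rowDeviation p (C m ω) u ^ 4 ≤
      2000 * √(n₂ m / 2) ^ 4 * n₁ m := by
  have h := ae_eventually_forall_notMem (P := P) hinj (bad := fun m _ => {ω | ¬
    ∑ u, rowDeviation p (C m ω) u ^ 4 ≤ 2000 * √(n₂ m / 2) ^ 4 * n₁ m}) (by
    filter_upwards [hn₁.eventually_gt_atTop 0, hn₂.eventually_gt_atTop 0, hK,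
      (tendsto_atTop_mono (fun m => Nat.le_add_right (n₁ m) (n₂ m)) hn₁).eventually
        (eventually_log_pow_le (inv_pos.mpr hK0))] with m h1 h2 h3 h4 j _
    have hlog : 0 ≤ Real.log (((n₁ m + n₂ m : ℕ) : ℝ) + 1) :=
      Real.log_nonneg (by linarith [Nat.cast_nonneg (α := ℝ) (n₁ m + n₂ m)])
    have h5 := (hC m).measureReal_not_sum_pow_four_le hp (by simpa using h1) (by simpa using h2)
      (r := 2 * Real.log (((n₁ m + n₂ m : ℕ) : ℝ) + 1)) (by positivity) (by
        rw [Fintype.card_fin]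
        refine h4.trans ?_
        rw [inv_mul_le_iff₀ hK0]
        push_cast
        exact h3)
    simp only [Fintype.card_fin] at h5
    refine h5.trans ((add_one_mul_exp_log_le ?_ (by positivity)).trans ?_)
    · push_cast
      linarith [Nat.cast_nonneg (α := ℝ) (n₂ m)]
    · push_cast
      gcongr
      norm_num)
  filter_upwards [h] with ω hω
  filter_upwards [hω] with m hm
  exact not_not.mp (hm 0 (Nat.zero_le _))

theorem ae_eventually_isSpectrallyRegular
    (hinj : Function.Injective fun m => (n₁ m, n₂ m)) (hn₁ : Tendsto n₁ atTop atTop)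
    (hn₂ : Tendsto n₂ atTop atTop) (hK0 : 0 < K)
    (hK₁ : ∀ᶠ m in atTop, (n₁ m + n₂ m : ℝ) ≤ K * n₁ m)
    (hK₂ : ∀ᶠ m in atTop, (n₁ m + n₂ m : ℝ) ≤ K * n₂ m) (hp0 : 0 < p) (hp1 : p < 1)
    (hC : ∀ m, IsIIDBernoulli P (C m) p) (G : ∀ m, SimpleGraph (Fin (n₁ m))) {T κ : ℝ}
    (hT : 0 < T) (hκ : 0 < κ) :
    ∀ᵐ ω ∂P, ∀ᶠ m in atTop, ∀ j ≤ n₁ m + n₂ m,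
      IsSpectrallyRegular (G m) p (C m ω) T κ j := by
  obtain ⟨c, hc, M₀, hM₀⟩ := exists_measureReal_not_isSpectrallyRegular_le hp0 hp1 hT hκ hK0
  have hadd := tendsto_atTop_mono (fun m => Nat.le_add_right (n₁ m) (n₂ m)) hn₁
  have h := ae_eventually_forall_notMem (P := P) hinj (bad := fun m j => {ω | ¬
    IsSpectrallyRegular (G m) p (C m ω) T κ j}) (by
    filter_upwards [hn₁.eventually_gt_atTop 0, hn₂.eventually_gt_atTop 0,
      hn₂.eventually_ge_atTop M₀, hK₁, hK₂,
      hadd.eventually (eventually_log_pow_le (inv_pos.mpr hK0)),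
      hadd.eventually (eventually_exp_neg_mul_le (mul_pos hc (inv_pos.mpr hK0)))]
      with m h1 h2 h2' h3 h3' h4 h4' j _
    have hlog : 0 ≤ Real.log (((n₁ m + n₂ m : ℕ) : ℝ) + 1) :=
      Real.log_nonneg (by linarith [Nat.cast_nonneg (α := ℝ) (n₁ m + n₂ m)])
    have hKm : K⁻¹ * ((n₁ m + n₂ m : ℕ) : ℝ) ≤ n₁ m := by
      rw [inv_mul_le_iff₀ hK0]
      push_cast
      exact h3
    have h5 := hM₀ (hC m) (by simpa using h1) (by simpa using h2) (by simpa using h2')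
      (by simpa using h3') (2 * Real.log (((n₁ m + n₂ m : ℕ) : ℝ) + 1)) (by positivity) (by
        rw [Fintype.card_fin]
        exact h4.trans hKm) (G m) j
    simp only [Fintype.card_fin] at h5
    have h6 := add_one_mul_exp_log_le (a := n₁ m) (N := ((n₁ m + n₂ m : ℕ) : ℝ))
      (by push_cast; linarith [Nat.cast_nonneg (α := ℝ) (n₂ m)]) (by positivity)
    have h7 : Real.exp (-(c * n₁ m)) ≤ 1 / (((n₁ m + n₂ m : ℕ) : ℝ) + 1) ^ 7 := by
      refine le_trans (Real.exp_le_exp.mpr (neg_le_neg ?_)) h4'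
      rw [mul_assoc]
      gcongr
    have h8 : (0 : ℝ) ≤ 1 / (((n₁ m + n₂ m : ℕ) : ℝ) + 1) ^ 7 := by positivity
    have h9 : (4 : ℝ) / ((n₁ m : ℝ) + n₂ m + 1) ^ 7 =
        4 * (1 / (((n₁ m + n₂ m : ℕ) : ℝ) + 1) ^ 7) := by
      push_cast
      ring
    rw [h9]
    linarith)
  filter_upwards [h] with ω hω
  filter_upwards [hω] with m hm j hj
  exact not_not.mp (hm j hj)

/-- An almost sure bound for the row sums, in terms of the number of nodes. -/
def rowDeviationBound (N : ℝ) : ℝ := 5 * √(N * √N)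

/-- A single fourth power is at most the whole sum, which is `O(N ^ 3)`. The resulting order
`N^(3/4)` is crude, but `o(N)` is all that is needed. -/
theorem abs_rowDeviation_le_bound {V W : Type*} [Fintype V] [Fintype W] {C : V → W → Bool}
    (h : ∑ u, rowDeviation p C u ^ 4 ≤ 2000 * √(Fintype.card W / 2) ^ 4 * Fintype.card V) (u : V) :
    |rowDeviation p C u| ≤ rowDeviationBound (Fintype.card V + Fintype.card W) := by
  have hm : (0 : ℝ) ≤ Fintype.card V := by positivity
  have hk : (0 : ℝ) ≤ Fintype.card W := by positivity
  set m := (Fintype.card V : ℝ)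
  set k := (Fintype.card W : ℝ)
  rw [rowDeviationBound]
  refine le_of_pow_le_pow_left₀ (by norm_num : 4 ≠ 0) (by positivity) ?_
  have h1 : rowDeviation p C u ^ 4 ≤ ∑ u, rowDeviation p C u ^ 4 :=
    Finset.single_le_sum (f := fun u => rowDeviation p C u ^ 4) (fun u _ => by positivity)
      (Finset.mem_univ u)
  have hs4 : √(k / 2) ^ 4 = k ^ 2 / 4 := by
    rw [show 4 = 2 * 2 from rfl, pow_mul, Real.sq_sqrt (by positivity)]
    ring
  have hs5 : (5 * √((m + k) * √(m + k))) ^ 4 = 625 * (m + k) ^ 3 := by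
    rw [mul_pow, show √((m + k) * √(m + k)) ^ 4 = (√((m + k) * √(m + k)) ^ 2) ^ 2 by ring,
      Real.sq_sqrt (by positivity), mul_pow, Real.sq_sqrt (by positivity)]
    ring
  rw [Even.pow_abs (by decide : Even 4), hs5]
  rw [hs4] at h
  calc rowDeviation p C u ^ 4 ≤ 2000 * (k ^ 2 / 4) * m := h1.trans h
    _ = 500 * (k ^ 2 * m) := by ring
    _ ≤ 625 * ((m + k) ^ 2 * (m + k)) := by gcongr <;> linarith
    _ = _ := by ring

theorem tendsto_rowDeviationBound_div :
    Tendsto (fun N : ℝ => rowDeviationBound N / N) atTop (𝓝 0) := by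
  have h1 : Tendsto (fun N : ℝ => √(√N)) atTop atTop :=
    Real.tendsto_sqrt_atTop.comp Real.tendsto_sqrt_atTop
  have h2 := h1.inv_tendsto_atTop.const_mul 5
  rw [mul_zero] at h2
  refine h2.congr' ?_
  filter_upwards [eventually_gt_atTop 0] with N hN
  obtain ⟨t, ht, rfl⟩ : ∃ t > 0, N = t ^ 4 :=
    ⟨√(√N), by positivity, by
      rw [show 4 = 2 * 2 from rfl, pow_mul, Real.sq_sqrt (Real.sqrt_nonneg N), Real.sq_sqrt hN.le]⟩
  have h4 : √(t ^ 4) = t ^ 2 := by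
    rw [show t ^ 4 = (t ^ 2) ^ 2 by ring, Real.sqrt_sq (by positivity)]
  rw [rowDeviationBound, Real.sqrt_mul hN.le, Pi.inv_apply, h4, Real.sqrt_sq ht.le]
  field_simp

theorem ae_eventually_hasSmallDeviation
    (hinj : Function.Injective fun m => (n₁ m, n₂ m)) (hn₁ : Tendsto n₁ atTop atTop)
    (hn₂ : Tendsto n₂ atTop atTop) (hK0 : 0 < K)
    (hK₁ : ∀ᶠ m in atTop, (n₁ m + n₂ m : ℝ) ≤ K * n₁ m)
    (hK₂ : ∀ᶠ m in atTop, (n₁ m + n₂ m : ℝ) ≤ K * n₂ m) (hp : 0 ≤ p)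
    (hC : ∀ m, IsIIDBernoulli P (C m) p) :
    ∀ᵐ ω ∂P, ∀ᶠ m in atTop, HasSmallDeviation p (C m ω) (6 * √((n₁ m : ℝ) + n₂ m))
      (rowDeviationBound ((n₁ m : ℝ) + n₂ m)) := by
  have hadd := tendsto_atTop_mono (fun m => Nat.le_add_right (n₁ m) (n₂ m)) hn₁
  have h := ae_eventually_forall_notMem (P := P) hinj (bad := fun m _ => {ω | ¬
    ∀ (z : Fin (n₁ m) → ℝ) (w : Fin (n₂ m) → ℝ),
      |∑ u, ∑ v, z u * w v * centredEntry p (C m ω) u v| ≤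
      6 * √((n₁ m : ℝ) + n₂ m) * (l2norm z * l2norm w)}) (by
    filter_upwards [hn₁.eventually_gt_atTop 0,
      hadd.eventually (eventually_exp_neg_mul_le two_pos)] with m h1 h2 j _
    have h3 := (hC m).measureReal_not_bilin_le hp (by simpa using h1)
    simp only [Fintype.card_fin] at h3
    push_cast at h2
    refine h3.trans (h2.trans ?_)
    gcongr
    norm_num)
  have hswap : Function.Injective fun m => (n₂ m, n₁ m) :=
    fun a b hab => hinj (by simpa [and_comm] using hab)
  have hrow := ae_eventually_sum_rowDeviation_pow_four_le hinj hn₁ hn₂ hK0 hK₁ hp hC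
  have hcol := ae_eventually_sum_rowDeviation_pow_four_le hswap hn₂ hn₁ hK0
    (by simpa only [add_comm] using hK₂) hp fun m => (hC m).swap
  filter_upwards [h, hrow, hcol] with ω hω h1 h2
  filter_upwards [hω, h1, h2] with m hm h1 h2
  refine ⟨not_not.mp (hm 0 (Nat.zero_le _)), fun u => ?_, fun v => ?_⟩
  · simpa using abs_rowDeviation_le_bound (C := C m ω) (by simpa using h1) u
  · simpa [add_comm] using abs_rowDeviation_le_bound
      (C := fun v u => C m ω u v) (by simpa using h2) v

end AlmostSure

end

noncomputable section

open Matrix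

/-! ### Limits along a sequence of two-cluster graphs -/

section Equations

variable {V W : Type*} [Fintype V] [Fintype W] {G : SimpleGraph V} {H : SimpleGraph W}
  {C : V → W → Bool} {y : V ⊕ W → ℝ}

theorem IsSpectralSolution.eq_inl (hV : 2 ≤ Fintype.card V)
    (hy : IsSpectralSolution (twoClusterGraph G H C) y) (u : V) :
    (graphLaplacian G).mulVec (fun u => y (Sum.inl u)) u +
      ∑ v, (if C u v = true then (1 : ℝ) else 0) * (y (Sum.inl u) - y (Sum.inr v)) =
    lambda2 (twoClusterGraph G H C) * y (Sum.inl u) := by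
  have h := congrFun (hy.mulVec_eq (by rw [Fintype.card_sum]; omega)) (Sum.inl u)
  rw [twoClusterGraph_mulVec_inl] at h
  exact h

theorem IsSpectralSolution.eq_inr (hV : 2 ≤ Fintype.card V)
    (hy : IsSpectralSolution (twoClusterGraph G H C) y) (v : W) :
    (graphLaplacian H).mulVec (fun v => y (Sum.inr v)) v +
      ∑ u, (if C u v = true then (1 : ℝ) else 0) * (y (Sum.inr v) - y (Sum.inl u)) =
    lambda2 (twoClusterGraph G H C) * y (Sum.inr v) := by
  have h := congrFun (hy.mulVec_eq (by rw [Fintype.card_sum]; omega)) (Sum.inr v)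
  rw [twoClusterGraph_mulVec_inr] at h
  exact h

/-- Summing the eigenvector equation over the first cluster removes the internal Laplacian, and the
two block sums are opposite. -/
theorem IsSpectralSolution.mul_sum_eq (hV : 2 ≤ Fintype.card V)
    (hy : IsSpectralSolution (twoClusterGraph G H C) y) (p : ℝ) :
    (lambda2 (twoClusterGraph G H C) - p * (Fintype.card V + Fintype.card W)) *
        ∑ u, y (Sum.inl u) =
      rowDeviation p C ⬝ᵥ (fun u => y (Sum.inl u)) -
        rowDeviation p (fun v u => C u v) ⬝ᵥ fun v => y (Sum.inr v) := by
  have h1 := Finset.sum_congr (rfl : (Finset.univ : Finset V) = Finset.univ)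
    fun u _ => hy.eq_inl hV u
  rw [Finset.sum_add_distrib, sum_graphLaplacian_mulVec, zero_add, ← Finset.mul_sum] at h1
  simp only [mul_sub, Finset.sum_sub_distrib] at h1
  have h2 : ∀ u, ∑ v, (if C u v = true then (1 : ℝ) else 0) * y (Sum.inl u) =
      p * Fintype.card W * y (Sum.inl u) + rowDeviation p C u * y (Sum.inl u) := by
    intro u
    rw [← Finset.sum_mul, sum_entry_eq p, add_mul]
  have h3 : ∑ u, ∑ v, (if C u v = true then (1 : ℝ) else 0) * y (Sum.inr v) =
      p * Fintype.card V * ∑ v, y (Sum.inr v) +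
        ∑ v, rowDeviation p (fun v u => C u v) v * y (Sum.inr v) := by
    rw [Finset.sum_comm, Finset.mul_sum, ← Finset.sum_add_distrib]
    refine Finset.sum_congr rfl fun v _ => ?_
    rw [← Finset.sum_mul, sum_entry_eq p (fun v u => C u v) v, add_mul]
  have h4 := hy.1.2
  rw [Fintype.sum_sum_type] at h4
  have h5 : ∑ v, y (Sum.inr v) = -∑ u, y (Sum.inl u) := by linarith
  simp only [h2, Finset.sum_add_distrib, ← Finset.mul_sum, h3, h5] at h1
  simp only [dotProduct]
  linarith

theorem IsFeasible.l2norm_inl_le (hy : IsFeasible y) : l2norm (fun u => y (Sum.inl u)) ≤ 1 := by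
  refine l2norm_le_one_of_sum_le ?_
  have h := hy.1
  rw [Fintype.sum_sum_type] at h
  have := Finset.sum_nonneg (s := Finset.univ) fun v _ => sq_nonneg (y (Sum.inr v))
  linarith

theorem IsFeasible.l2norm_inr_le (hy : IsFeasible y) : l2norm (fun v => y (Sum.inr v)) ≤ 1 := by
  refine l2norm_le_one_of_sum_le ?_
  have h := hy.1
  rw [Fintype.sum_sum_type] at h
  have := Finset.sum_nonneg (s := Finset.univ) fun u _ => sq_nonneg (y (Sum.inl u))
  linarith

end Equations

section Limits

variable {n₁ n₂ : ℕ → ℕ}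

theorem tendsto_size (hn₁ : Tendsto n₁ atTop atTop) :
    Tendsto (fun m => (n₁ m : ℝ) + n₂ m) atTop atTop :=
  tendsto_atTop_mono (fun m => by simp) (tendsto_natCast_atTop_atTop.comp hn₁)

theorem tendsto_deviation_div (hn₁ : Tendsto n₁ atTop atTop) :
    Tendsto (fun m => (6 * √((n₁ m : ℝ) + n₂ m) + rowDeviationBound ((n₁ m : ℝ) + n₂ m)) /
      ((n₁ m : ℝ) + n₂ m)) atTop (𝓝 0) := by
  have h1 : Tendsto (fun N : ℝ => 6 * √N / N) atTop (𝓝 0) := by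
    have h2 := Real.tendsto_sqrt_atTop.inv_tendsto_atTop.const_mul 6
    rw [mul_zero] at h2
    refine h2.congr' ?_
    filter_upwards [eventually_gt_atTop 0] with N hN
    rw [Pi.inv_apply, mul_div_assoc, Real.sqrt_div_self]
  have h3 := (h1.add tendsto_rowDeviationBound_div).comp (tendsto_size (n₂ := n₂) hn₁)
  rw [add_zero] at h3
  refine h3.congr fun m => ?_
  simp only [Function.comp_apply]
  rw [add_div]

variable {G₁ : ∀ m, SimpleGraph (Fin (n₁ m))} {G₂ : ∀ m, SimpleGraph (Fin (n₂ m))}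
  {C : ∀ m, Fin (n₁ m) → Fin (n₂ m) → Bool} {p ρ₁ ρ₂ l₁ l₂ : ℝ}

theorem tendsto_lambda2_div (hn₁ : Tendsto n₁ atTop atTop) (hn₂ : Tendsto n₂ atTop atTop)
    (hρ₁ : Tendsto (fun m => (n₁ m : ℝ) / ((n₁ m : ℝ) + n₂ m)) atTop (𝓝 ρ₁))
    (hρ₂ : Tendsto (fun m => (n₂ m : ℝ) / ((n₁ m : ℝ) + n₂ m)) atTop (𝓝 ρ₂))
    (hl₁ : Tendsto (fun m => lambda2 (G₁ m) / ((n₁ m : ℝ) + n₂ m)) atTop (𝓝 l₁))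
    (hl₂ : Tendsto (fun m => lambda2 (G₂ m) / ((n₁ m : ℝ) + n₂ m)) atTop (𝓝 l₂))
    (hdev : ∀ᶠ m in atTop, HasSmallDeviation p (C m) (6 * √((n₁ m : ℝ) + n₂ m))
      (rowDeviationBound ((n₁ m : ℝ) + n₂ m))) :
    Tendsto (fun m => lambda2 (twoClusterGraph (G₁ m) (G₂ m) (C m)) / ((n₁ m : ℝ) + n₂ m)) atTop
      (𝓝 (min p (min (l₁ + p * ρ₂) (l₂ + p * ρ₁)))) := by
  have hη := tendsto_deviation_div (n₂ := n₂) hn₁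
  have hf := (tendsto_const_nhds (x := p)).min
    ((hl₁.add (hρ₂.const_mul p)).min (hl₂.add (hρ₁.const_mul p)))
  have hlo := hf.sub hη
  have hhi := hf.add hη
  rw [sub_zero] at hlo
  rw [add_zero] at hhi
  have hmin : ∀ {N a b c d : ℝ}, 0 < N →
      min p (min (a / N + p * (b / N)) (c / N + p * (d / N))) =
        min (p * N) (min (a + p * b) (c + p * d)) / N := by
    intro N a b c d hN
    rw [← min_div_div_right hN.le, ← min_div_div_right hN.le, mul_div_cancel_right₀ _ hN.ne',
      add_div, add_div, mul_div_assoc, mul_div_assoc]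
  have hev : ∀ᶠ m in atTop, 2 ≤ n₁ m ∧ 2 ≤ n₂ m ∧ (0 : ℝ) < (n₁ m : ℝ) + n₂ m := by
    filter_upwards [hn₁.eventually_ge_atTop 2, hn₂.eventually_ge_atTop 2] with m h1 h2
    have : (0 : ℝ) < n₁ m := by exact_mod_cast (by omega : 0 < n₁ m)
    exact ⟨h1, h2, by positivity⟩
  refine tendsto_of_tendsto_of_tendsto_of_le_of_le' hlo hhi ?_ ?_
  · filter_upwards [hdev, hev] with m h ⟨h1, h2, hN⟩
    have h3 := h.min_le_lambda2 (G := G₁ m) (H := G₂ m) (by positivity) (by simpa using h1)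
      (by simpa using h2)
    simp only [Fintype.card_fin] at h3
    rw [hmin hN, ← sub_div]
    gcongr
  · filter_upwards [hdev, hev] with m h ⟨h1, h2, hN⟩
    have h3 := h.lambda2_le_mul (G := G₁ m) (H := G₂ m) (by positivity) (by simpa using h1)
      (by simpa using h2)
    have h4 := h.lambda2_le_inl (G := G₁ m) (H := G₂ m) (by positivity) (by simpa using h1)
    have h5 := h.lambda2_le_inr (G := G₁ m) (H := G₂ m) (by positivity) (by simpa using h2)
    simp only [Fintype.card_fin] at h3 h4 h5
    rw [hmin hN, ← add_div]
    gcongr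
    rw [← sub_le_iff_le_add]
    exact le_min (by linarith) (le_min (by linarith) (by linarith))

/-- The maximum norm of the first block of an eigenvector close to the two-cluster indicator. -/
theorem tendsto_norm_block {l K : ℝ} {D lam : ℕ → ℝ} {σ : ℕ → ℝ} {y₁ : ∀ m, Fin (n₁ m) → ℝ}
    {y₂ : ∀ m, Fin (n₂ m) → ℝ} (hn₁ : Tendsto n₁ atTop atTop) (hn₂ : Tendsto n₂ atTop atTop)
    (hK : ∀ᶠ m in atTop, (n₁ m + n₂ m : ℝ) ≤ K * n₂ m)
    (hρ₂ : Tendsto (fun m => (n₂ m : ℝ) / ((n₁ m : ℝ) + n₂ m)) atTop (𝓝 ρ₂))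
    (hl : Tendsto (fun m => lambda2 (G₁ m) / ((n₁ m : ℝ) + n₂ m)) atTop (𝓝 l))
    (hD : Tendsto (fun m => D m / ((n₁ m : ℝ) + n₂ m)) atTop (𝓝 0))
    (hlam : Tendsto (fun m => lam m / ((n₁ m : ℝ) + n₂ m)) atTop (𝓝 p))
    (hp : p < l + p * ρ₂)
    (hrow : ∀ᶠ m in atTop, ∀ u, |rowDeviation p (C m) u| ≤ D m)
    (heq : ∀ᶠ m in atTop, ∀ u, (graphLaplacian (G₁ m)).mulVec (y₁ m) u +
      ∑ v, (if C m u v = true then (1 : ℝ) else 0) * (y₁ m u - y₂ m v) = lam m * y₁ m u)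
    (hσ : ∀ m, σ m = 1 ∨ σ m = -1)
    (hζ₁ : Tendsto (fun m => l2norm fun u =>
      y₁ m u - σ m * √(n₂ m / (((n₁ m : ℝ) + n₂ m) * n₁ m))) atTop (𝓝 0))
    (hζ₂ : Tendsto (fun m => l2norm fun v =>
      y₂ m v + σ m * √(n₁ m / (((n₁ m : ℝ) + n₂ m) * n₂ m))) atTop (𝓝 0)) :
    Tendsto (fun m => ‖fun u => √(((n₁ m : ℝ) + n₂ m) * n₁ m / n₂ m) * y₁ m u - σ m‖) atTop
      (𝓝 0) := by
  -- The diagonal coefficient divided by `N`; its limit is positive precisely because of the gap `p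
  -- < l + p ρ₂`.
  have hden : Tendsto (fun m => lambda2 (G₁ m) / ((n₁ m : ℝ) + n₂ m) * (1 - 1 / n₁ m) +
      p * (n₂ m / ((n₁ m : ℝ) + n₂ m)) - D m / ((n₁ m : ℝ) + n₂ m) -
      lam m / ((n₁ m : ℝ) + n₂ m)) atTop (𝓝 (l + p * ρ₂ - p)) := by
    have h1 : Tendsto (fun m => (1 : ℝ) / n₁ m) atTop (𝓝 0) :=
      tendsto_one_div_atTop_nhds_zero_nat.comp hn₁
    have h2 := ((hl.mul (h1.const_sub 1)).add (hρ₂.const_mul p)).sub hD |>.sub hlam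
    simpa using h2
  have hnum : Tendsto (fun m => √K * (l2norm fun u =>
      y₁ m u - σ m * √(n₂ m / (((n₁ m : ℝ) + n₂ m) * n₁ m))) + (l2norm fun v =>
      y₂ m v + σ m * √(n₁ m / (((n₁ m : ℝ) + n₂ m) * n₂ m))) +
      |lam m / ((n₁ m : ℝ) + n₂ m) - p| + D m / ((n₁ m : ℝ) + n₂ m) * K) atTop (𝓝 0) := by
    have h1 := ((hζ₁.const_mul √K).add hζ₂).add (hlam.sub_const p).abs |>.add (hD.mul_const K)
    simpa using h1
  have hquot := hnum.div hden (by linarith)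
  rw [zero_div] at hquot
  refine squeeze_zero' (Eventually.of_forall fun m => norm_nonneg _) ?_ hquot
  filter_upwards [hden.eventually_const_lt (by linarith : (0 : ℝ) < l + p * ρ₂ - p), hK, hrow, heq,
    hn₁.eventually_ge_atTop 2, hn₂.eventually_ge_atTop 2] with m hpos hKm hrowm heqm h2 h3
  have hm0 : (0 : ℝ) < n₁ m := by exact_mod_cast (by omega : 0 < n₁ m)
  have hk0 : (0 : ℝ) < n₂ m := by exact_mod_cast (by omega : 0 < n₂ m)
  have hu0 : Nonempty (Fin (n₁ m)) := ⟨⟨0, by omega⟩⟩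
  simp only [Pi.div_apply]
  have hσ1 : |σ m| = 1 := by rcases hσ m with h | h <;> simp [h]
  set a := (n₁ m : ℝ)
  set k := (n₂ m : ℝ)
  set N := a + k with hN
  have hN0 : 0 < N := by positivity
  set α := √(N * a / k) with hα
  set β := √(N * k / a) with hβ
  have hα2 : α ^ 2 = N * a / k := Real.sq_sqrt (by positivity)
  have hβ2 : β ^ 2 = N * k / a := Real.sq_sqrt (by positivity)
  have hα0 : 0 < α := Real.sqrt_pos.mpr (by positivity)
  have hβ0 : 0 < β := Real.sqrt_pos.mpr (by positivity)
  have hα1 : √(k / (N * a)) = α⁻¹ := by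
    rw [hα, ← Real.sqrt_inv, inv_div]
  have hβ1 : √(a / (N * k)) = β⁻¹ := by
    rw [hβ, ← Real.sqrt_inv, inv_div]
  have hαβ : α = a / k * β := by
    rw [← sq_eq_sq₀ (by positivity) (by positivity), mul_pow, hα2, hβ2]
    field_simp
  rw [hα1, hβ1]
  set ζ₁ := l2norm fun u => y₁ m u - σ m * α⁻¹
  set ζ₂ := l2norm fun v => y₂ m v + σ m * β⁻¹
  have hh1 : (l2norm fun u => α * y₁ m u - σ m) = α * ζ₁ := by
    rw [← abs_of_pos hα0, ← l2norm_smul, abs_of_pos hα0]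
    congr 1
    ext u
    simp only [Pi.smul_apply, smul_eq_mul]
    field_simp
  have hh2 : (l2norm fun v => β * y₂ m v + σ m) = β * ζ₂ := by
    rw [← abs_of_pos hβ0, ← l2norm_smul, abs_of_pos hβ0]
    congr 1
    ext u
    simp only [Pi.smul_apply, smul_eq_mul]
    field_simp
  have hζ1 : 0 ≤ ζ₁ := l2norm_nonneg _
  have hζ2 : 0 ≤ ζ₂ := l2norm_nonneg _
  rw [pi_norm_le_iff_of_nonempty]
  intro u
  -- The blocks are rescaled so that the indicator becomes `σ` and `-σ`; the ratio of the two
  -- scalings is `α / β = a / k`.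
  have key := abs_entry_mul_le (G := G₁ m) (by simpa using h2) hrowm
    (h := fun u => α * y₁ m u - σ m) (h' := fun v => β * y₂ m v + σ m) (r := a / k) (σ := σ m)
    (l := lam m) (by positivity) (by
      rw [Fintype.card_fin, Fintype.card_fin]
      exact div_mul_cancel₀ a hk0.ne') hσ1 (by
      intro u
      have h4 : (graphLaplacian (G₁ m)).mulVec (fun u => α * y₁ m u - σ m) u =
          α * (graphLaplacian (G₁ m)).mulVec (y₁ m) u := by
        have : (fun u => α * y₁ m u - σ m) = α • y₁ m - fun _ => σ m := rfl
        rw [this, mulVec_sub, graphLaplacian_mulVec_const, mulVec_smul]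
        simp
      rw [h4, sub_add_cancel, mul_left_comm, ← heqm u, mul_add, Finset.mul_sum]
      congr 1
      refine Finset.sum_congr rfl fun v _ => ?_
      rw [add_sub_cancel_right, ← mul_assoc, ← hαβ]
      ring) u
  rw [hh1, hh2] at key
  simp only [Fintype.card_fin] at key
  have hD0 : 0 ≤ D m := (abs_nonneg _).trans (hrowm u)
  -- Rescaling and Cauchy–Schwarz together amplify the Euclidean error by a factor of order `N`
  -- only, which the diagonal coefficient compensates.
  have b1 : √a * α ≤ N * √K := by
    have hK0 : 0 ≤ K := by
      by_contra hK0
      nlinarith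
    refine le_of_sq_le_sq ?_ (by positivity)
    rw [mul_pow, mul_pow, hα2, Real.sq_sqrt hm0.le, Real.sq_sqrt hK0]
    rw [mul_div_assoc', div_le_iff₀ hk0]
    have c1 : a * a ≤ N * (K * k) :=
      mul_le_mul (by linarith) (by linarith) hm0.le hN0.le
    nlinarith
  have b2 : a / k * (√k * β) ≤ N := by
    rw [mul_left_comm, ← hαβ]
    refine le_of_sq_le_sq ?_ hN0.le
    rw [mul_pow, hα2, Real.sq_sqrt hk0.le, mul_div_cancel₀ _ hk0.ne', sq]
    gcongr
    linarith
  have b3 : 1 + a / k ≤ K := by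
    rw [show 1 + a / k = N / k by rw [hN]; field_simp; ring, div_le_iff₀ hk0]
    exact hKm
  have b4 : |lam m - p * N| = N * |lam m / N - p| := by
    rw [← abs_of_pos hN0, ← abs_mul, abs_of_pos hN0]
    congr 1
    field_simp
  rw [Real.norm_eq_abs, le_div_iff₀ hpos]
  refine le_of_mul_le_mul_left ?_ hN0
  calc N * (|α * y₁ m u - σ m| * (lambda2 (G₁ m) / N * (1 - 1 / a) + p * (k / N) - D m / N -
        lam m / N)) =
        (lambda2 (G₁ m) * (1 - 1 / a) + p * k - D m - lam m) * |α * y₁ m u - σ m| := by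
        field_simp
    _ ≤ √a * (α * ζ₁) + a / k * (√k * (β * ζ₂)) + |lam m - p * N| + D m * (1 + a / k) := key
    _ = √a * α * ζ₁ + a / k * (√k * β) * ζ₂ + N * |lam m / N - p| + D m * (1 + a / k) := by
        rw [b4]
        ring
    _ ≤ N * √K * ζ₁ + N * ζ₂ + N * |lam m / N - p| + D m * K := by gcongr
    _ = _ := by field_simp

end Limits

end

noncomputable section

open Matrix

/-! ### Eigenvectors below and above the threshold -/

section Threshold

variable {n₁ n₂ : ℕ → ℕ} {G₁ : ∀ m, SimpleGraph (Fin (n₁ m))}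
  {G₂ : ∀ m, SimpleGraph (Fin (n₂ m))} {p K ρ₁ ρ₂ l₁ l₂ : ℝ}

/-- Both gaps are at least `δ N`, so `HasSmallDeviation.centred_le` bounds the squared distance to
the span of the indicator by `2 (B + D) / (δ N)`; choosing the sign doubles it. -/
theorem exists_sign_tendsto_l2norm {C : ∀ m, Fin (n₁ m) → Fin (n₂ m) → Bool}
    {y : ∀ m, Fin (n₁ m) ⊕ Fin (n₂ m) → ℝ}
    (hn₁ : Tendsto n₁ atTop atTop) (hn₂ : Tendsto n₂ atTop atTop)
    (hρ₁ : Tendsto (fun m => (n₁ m : ℝ) / ((n₁ m : ℝ) + n₂ m)) atTop (𝓝 ρ₁))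
    (hρ₂ : Tendsto (fun m => (n₂ m : ℝ) / ((n₁ m : ℝ) + n₂ m)) atTop (𝓝 ρ₂))
    (hl₁ : Tendsto (fun m => lambda2 (G₁ m) / ((n₁ m : ℝ) + n₂ m)) atTop (𝓝 l₁))
    (hl₂ : Tendsto (fun m => lambda2 (G₂ m) / ((n₁ m : ℝ) + n₂ m)) atTop (𝓝 l₂))
    (hdev : ∀ᶠ m in atTop, HasSmallDeviation p (C m) (6 * √((n₁ m : ℝ) + n₂ m))
      (rowDeviationBound ((n₁ m : ℝ) + n₂ m)))
    (h₁ : p * ρ₁ < l₁) (h₂ : p * ρ₂ < l₂)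
    (hy : ∀ m, IsSpectralSolution (twoClusterGraph (G₁ m) (G₂ m) (C m)) (y m)) :
    ∃ σ : ℕ → ℝ, (∀ m, σ m = 1 ∨ σ m = -1) ∧
      Tendsto (fun m => l2norm fun u : Fin (n₁ m) =>
        y m (Sum.inl u) - σ m * √(n₂ m / (((n₁ m : ℝ) + n₂ m) * n₁ m))) atTop (𝓝 0) ∧
      Tendsto (fun m => l2norm fun v : Fin (n₂ m) =>
        y m (Sum.inr v) + σ m * √(n₁ m / (((n₁ m : ℝ) + n₂ m) * n₂ m))) atTop (𝓝 0) := by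
  obtain ⟨δ, hδ, hδ₁, hδ₂⟩ : ∃ δ > 0, δ < l₁ - p * ρ₁ ∧ δ < l₂ - p * ρ₂ := by
    obtain ⟨δ, h0, h⟩ := exists_between (lt_min (sub_pos.mpr h₁) (sub_pos.mpr h₂))
    exact ⟨δ, h0, h.trans_le (min_le_left _ _), h.trans_le (min_le_right _ _)⟩
  have hsign : ∀ m, ∃ σ : ℝ, (σ = 1 ∨ σ = -1) ∧ (0 < n₁ m → 0 < n₂ m →
      (∑ u, (y m (Sum.inl u) - σ * √(n₂ m / (((n₁ m : ℝ) + n₂ m) * n₁ m))) ^ 2) +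
        ∑ v, (y m (Sum.inr v) + σ * √(n₁ m / (((n₁ m : ℝ) + n₂ m) * n₂ m))) ^ 2 ≤
      2 * ((∑ u, y m (Sum.inl u) ^ 2 - (∑ u, y m (Sum.inl u)) ^ 2 / n₁ m) +
        (∑ v, y m (Sum.inr v) ^ 2 - (∑ u, y m (Sum.inl u)) ^ 2 / n₂ m))) := by
    intro m
    by_cases h : 0 < n₁ m ∧ 0 < n₂ m
    · obtain ⟨σ, hσ, hs⟩ := (hy m).1.sum_sq_block_le (by simpa using h.1) (by simpa using h.2)
      simp only [Fintype.card_fin] at hs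
      exact ⟨σ, hσ, fun _ _ => hs⟩
    -- An arbitrary sign for empty clusters, which do not occur for large `m`.
    · exact ⟨1, Or.inl rfl, fun h1 h2 => absurd ⟨h1, h2⟩ h⟩
  choose σ hσ hs using hsign
  have hη := ((tendsto_deviation_div (n₂ := n₂) hn₁).const_mul (4 / δ)).sqrt
  rw [mul_zero, Real.sqrt_zero] at hη
  have hev : ∀ᶠ m in atTop,
      (∑ u, (y m (Sum.inl u) - σ m * √(n₂ m / (((n₁ m : ℝ) + n₂ m) * n₁ m))) ^ 2) +
        ∑ v, (y m (Sum.inr v) + σ m * √(n₁ m / (((n₁ m : ℝ) + n₂ m) * n₂ m))) ^ 2 ≤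
      4 / δ * ((6 * √((n₁ m : ℝ) + n₂ m) + rowDeviationBound ((n₁ m : ℝ) + n₂ m)) /
        ((n₁ m : ℝ) + n₂ m)) := by
    filter_upwards [(hl₁.sub (hρ₁.const_mul p)).eventually_const_lt hδ₁,
      (hl₂.sub (hρ₂.const_mul p)).eventually_const_lt hδ₂, hdev,
      hn₁.eventually_ge_atTop 2, hn₂.eventually_ge_atTop 2] with m c1 c2 hd h2 h3
    refine (hs m (by omega) (by omega)).trans ?_
    have key := hd.centred_le (by positivity) (by simpa using h2) (by simpa using h3) (hy m)
    have i1 := sq_sum_div_card_le fun u => y m (Sum.inl u)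
    have i2 := sq_sum_div_card_le fun v => y m (Sum.inr v)
    have h4 := (hy m).1.2
    rw [Fintype.sum_sum_type] at h4
    have h5 : ∑ v, y m (Sum.inr v) = -∑ u, y m (Sum.inl u) := by linarith
    rw [h5, neg_sq] at i2
    simp only [Fintype.card_fin] at key i1 i2
    have hN : (0 : ℝ) < (n₁ m : ℝ) + n₂ m := by
      have : (0 : ℝ) < n₁ m := by exact_mod_cast (by omega : 0 < n₁ m)
      positivity
    set N := (n₁ m : ℝ) + n₂ m
    rw [mul_div_assoc', ← sub_div, lt_div_iff₀ hN] at c1 c2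
    set X := ∑ u, y m (Sum.inl u) ^ 2 - (∑ u, y m (Sum.inl u)) ^ 2 / n₁ m
    set Y := ∑ v, y m (Sum.inr v) ^ 2 - (∑ u, y m (Sum.inl u)) ^ 2 / n₂ m
    have hX : 0 ≤ X := sub_nonneg.mpr i1
    have hY : 0 ≤ Y := sub_nonneg.mpr i2
    rw [div_mul_div_comm, le_div_iff₀ (by positivity)]
    have j1 := mul_le_mul_of_nonneg_right c1.le hX
    have j2 := mul_le_mul_of_nonneg_right c2.le hY
    linarith
  refine ⟨σ, hσ, ?_, ?_⟩
  · refine squeeze_zero' (Eventually.of_forall fun m => l2norm_nonneg _) ?_ hη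
    filter_upwards [hev] with m hm
    refine Real.sqrt_le_sqrt (le_trans ?_ hm)
    exact le_add_of_nonneg_right (Finset.sum_nonneg fun _ _ => sq_nonneg _)
  · refine squeeze_zero' (Eventually.of_forall fun m => l2norm_nonneg _) ?_ hη
    filter_upwards [hev] with m hm
    refine Real.sqrt_le_sqrt (le_trans ?_ hm)
    exact le_add_of_nonneg_left (Finset.sum_nonneg fun _ _ => sq_nonneg _)

/-- In `IsSpectralSolution.mul_sum_eq` the coefficient is at most `-(p - g) N` for any fixed `g`
between `f` and `p`, while the right side is at most `102 N / T` for every `T`. -/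
theorem tendsto_sum_block {C : ∀ m, Fin (n₁ m) → Fin (n₂ m) → Bool}
    {y : ∀ m, Fin (n₁ m) ⊕ Fin (n₂ m) → ℝ} {f : ℝ} (hn₁ : Tendsto n₁ atTop atTop)
    (hlam : Tendsto (fun m => lambda2 (twoClusterGraph (G₁ m) (G₂ m) (C m)) /
      ((n₁ m : ℝ) + n₂ m)) atTop (𝓝 f)) (hf : f < p)
    (hy : ∀ m, IsSpectralSolution (twoClusterGraph (G₁ m) (G₂ m) (C m)) (y m))
    (he : ∀ T : ℕ, 0 < T → ∀ᶠ m in atTop,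
      |rowDeviation p (C m) ⬝ᵥ (fun u => y m (Sum.inl u))| ≤ 51 / T * ((n₁ m : ℝ) + n₂ m) ∧
      |rowDeviation p (fun v u => C m u v) ⬝ᵥ (fun v => y m (Sum.inr v))| ≤
        51 / T * ((n₁ m : ℝ) + n₂ m)) :
    Tendsto (fun m => ∑ u, y m (Sum.inl u)) atTop (𝓝 0) ∧
      Tendsto (fun m => ∑ v, y m (Sum.inr v)) atTop (𝓝 0) := by
  have h1 : Tendsto (fun m => ∑ u, y m (Sum.inl u)) atTop (𝓝 0) := by
    obtain ⟨g, hfg, hgp⟩ := exists_between hf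
    rw [Metric.tendsto_atTop']
    intro ε hε
    obtain ⟨T, hT⟩ := exists_nat_gt (102 / (ε * (p - g)))
    have hgp' : 0 < p - g := sub_pos.mpr hgp
    have hT0 : (0 : ℝ) < T := lt_trans (by positivity) hT
    have hev := (he T (by exact_mod_cast hT0)).and
      ((hlam.eventually_lt_const hfg).and (hn₁.eventually_ge_atTop 2))
    obtain ⟨M, hM⟩ := hev.exists_forall_of_atTop
    refine ⟨M, fun m hm => ?_⟩
    obtain ⟨⟨e1, e2⟩, hl, h2⟩ := hM m hm.le
    have hN : (0 : ℝ) < (n₁ m : ℝ) + n₂ m := by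
      have : (0 : ℝ) < n₁ m := by exact_mod_cast (by omega : 0 < n₁ m)
      positivity
    have h3 := (hy m).mul_sum_eq (by simpa using h2) p
    simp only [Fintype.card_fin] at h3
    set N := (n₁ m : ℝ) + n₂ m
    set lam := lambda2 (twoClusterGraph (G₁ m) (G₂ m) (C m))
    set s := ∑ u, y m (Sum.inl u)
    rw [div_lt_iff₀ hN] at hl
    have h4 : |(lam - p * N) * s| ≤ 51 / T * N + 51 / T * N := by
      rw [h3]
      exact (abs_sub _ _).trans (add_le_add e1 e2)
    have h5 : (p - g) * N * |s| ≤ |(lam - p * N) * s| := by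
      rw [abs_mul]
      refine mul_le_mul_of_nonneg_right ?_ (abs_nonneg s)
      rw [abs_of_neg (by nlinarith)]
      linarith
    rw [dist_zero_right, Real.norm_eq_abs]
    have h6 : (p - g) * |s| ≤ 102 / T := by
      have h7 : (p - g) * N * |s| ≤ 51 / T * N + 51 / T * N := h5.trans h4
      have h8 : N * ((p - g) * |s|) ≤ N * (102 / T) := by
        calc N * ((p - g) * |s|) = (p - g) * N * |s| := by ring
          _ ≤ _ := h7
          _ = _ := by ring
      exact le_of_mul_le_mul_left h8 hN
    have h9 : 102 / T < (p - g) * ε := by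
      rw [div_lt_iff₀ (by positivity)] at hT
      rw [div_lt_iff₀ hT0]
      linarith
    exact lt_of_mul_lt_mul_left (h6.trans_lt h9) hgp'.le
  refine ⟨h1, ?_⟩
  have h2 := h1.neg
  rw [neg_zero] at h2
  refine h2.congr fun m => ?_
  have h4 := (hy m).1.2
  rw [Fintype.sum_sum_type] at h4
  linarith

variable {Ω : Type*} [MeasurableSpace Ω] {P : Measure Ω} [IsProbabilityMeasure P]
  {C : ∀ m, Ω → Fin (n₁ m) → Fin (n₂ m) → Bool}

/-- The case `p = 1` has no fluctuations, hence no low rows to build trial vectors from, but the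
correlations vanish outright. -/
theorem ae_rowDeviation_eq_zero (hC : ∀ m, IsIIDBernoulli P (C m) 1) :
    ∀ᵐ ω ∂P, ∀ m, rowDeviation 1 (C m ω) = 0 ∧ rowDeviation 1 (fun v u => C m ω u v) = 0 := by
  have h : ∀ᵐ ω ∂P, ∀ m u v, C m ω u v = true := by
    simp only [ae_all_iff]
    intro m u v
    have h1 := (hC m).prob u v
    rw [ENNReal.ofReal_one] at h1
    exact (prob_compl_eq_zero_iff ((hC m).measurable u v (measurableSet_singleton true))).mpr h1
  filter_upwards [h] with ω hω m
  constructor <;> ext u <;> simp [rowDeviation, centredEntry, hω]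

/-- Above the threshold, the minimizers are asymptotically uncorrelated with the row deviations. -/
theorem ae_eventually_abs_dotProduct_rowDeviation_le
    (hinj : Function.Injective fun m => (n₁ m, n₂ m)) (hn₁ : Tendsto n₁ atTop atTop)
    (hn₂ : Tendsto n₂ atTop atTop) (hK0 : 0 < K)
    (hK₁ : ∀ᶠ m in atTop, (n₁ m + n₂ m : ℝ) ≤ K * n₁ m)
    (hK₂ : ∀ᶠ m in atTop, (n₁ m + n₂ m : ℝ) ≤ K * n₂ m) (hp0 : 0 < p) (hp1 : p ≤ 1)
    (hC : ∀ m, IsIIDBernoulli P (C m) p) {f : ℝ} (hf : f < p)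
    (hlam : ∀ᵐ ω ∂P, Tendsto (fun m => lambda2 (twoClusterGraph (G₁ m) (G₂ m) (C m ω)) /
      ((n₁ m : ℝ) + n₂ m)) atTop (𝓝 f)) :
    ∀ᵐ ω ∂P, ∀ T : ℕ, 0 < T → ∀ᶠ m in atTop, ∀ y : Fin (n₁ m) ⊕ Fin (n₂ m) → ℝ,
      IsSpectralSolution (twoClusterGraph (G₁ m) (G₂ m) (C m ω)) y →
      |rowDeviation p (C m ω) ⬝ᵥ (fun u => y (Sum.inl u))| ≤ 51 / T * ((n₁ m : ℝ) + n₂ m) ∧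
      |rowDeviation p (fun v u => C m ω u v) ⬝ᵥ (fun v => y (Sum.inr v))| ≤
        51 / T * ((n₁ m : ℝ) + n₂ m) := by
  rcases hp1.eq_or_lt with rfl | hp1
  · filter_upwards [ae_rowDeviation_eq_zero hC] with ω hω T hT
    refine Eventually.of_forall fun m y hy => ?_
    rw [(hω m).1, (hω m).2]
    simp only [zero_dotProduct, abs_zero]
    exact ⟨by positivity, by positivity⟩
  have hswap : Function.Injective fun m => (n₂ m, n₁ m) :=
    fun a b hab => hinj (by simpa [and_comm] using hab)
  have hK₁' : ∀ᶠ m in atTop, (n₂ m + n₁ m : ℝ) ≤ K * n₁ m := by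
    simpa only [add_comm] using hK₁
  have hK₂' : ∀ᶠ m in atTop, (n₂ m + n₁ m : ℝ) ≤ K * n₂ m := by
    simpa only [add_comm] using hK₂
  have hdev := ae_eventually_hasSmallDeviation hinj hn₁ hn₂ hK0 hK₁ hK₂ hp0.le hC
  have hrow := ae_eventually_sum_rowDeviation_pow_four_le hinj hn₁ hn₂ hK0 hK₁ hp0.le hC
  have hcol := ae_eventually_sum_rowDeviation_pow_four_le hswap hn₂ hn₁ hK0 hK₂' hp0.le
    fun m => (hC m).swap
  rw [ae_all_iff]
  intro T
  rcases Nat.eq_zero_or_pos T with rfl | hT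
  · simp
  have hT' : (0 : ℝ) < T := by exact_mod_cast hT
  -- With `κ = 1 / T` the final constant is `1 / T + 50 / T = 51 / T`.
  have hreg₁ := ae_eventually_isSpectrallyRegular hinj hn₁ hn₂ hK0 hK₁ hK₂ hp0 hp1 hC G₁
    hT' (inv_pos.mpr hT')
  have hreg₂ := ae_eventually_isSpectrallyRegular hswap hn₂ hn₁ hK0 hK₂' hK₁' hp0 hp1
    (fun m => (hC m).swap) G₂ hT' (inv_pos.mpr hT')
  have hsqrt : Tendsto (fun m => T / √((n₁ m : ℝ) + n₂ m)) atTop (𝓝 0) :=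
    (Real.tendsto_sqrt_atTop.comp (tendsto_size (n₂ := n₂) hn₁)).const_div_atTop _
  filter_upwards [hdev, hrow, hcol, hreg₁, hreg₂, hlam] with ω w1 w2 w3 w4 w5 w6 _
  have hgap := (w6.add hsqrt).eventually_lt_const (by simpa using hf : f + 0 < p)
  filter_upwards [w1, w2, w3, w4, w5, hgap, hn₁.eventually_ge_atTop 2,
    hn₂.eventually_ge_atTop 2] with m w1 w2 w3 w4 w5 hgap h2 h3 y hy
  have hm0 : (0 : ℝ) < n₁ m := by exact_mod_cast (by omega : 0 < n₁ m)
  have hN : (1 : ℝ) ≤ (n₁ m : ℝ) + n₂ m := by exact_mod_cast (by omega : 1 ≤ n₁ m + n₂ m)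
  have hq2 : √((n₁ m : ℝ) + n₂ m) ^ 2 = (n₁ m : ℝ) + n₂ m := Real.sq_sqrt (by positivity)
  have hq1 : 1 ≤ √((n₁ m : ℝ) + n₂ m) := Real.one_le_sqrt.mpr hN
  have hlam0 := lambda2_nonneg (twoClusterGraph (G₁ m) (G₂ m) (C m ω))
  have hsum := hy.1.2
  rw [Fintype.sum_sum_type] at hsum
  have heq₁ := hy.eq_inl (by simpa using h2)
  have heq₂ := hy.eq_inr (by simpa using h2)
  have hμ₁ := fun (x : Fin (n₁ m) → ℝ) (hx : ∑ u, x u = 0) =>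
    lambda2_mul_le_inl (G₁ m) (G₂ m) p (C m ω) (by simpa using h2) hx
  have hμ₂ := fun (x : Fin (n₂ m) → ℝ) (hx : ∑ v, x v = 0) =>
    lambda2_mul_le_inr (G₁ m) (G₂ m) p (C m ω) (by simpa using h3) hx
  set lam := lambda2 (twoClusterGraph (G₁ m) (G₂ m) (C m ω))
  have hgap' : lam + T * √((n₁ m : ℝ) + n₂ m) < p * ((n₁ m : ℝ) + n₂ m) := by
    have h4 : (lam + T * √((n₁ m : ℝ) + n₂ m)) / ((n₁ m : ℝ) + n₂ m) < p := by
      refine lt_of_eq_of_lt ?_ hgap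
      rw [add_div]
      congr 1
      rw [mul_div_assoc, Real.sqrt_div_self, div_eq_mul_inv]
    rwa [div_lt_iff₀ (by linarith)] at h4
  -- The random level stays in the range covered by the union bound, since `lam < p N ≤ N`.
  have hj : ⌊lam / √((n₁ m : ℝ) + n₂ m)⌋₊ ≤ n₁ m + n₂ m := by
    refine Nat.floor_le_of_le ?_
    push_cast
    refine (div_le_self hlam0 hq1).trans ?_
    have : p * ((n₁ m : ℝ) + n₂ m) ≤ (n₁ m : ℝ) + n₂ m := by nlinarith
    have : 0 ≤ T * √((n₁ m : ℝ) + n₂ m) := by positivity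
    linarith
  have hfin : ((T : ℝ)⁻¹ + 50 / T) * ((n₁ m : ℝ) + n₂ m) = 51 / T * ((n₁ m : ℝ) + n₂ m) := by
    field_simp
    norm_num
  constructor
  · have hr := w4 _ hj
    have key := IsSpectrallyRegular.abs_dotProduct_rowDeviation_le (μ := lam)
      (D := rowDeviationBound ((n₁ m : ℝ) + n₂ m)) (by rw [Fintype.card_fin]; omega)
      (by rw [Fintype.card_fin]; omega) hT' hlam0
      (by simpa using hr) (by simpa using w1) (by simpa only [Fintype.card_fin] using w2)
      (by simpa using hgap') hμ₁ hsum hy.1.l2norm_inl_le hy.1.l2norm_inr_le heq₁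
    simpa only [Fintype.card_fin, hfin] using key
  · have hr := w5 _ (hj.trans_eq (add_comm _ _))
    have key := IsSpectrallyRegular.abs_dotProduct_rowDeviation_le (μ := lam)
      (D := rowDeviationBound ((n₁ m : ℝ) + n₂ m)) (by rw [Fintype.card_fin]; omega)
      (by rw [Fintype.card_fin]; omega) hT' hlam0
      (by simpa [add_comm] using hr) (by simpa [add_comm] using w1.swap)
      (by simpa only [Fintype.card_fin] using w3)
      (by simpa [add_comm] using hgap') hμ₂ (by linarith) hy.1.l2norm_inr_le hy.1.l2norm_inl_le heq₂
    simpa only [Fintype.card_fin, add_comm (n₂ m : ℝ), hfin] using key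

end Threshold

end

noncomputable section

open Matrix

/-! ### The threshold -/

section Constants

theorem tendsto_cluster_ratio {n₁ n₂ : ℕ → ℕ} {c ρ₁ ρ₂ : ℝ} (hn₁ : Tendsto n₁ atTop atTop)
    (hc_pos : 0 < c)
    (hc : Tendsto (fun m => (min (n₁ m) (n₂ m) : ℝ) / (max (n₁ m) (n₂ m) : ℝ)) atTop (𝓝 c))
    (hρ₁ : Tendsto (fun m => (n₁ m : ℝ) / ((n₁ m : ℝ) + n₂ m)) atTop (𝓝 ρ₁))
    (hρ₂ : Tendsto (fun m => (n₂ m : ℝ) / ((n₁ m : ℝ) + n₂ m)) atTop (𝓝 ρ₂)) :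
    ρ₁ + ρ₂ = 1 ∧ min ρ₁ ρ₂ = c / (1 + c) ∧ max ρ₁ ρ₂ = 1 / (1 + c) := by
  have hN : ∀ᶠ m in atTop, (0 : ℝ) < (n₁ m : ℝ) + n₂ m := by
    filter_upwards [hn₁.eventually_gt_atTop 0] with m h
    have : (0 : ℝ) < n₁ m := by exact_mod_cast h
    positivity
  have h1 : ρ₁ + ρ₂ = 1 := by
    refine tendsto_nhds_unique (hρ₁.add hρ₂) (tendsto_const_nhds.congr' ?_)
    filter_upwards [hN] with m h
    rw [← add_div, div_self h.ne']
  have hmax : 0 < max ρ₁ ρ₂ := by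
    rcases le_total ρ₁ ρ₂ with h | h
    · rw [max_eq_right h]; linarith
    · rw [max_eq_left h]; linarith
  have h2 : min ρ₁ ρ₂ / max ρ₁ ρ₂ = c := by
    refine tendsto_nhds_unique ((hρ₁.min hρ₂).div (hρ₁.max hρ₂) hmax.ne') (hc.congr' ?_)
    filter_upwards [hN] with m h
    rw [Pi.div_apply, min_div_div_right h.le, max_div_div_right h.le,
      div_div_div_cancel_right₀ h.ne']
  have h3 := min_add_max ρ₁ ρ₂
  rw [div_eq_iff hmax.ne'] at h2
  have h4 : max ρ₁ ρ₂ * (1 + c) = 1 := by linarith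
  have h5 : (1 + c) ≠ 0 := by positivity
  refine ⟨h1, ?_, ?_⟩
  · rw [eq_div_iff h5, h2]
    linear_combination c * h4
  · rw [eq_div_iff h5, h4]

theorem eventually_size_le {n₁ n₂ : ℕ → ℕ} {ρ μ : ℝ} (hn₁ : Tendsto n₁ atTop atTop)
    (hμ : 0 < μ) (hμρ : μ < ρ)
    (hρ : Tendsto (fun m => (n₁ m : ℝ) / ((n₁ m : ℝ) + n₂ m)) atTop (𝓝 ρ)) :
    ∀ᶠ m in atTop, (n₁ m + n₂ m : ℝ) ≤ μ⁻¹ * n₁ m := by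
  filter_upwards [hρ.eventually_const_lt hμρ, hn₁.eventually_gt_atTop 0] with m h h0
  have : (0 : ℝ) < n₁ m := by exact_mod_cast h0
  rw [lt_div_iff₀ (by positivity)] at h
  rw [le_inv_mul_iff₀ hμ]
  exact h.le

/-- The larger and smaller of `ρ₁`, `ρ₂` are `(1 ± |ρ₁ - ρ₂|) / 2`. Both quotients are at least the
smaller `l` over the larger `ρ`, and the one with the smaller `l` is at most that `l` over the
smaller `ρ`. -/
theorem threshold_bounds {ρ₁ ρ₂ l₁ l₂ : ℝ} (hρ₁ : 0 < ρ₁) (hρ₂ : 0 < ρ₂) (hρ : ρ₁ + ρ₂ = 1)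
    (hl₁ : 0 ≤ l₁) (hl₂ : 0 ≤ l₂) :
    2 * min l₁ l₂ / (1 + |ρ₁ - ρ₂|) ≤ min (l₁ / ρ₁) (l₂ / ρ₂) ∧
      min (l₁ / ρ₁) (l₂ / ρ₂) ≤ 2 * min l₁ l₂ / (1 - |ρ₁ - ρ₂|) := by
  have h1 : 0 < 1 - |ρ₁ - ρ₂| := by
    rw [sub_pos, abs_lt]
    constructor <;> linarith
  have h2 : 0 ≤ min l₁ l₂ := le_min hl₁ hl₂
  have h3 := le_abs_self (ρ₁ - ρ₂)
  have h4 := neg_abs_le (ρ₁ - ρ₂)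
  constructor
  · refine le_min ?_ ?_
    · rw [div_le_div_iff₀ (by positivity) hρ₁]
      have := min_le_left l₁ l₂
      nlinarith
    · rw [div_le_div_iff₀ (by positivity) hρ₂]
      have := min_le_right l₁ l₂
      nlinarith
  · rcases le_total l₁ l₂ with h | h
    · rw [min_eq_left h]
      refine (min_le_left _ _).trans ?_
      rw [div_le_div_iff₀ hρ₁ h1]
      nlinarith
    · rw [min_eq_right h]
      refine (min_le_right _ _).trans ?_
      rw [div_le_div_iff₀ hρ₂ h1]
      nlinarith

end Constants

end

/-! ### Proof of the theorem -/

theorem corollary4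
    -- a sequence of pairs of connected clusters, of distinct pairs of sizes tending to infinity
    (n₁ n₂ : ℕ → ℕ)
    (hsizes : Function.Injective fun m => (n₁ m, n₂ m))
    (hn₁ : Tendsto n₁ atTop atTop) (hn₂ : Tendsto n₂ atTop atTop)
    (G₁ : ∀ m, SimpleGraph (Fin (n₁ m))) (G₂ : ∀ m, SimpleGraph (Fin (n₂ m)))
    (hG₁ : ∀ m, (G₁ m).Connected) (hG₂ : ∀ m, (G₂ m).Connected)
    -- the limit values
    (c ρ₁ ρ₂ l₁ l₂ cstar : ℝ)
    (hc_pos : 0 < c)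
    (hc : Tendsto (fun m => (min (n₁ m) (n₂ m) : ℝ) / (max (n₁ m) (n₂ m) : ℝ)) atTop (𝓝 c))
    (hρ₁ : Tendsto (fun m => (n₁ m : ℝ) / ((n₁ m : ℝ) + n₂ m)) atTop (𝓝 ρ₁))
    (hρ₂ : Tendsto (fun m => (n₂ m : ℝ) / ((n₁ m : ℝ) + n₂ m)) atTop (𝓝 ρ₂))
    (hl₁ : Tendsto (fun m => lambda2 (G₁ m) / ((n₁ m : ℝ) + n₂ m)) atTop (𝓝 l₁))
    (hl₂ : Tendsto (fun m => lambda2 (G₂ m) / ((n₁ m : ℝ) + n₂ m)) atTop (𝓝 l₂))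
    (hcstar : Tendsto
      (fun m => (lambda2 (G₁ m) + lambda2 (G₂ m) - |lambda2 (G₁ m) - lambda2 (G₂ m)|) /
        (2 * ((n₁ m : ℝ) + n₂ m))) atTop (𝓝 cstar)) :
    ∃ pstar : ℝ,
      -- (c)
      (2 * cstar / (1 + |ρ₁ - ρ₂|) ≤ pstar ∧ pstar ≤ 2 * cstar / (1 - |ρ₁ - ρ₂|)) ∧
      ∀ p : ℝ, 0 ≤ p → p ≤ 1 →
      ∀ (Ω : Type*) [MeasurableSpace Ω] (P : Measure Ω) [IsProbabilityMeasure P]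
        (C : ∀ m, Ω → Fin (n₁ m) → Fin (n₂ m) → Bool),
        (∀ m, IsIIDBernoulli P (C m) p) →
        -- (a), up to the threshold
        (p ≤ pstar → ∀ᵐ ω ∂P,
          Tendsto (fun m => lambda2 (twoClusterGraph (G₁ m) (G₂ m) (C m ω)) /
            ((n₁ m : ℝ) + n₂ m)) atTop (𝓝 p)) ∧
        -- (a), above the threshold
        (pstar < p → ∀ᵐ ω ∂P, ∀ ε > 0, ∀ᶠ m in atTop,
          cstar + c / (1 + c) * p - ε ≤
              lambda2 (twoClusterGraph (G₁ m) (G₂ m) (C m ω)) / ((n₁ m : ℝ) + n₂ m) ∧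
            lambda2 (twoClusterGraph (G₁ m) (G₂ m) (C m ω)) / ((n₁ m : ℝ) + n₂ m) ≤
              cstar + 1 / (1 + c) * p + ε) ∧
        -- (b), below the threshold
        (p < pstar → ∀ᵐ ω ∂P, ∀ y : ∀ m, Fin (n₁ m) ⊕ Fin (n₂ m) → ℝ,
          (∀ m, IsSpectralSolution (twoClusterGraph (G₁ m) (G₂ m) (C m ω)) (y m)) →
          ∃ σ : ℕ → ℝ, (∀ m, σ m = 1 ∨ σ m = -1) ∧
            -- every entry, uniformly (`‖·‖` is the maximum norm here)
            Tendsto (fun m => ‖fun u : Fin (n₁ m) =>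
              √(((n₁ m : ℝ) + n₂ m) * n₁ m / n₂ m) * y m (Sum.inl u) - σ m‖) atTop (𝓝 0) ∧
            Tendsto (fun m => ‖fun v : Fin (n₂ m) =>
              √(((n₁ m : ℝ) + n₂ m) * n₂ m / n₁ m) * y m (Sum.inr v) + σ m‖) atTop (𝓝 0) ∧
            -- in Euclidean norm, for the blocks of the unit vector `y m` itself
            Tendsto (fun m => l2norm fun u : Fin (n₁ m) =>
              y m (Sum.inl u) - σ m * √(n₂ m / (((n₁ m : ℝ) + n₂ m) * n₁ m))) atTop (𝓝 0) ∧
            Tendsto (fun m => l2norm fun v : Fin (n₂ m) =>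
              y m (Sum.inr v) + σ m * √(n₁ m / (((n₁ m : ℝ) + n₂ m) * n₂ m))) atTop (𝓝 0)) ∧
        -- (b), above the threshold
        (pstar < p → ∀ᵐ ω ∂P, ∀ y : ∀ m, Fin (n₁ m) ⊕ Fin (n₂ m) → ℝ,
          (∀ m, IsSpectralSolution (twoClusterGraph (G₁ m) (G₂ m) (C m ω)) (y m)) →
          Tendsto (fun m => ∑ u : Fin (n₁ m), y m (Sum.inl u)) atTop (𝓝 0) ∧
          Tendsto (fun m => ∑ v : Fin (n₂ m), y m (Sum.inr v)) atTop (𝓝 0)) := by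
  have hρ := tendsto_cluster_ratio hn₁ hc_pos hc hρ₁ hρ₂
  obtain ⟨hρsum, hρmin, hρmax⟩ := hρ
  have hmin0 : 0 < min ρ₁ ρ₂ := by rw [hρmin]; positivity
  obtain ⟨hρ₁0, hρ₂0⟩ := lt_min_iff.mp hmin0
  obtain ⟨μ, hμ0, hμ⟩ := exists_between hmin0
  have hswapρ₂ : Tendsto (fun m => (n₂ m : ℝ) / ((n₂ m : ℝ) + n₁ m)) atTop (𝓝 ρ₂) := by
    simpa only [add_comm] using hρ₂
  have hswapρ₁ : Tendsto (fun m => (n₁ m : ℝ) / ((n₂ m : ℝ) + n₁ m)) atTop (𝓝 ρ₁) := by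
    simpa only [add_comm] using hρ₁
  have hswapl₂ : Tendsto (fun m => lambda2 (G₂ m) / ((n₂ m : ℝ) + n₁ m)) atTop (𝓝 l₂) := by
    simpa only [add_comm] using hl₂
  have hK0 : 0 < μ⁻¹ := inv_pos.mpr hμ0
  have hK₁ := eventually_size_le hn₁ hμ0 (hμ.trans_le (min_le_left _ _)) hρ₁
  have hK₂' := eventually_size_le hn₂ hμ0 (hμ.trans_le (min_le_right _ _)) hswapρ₂
  have hK₂ : ∀ᶠ m in atTop, (n₁ m + n₂ m : ℝ) ≤ μ⁻¹ * n₂ m := by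
    simpa only [add_comm] using hK₂'
  have hK₁' : ∀ᶠ m in atTop, (n₂ m + n₁ m : ℝ) ≤ μ⁻¹ * n₁ m := by
    simpa only [add_comm] using hK₁
  have hl₁0 : 0 ≤ l₁ := ge_of_tendsto' hl₁ fun m => div_nonneg (lambda2_nonneg _) (by positivity)
  have hl₂0 : 0 ≤ l₂ := ge_of_tendsto' hl₂ fun m => div_nonneg (lambda2_nonneg _) (by positivity)
  -- Because `(x + y - |x - y|) / 2 = min x y`.
  have hcs : cstar = min l₁ l₂ := by
    refine tendsto_nhds_unique hcstar ((hl₁.min hl₂).congr fun m => ?_)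
    have hN : (0 : ℝ) ≤ (n₁ m : ℝ) + n₂ m := by positivity
    have h := min_add_max (lambda2 (G₁ m)) (lambda2 (G₂ m))
    have h' := max_sub_min_eq_abs' (lambda2 (G₁ m)) (lambda2 (G₂ m))
    rw [min_div_div_right hN, ← h', ← h, ← div_div]
    ring
  rw [hcs, ← hρmin, ← hρmax]
  have hDtend : Tendsto (fun m => rowDeviationBound ((n₁ m : ℝ) + n₂ m) / ((n₁ m : ℝ) + n₂ m))
      atTop (𝓝 0) := tendsto_rowDeviationBound_div.comp (tendsto_size hn₁)
  -- Since `ρ₁ + ρ₂ = 1`, the condition `p ≤ l₁ + p ρ₂` is `p ρ₁ ≤ l₁`, and likewise for the second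
  -- cluster; the threshold is where the first of these fails.
  refine ⟨min (l₁ / ρ₁) (l₂ / ρ₂), threshold_bounds hρ₁0 hρ₂0 hρsum hl₁0 hl₂0, ?_⟩
  intro p hp0 hp1 Ω _ P _ C hC
  have hdev := ae_eventually_hasSmallDeviation hsizes hn₁ hn₂ hK0 hK₁ hK₂ hp0 hC
  have hlam : ∀ᵐ ω ∂P, Tendsto (fun m => lambda2 (twoClusterGraph (G₁ m) (G₂ m) (C m ω)) /
      ((n₁ m : ℝ) + n₂ m)) atTop (𝓝 (min p (min (l₁ + p * ρ₂) (l₂ + p * ρ₁)))) := by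
    filter_upwards [hdev] with ω hω
    exact tendsto_lambda2_div hn₁ hn₂ hρ₁ hρ₂ hl₁ hl₂ hω
  have hbelow : p ≤ min (l₁ / ρ₁) (l₂ / ρ₂) →
      min p (min (l₁ + p * ρ₂) (l₂ + p * ρ₁)) = p := by
    intro h
    obtain ⟨h1, h2⟩ := le_min_iff.mp h
    rw [le_div_iff₀ hρ₁0] at h1
    rw [le_div_iff₀ hρ₂0] at h2
    refine min_eq_left (le_min ?_ ?_)
    · linear_combination h1 - p * hρsum
    · linear_combination h2 - p * hρsum
  have habove : min (l₁ / ρ₁) (l₂ / ρ₂) < p →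
      0 < p ∧ min (l₁ + p * ρ₂) (l₂ + p * ρ₁) < p := by
    intro h
    refine ⟨lt_of_le_of_lt (le_min (by positivity) (by positivity)) h, ?_⟩
    rcases min_lt_iff.mp h with h | h
    · rw [div_lt_iff₀ hρ₁0] at h
      refine (min_le_left _ _).trans_lt ?_
      linear_combination h + p * hρsum
    · rw [div_lt_iff₀ hρ₂0] at h
      refine (min_le_right _ _).trans_lt ?_
      linear_combination h + p * hρsum
  refine ⟨fun h => ?_, fun h => ?_, fun h => ?_, fun h => ?_⟩
  · rw [hbelow h] at hlam
    exact hlam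
  · rw [min_eq_right (habove h).2.le] at hlam
    filter_upwards [hlam] with ω hω ε hε
    have h1 : min l₁ l₂ + min ρ₁ ρ₂ * p ≤ min (l₁ + p * ρ₂) (l₂ + p * ρ₁) := by
      refine le_min ?_ ?_
      · rw [mul_comm p]
        exact add_le_add (min_le_left _ _) (mul_le_mul_of_nonneg_right (min_le_right _ _) hp0)
      · rw [mul_comm p]
        exact add_le_add (min_le_right _ _) (mul_le_mul_of_nonneg_right (min_le_left _ _) hp0)
    have h2 : min (l₁ + p * ρ₂) (l₂ + p * ρ₁) ≤ min l₁ l₂ + max ρ₁ ρ₂ * p := by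
      rcases le_total l₁ l₂ with hl | hl
      · rw [min_eq_left hl, mul_comm (max _ _)]
        refine (min_le_left _ _).trans ?_
        gcongr
        exact le_max_right _ _
      · rw [min_eq_right hl, mul_comm (max _ _)]
        refine (min_le_right _ _).trans ?_
        gcongr
        exact le_max_left _ _
    filter_upwards [hω.eventually_const_lt (sub_lt_self _ hε),
      hω.eventually_lt_const (lt_add_of_pos_right _ hε)] with m h3 h4
    constructor <;> linarith
  · rw [hbelow h.le] at hlam
    obtain ⟨h1, h2⟩ := lt_min_iff.mp h
    rw [lt_div_iff₀ hρ₁0] at h1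
    rw [lt_div_iff₀ hρ₂0] at h2
    filter_upwards [hdev, hlam] with ω hω hlamω y hy
    obtain ⟨σ, hσ, hζ₁, hζ₂⟩ :=
      exists_sign_tendsto_l2norm hn₁ hn₂ hρ₁ hρ₂ hl₁ hl₂ hω h1 h2 hy
    refine ⟨σ, hσ, ?_, ?_, hζ₁, hζ₂⟩
    · refine tendsto_norm_block hn₁ hn₂ hK₂ hρ₂ hl₁ hDtend hlamω
        (by linear_combination h1 - p * hρsum) (hω.mono fun m hm => hm.row) ?_ hσ hζ₁ hζ₂
      filter_upwards [hn₁.eventually_ge_atTop 2] with m hm u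
      exact (hy m).eq_inl (by simpa using hm) u
    -- The second block follows by exchanging the clusters, which reverses the sign of the
    -- indicator.
    · have key := tendsto_norm_block (n₁ := n₂) (n₂ := n₁) (G₁ := G₂) (σ := fun m => -σ m)
        (C := fun m v u => C m ω u v) (p := p)
        (D := fun m => rowDeviationBound ((n₁ m : ℝ) + n₂ m))
        (lam := fun m => lambda2 (twoClusterGraph (G₁ m) (G₂ m) (C m ω)))
        (y₁ := fun m v => y m (Sum.inr v)) (y₂ := fun m u => y m (Sum.inl u))
        hn₂ hn₁ hK₁' hswapρ₁ hswapl₂ (by simpa only [add_comm] using hDtend)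
        (by simpa only [add_comm] using hlamω)
        (by linear_combination h2 - p * hρsum) (hω.mono fun m hm => hm.col) (by
          filter_upwards [hn₁.eventually_ge_atTop 2] with m hm v
          exact (hy m).eq_inr (by simpa using hm) v)
        (fun m => by rcases hσ m with h | h <;> simp [h])
        (by simpa only [neg_mul, sub_neg_eq_add, add_comm (n₂ _ : ℝ)] using hζ₂)
        (by simpa only [neg_mul, ← sub_eq_add_neg, add_comm (n₂ _ : ℝ)] using hζ₁)
      simpa only [sub_neg_eq_add, add_comm (n₂ _ : ℝ)] using key
  · obtain ⟨hp, hf⟩ := habove h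
    rw [min_eq_right hf.le] at hlam
    have hcorr := ae_eventually_abs_dotProduct_rowDeviation_le hsizes hn₁ hn₂ hK0 hK₁ hK₂ hp hp1 hC
      hf hlam
    filter_upwards [hlam, hcorr] with ω hlamω hω y hy
    exact tendsto_sum_block hn₁ hlamω hf hy fun T hT =>
      (hω T hT).mono fun m hm => hm (y m) (hy m)
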